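/- **Definitions.** A stable matching (SM) instance of size $n\ge 1$ consists of $n$ men and $n$ women, each of whom has a strict preference list ranking all $n$ members of the other group; it has $2n$ agents. A matching is a bijection between men and women; it is stable if no man and woman both prefer each other to their partners. A rotation exposed in a stable matching $\mu$ is a nonempty circular list of distinct pairs $(m_1,w_1),\dots,(m_\ell,w_\ell)$ of $\mu$ such that, for each $i$ (indices modulo $\ell$), $w_{i+1}$ is the first woman after $w_i$ on $m_i$'s list who prefers $m_i$ to her partner in $\mu$. Eliminating it re-matches each $m_i$ with $w_{i+1}$. Let $R(I)$ be the set of all rotations exposed in stable matchings of $I$, and for a stable matching $\mu$ let $R_\mu$ be the set of rotations eliminated in passing from the man-optimal stable matching to $\mu$ by successive eliminations. Write $\rho\prec\rho'$ if $\rho\in R_\mu$ for every stable matching $\mu$ in which $\rho'$ is exposed. The instance $I$ *realizes* a finite poset $\mathcal P$ if $(R(I),\prec)$ is isomorphic to $\mathcal P$. An SM instance has *$k$-attribute preferences* if every agent $a$ can be given a profile $(\bar a,\varphi_a)$, with $\bar a\in\mathbb R^k$ and $\varphi_a:\mathbb R^k\to\mathbb R$ linear, such that $a$ prefers $b$ to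 $b'$ if and only if $\varphi_a(\bar b)>\varphi_a(\bar b')$. Running time is measured on a random access machine that adds, subtracts, multiplies, compares, reads and writes integer words at unit cost. The Hasse diagram of a poset with $p$ elements and $q$ covering pairs is given by $p$, $q$ and an arbitrarily ordered list of its edges $(u,v)$ (meaning that $v$ covers $u$), for an arbitrary numbering of the elements. **Theorem.** There is a constant $C$ such that for every $k\ge 6$ (in particular for $k=6$) there are a program and constants $T,B$ with the following property. For every finite poset $\mathcal P$ whose Hasse diagram has $p$ vertices and $q$ edges, the program, given the Hasse diagram of $\mathcal P$, computes the profiles (integer vectors, and linear functions with integer coefficients) of an SM instance with $k$-attribute preferences that realizes $\mathcal P$ and has at most $C\cdot\max\{1,p+q\}$ agents. It halts within $T\cdot\max\{1,p+q\}$ steps and writes only words of absolute value at most $(p+q+2)^B$, that is, of $O(\log(p+q+2))$ bits. Thus all finite posets are realized, with $O(p+q)$ agents and in $O(p+q)$ time, by instances with $k$-attribute preferences, for every $k\ge 6$. -/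

import Mathlib

namespace StableMatching

/-! ## Stable matching instances with complete preference lists -/

/-- A stable matching instance of size `n` with complete preference lists. The men and the women
are each indexed by `Fin n`. `manRank m w` is the position of `w` in the preference list of `m`
(a smaller value means more preferred), and `womanRank w m` is the position of `m` in the
preference list of `w`. -/
structure SMInstance (n : ℕ) where
  manRank : Fin n → Equiv.Perm (Fin n)
  womanRank : Fin n → Equiv.Perm (Fin n)

/-- A matching of `n` men with `n` women (every agent is in exactly one pair), as the bijection
sending each man to his partner. -/
abbrev Matching (n : ℕ) := Equiv.Perm (Fin n)

namespace SMInstance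

variable {n : ℕ} (I : SMInstance n)

/-- Man `m` prefers woman `w` to woman `w'`. -/
def ManPrefers (m w w' : Fin n) : Prop := I.manRank m w < I.manRank m w'

/-- Woman `w` prefers man `m` to man `m'`. -/
def WomanPrefers (w m m' : Fin n) : Prop := I.womanRank w m < I.womanRank w m'

/-- `μ` has no blocking pair. -/
def Stable (μ : Matching n) : Prop :=
  ∀ m w, ¬ (I.ManPrefers m w (μ m) ∧ I.WomanPrefers w m (μ.symm w))

/-- `μ` is the man-optimal stable matching: every man has his best stable partner. -/
def ManOptimal (μ : Matching n) : Prop :=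
  I.Stable μ ∧ ∀ ν : Matching n, I.Stable ν → ∀ m, I.manRank m (μ m) ≤ I.manRank m (ν m)

/-- The circular list `ρ` of distinct man-woman pairs is a rotation exposed in `μ`: its pairs
`(mᵢ, wᵢ)` belong to `μ`, and `wᵢ₊₁` is the first woman after `wᵢ` on the list of `mᵢ` who prefers
`mᵢ` to her partner in `μ`. -/
def Exposed (μ : Matching n) (ρ : Cycle (Fin n × Fin n)) : Prop :=
  ρ ≠ Cycle.nil ∧ ρ.Nodup ∧ (∀ x ∈ ρ, μ x.1 = x.2) ∧
    ρ.Chain fun x y =>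
      I.ManPrefers x.1 x.2 y.2 ∧ I.WomanPrefers y.2 x.1 y.1 ∧
        ∀ w, I.ManPrefers x.1 x.2 w → I.ManPrefers x.1 w y.2 →
          ¬ I.WomanPrefers w x.1 (μ.symm w)

/-- `μ'` is the elimination of `ρ` from `μ`: each `mᵢ` in `ρ` is now matched to `wᵢ₊₁`, and the
other men keep their partners. -/
def IsElimination (μ : Matching n) (ρ : Cycle (Fin n × Fin n)) (μ' : Matching n) : Prop :=
  (∀ m, (∀ x ∈ ρ, x.1 ≠ m) → μ' m = μ m) ∧ ρ.Chain fun x y => μ' x.1 = y.2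

/-- `I.ReachedBy μ S`: starting from the man-optimal stable matching, one can arrive at `μ` by
successively eliminating exposed rotations, the set of eliminated rotations being `S`. -/
inductive ReachedBy : Matching n → Set (Cycle (Fin n × Fin n)) → Prop
  | base {μ : Matching n} : I.ManOptimal μ → ReachedBy μ ∅
  | step {μ μ' : Matching n} {S : Set (Cycle (Fin n × Fin n))} {ρ : Cycle (Fin n × Fin n)} :
      ReachedBy μ S → I.Stable μ → I.Exposed μ ρ → IsElimination μ ρ μ' →
        ReachedBy μ' (insert ρ S)

/-- The set `R(I)` of all rotations of `I`. -/
def rotations : Set (Cycle (Fin n × Fin n)) := {ρ | ∃ μ, I.Stable μ ∧ I.Exposed μ ρ}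

/-- The set `R_μ` of rotations eliminated on the way from the man-optimal stable matching
to `μ`. -/
def eliminated (μ : Matching n) : Set (Cycle (Fin n × Fin n)) :=
  {ρ | ∃ S, I.ReachedBy μ S ∧ ρ ∈ S}

/-- `ρ` precedes `ρ'` if `ρ` was eliminated in every stable matching in which `ρ'` is exposed. -/
def Precedes (ρ ρ' : I.rotations) : Prop :=
  ∀ μ : Matching n, I.Stable μ → I.Exposed μ ρ'.1 → ρ.1 ∈ I.eliminated μ

/-- `I` realizes the poset `X`: its rotation poset is isomorphic to `X`. -/
def Realizes (X : Type*) [PartialOrder X] : Prop :=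
  Nonempty ((fun x y : X => x < y) ≃r I.Precedes)

end SMInstance

/-! ## The `k`-attribute model -/

/-- Profiles for `n` men and `n` women: every agent has a vector in `ℝ^k` and a linear
function on `ℝ^k`. -/
structure Profiles (k n : ℕ) where
  manVec : Fin n → Fin k → ℝ
  manFun : Fin n → (Fin k → ℝ) →ₗ[ℝ] ℝ
  womanVec : Fin n → Fin k → ℝ
  womanFun : Fin n → (Fin k → ℝ) →ₗ[ℝ] ℝ

/-- The preference lists of `I` are those given by the profiles `A`: each agent ranks the agents
of the other group by strictly decreasing value of the agent's linear function. As ranks are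
bijective, this includes the absence of ties. -/
def SMInstance.InducedBy {k n : ℕ} (I : SMInstance n) (A : Profiles k n) : Prop :=
  (∀ m w w', I.ManPrefers m w w' ↔ A.manFun m (A.womanVec w') < A.manFun m (A.womanVec w)) ∧
  (∀ w m m', I.WomanPrefers w m m' ↔ A.womanFun w (A.manVec m') < A.womanFun w (A.manVec m))

/-! ## A random access machine with unit-cost instructions on bounded words -/

/-- The state of the machine: integer registers, and integer arrays. -/
structure State where
  reg : ℕ → ℤ
  arr : ℕ → ℕ → ℤ

/-- Write `v` to register `d`. -/
def State.setReg (s : State) (d : ℕ) (v : ℤ) : State :=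
  { s with reg := Function.update s.reg d v }

/-- Write `v` to cell `i` of array `a`. -/
def State.setArr (s : State) (a i : ℕ) (v : ℤ) : State :=
  { s with arr := Function.update s.arr a (Function.update (s.arr a) i v) }

/-- Structured random access machine programs. The names of registers and arrays are constants
of the program; only array cells are addressed indirectly. -/
inductive Program
  /-- register `d` becomes the constant `c` -/
  | const (d : ℕ) (c : ℤ)
  /-- register `d` becomes the sum of registers `x` and `y` -/
  | add (d x y : ℕ)
  /-- register `d` becomes the difference of registers `x` and `y` -/
  | sub (d x y : ℕ)
  /-- register `d` becomes the product of registers `x` and `y` -/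
  | mul (d x y : ℕ)
  /-- register `d` becomes the cell of array `a` whose index is in register `x` -/
  | load (d a x : ℕ)
  /-- the cell of array `a` whose index is in register `x` becomes register `y` -/
  | store (a x y : ℕ)
  /-- sequential composition -/
  | seq (P Q : Program)
  /-- if register `x` is positive then `P` else `Q` -/
  | branch (x : ℕ) (P Q : Program)
  /-- while register `x` is positive do `P` -/
  | loop (x : ℕ) (P : Program)

/-- `Exec W P s t s'`: started in state `s`, the program `P` halts in state `s'` after `t` steps,
and all words it writes have absolute value at most `W`. Every instruction and every test costs
one step. There is no rule for a negative array index or for writing a word that is too large. -/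
inductive Exec (W : ℤ) : Program → State → ℕ → State → Prop
  | const {d : ℕ} {c : ℤ} {s : State} : |c| ≤ W → Exec W (.const d c) s 1 (s.setReg d c)
  | add {d x y : ℕ} {s : State} : |s.reg x + s.reg y| ≤ W →
      Exec W (.add d x y) s 1 (s.setReg d (s.reg x + s.reg y))
  | sub {d x y : ℕ} {s : State} : |s.reg x - s.reg y| ≤ W →
      Exec W (.sub d x y) s 1 (s.setReg d (s.reg x - s.reg y))
  | mul {d x y : ℕ} {s : State} : |s.reg x * s.reg y| ≤ W →
      Exec W (.mul d x y) s 1 (s.setReg d (s.reg x * s.reg y))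
  | load {d a x : ℕ} {s : State} : 0 ≤ s.reg x → |s.arr a (s.reg x).toNat| ≤ W →
      Exec W (.load d a x) s 1 (s.setReg d (s.arr a (s.reg x).toNat))
  | store {a x y : ℕ} {s : State} : 0 ≤ s.reg x → |s.reg y| ≤ W →
      Exec W (.store a x y) s 1 (s.setArr a (s.reg x).toNat (s.reg y))
  | seq {P Q : Program} {s s' s'' : State} {t t' : ℕ} :
      Exec W P s t s' → Exec W Q s' t' s'' → Exec W (.seq P Q) s (t + t') s''
  | branch_pos {x : ℕ} {P Q : Program} {s s' : State} {t : ℕ} :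
      0 < s.reg x → Exec W P s t s' → Exec W (.branch x P Q) s (t + 1) s'
  | branch_neg {x : ℕ} {P Q : Program} {s s' : State} {t : ℕ} :
      ¬ 0 < s.reg x → Exec W Q s t s' → Exec W (.branch x P Q) s (t + 1) s'
  | loop_pos {x : ℕ} {P : Program} {s s' s'' : State} {t t' : ℕ} :
      0 < s.reg x → Exec W P s t s' → Exec W (.loop x P) s' t' s'' →
        Exec W (.loop x P) s (t + t' + 1) s''
  | loop_neg {x : ℕ} {P : Program} {s : State} :
      ¬ 0 < s.reg x → Exec W (.loop x P) s 1 s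

/-! ## Input and output -/

/-- The Hasse diagram of a finite poset `X`, given with an arbitrary numbering of its `p` elements
and an arbitrary list, without repetition, of its edges `(u, v)`, where `u` is covered by `v`. -/
structure HasseDiagram (X : Type*) [PartialOrder X] where
  p : ℕ
  label : X ≃ Fin p
  edges : List (Fin p × Fin p)
  nodup : edges.Nodup
  mem_edges : ∀ u v : X, (label u, label v) ∈ edges ↔ u ⋖ v

/-- The number of edges. -/
def HasseDiagram.q {X : Type*} [PartialOrder X] (H : HasseDiagram X) : ℕ := H.edges.length

/-- The initial state on input `H`: registers `0` and `1` hold `p` and `q`, cell `i` of array `0`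
holds the tail and cell `i` of array `1` the head of the `i`-th edge; all else is `0`. -/
def HasseDiagram.input {X : Type*} [PartialOrder X] (H : HasseDiagram X) : State where
  reg := fun r => if r = 0 then (H.p : ℤ) else if r = 1 then (H.q : ℤ) else 0
  arr := fun a i =>
    if a = 0 then ((H.edges.map fun e => (e.1 : ℤ)).getD i 0)
    else if a = 1 then ((H.edges.map fun e => (e.2 : ℤ)).getD i 0)
    else 0

/-- The state `s` holds the profiles `A` as output: register `0` holds `n`, the vectors and
the coefficients of the linear functions of the men are in arrays `2` and `3`, and those of the
women in arrays `4` and `5`, with `k` consecutive cells for each agent. -/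
def State.Outputs {k n : ℕ} (s : State) (A : Profiles k n) : Prop :=
  s.reg 0 = (n : ℤ) ∧
    ∀ (a : Fin n) (j : Fin k),
      A.manVec a j = (s.arr 2 (a * k + j) : ℝ) ∧
      A.manFun a (Pi.single j 1) = (s.arr 3 (a * k + j) : ℝ) ∧
      A.womanVec a j = (s.arr 4 (a * k + j) : ℝ) ∧
      A.womanFun a (Pi.single j 1) = (s.arr 5 (a * k + j) : ℝ)

end StableMatching

open StableMatching

/-! The instance is drawn on the Hasse diagram. Each covering pair `u ⋖ v` gives an agent with
source `u` and target `v` on either side of the market. Each element `v` gives a crossing agent `d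
v` with source and target `v`, and an auxiliary agent with target `v` and no source. One spare agent
keeps the size positive when the poset is empty. A permutation `σ` runs cyclically through the
agents with a common source, a permutation `τ` through those with a common target. The list of man
`m` starts with `σ⁻¹ m`, `m`, `τ m`, that of woman `w` with `τ⁻¹ w`, `w`, `σ w`; crossing agents
lack the middle entry. Below these favourites the order is irrelevant.

The rotation of `v` moves every man with source `v` from `σ⁻¹ m` to `m` and every man with target
`v` from `m` to `τ m`. The crossing man makes both moves at once, which welds the two cycles into a
single one. The man of an edge from `u` to `v` therefore takes part in two rotations, that of `u`
before that of `v`. The auxiliary agent guarantees that `τ` moves `d v`.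

Stable matchings correspond to lower sets. In a stable matching every man has one of his favourites,
because `τ m` likes `m` best. Stability then passes progress along the cycles: a man who has moved
forces the next one to move, so the crossing man of `v` decides for all men at `v` whether the
rotation has happened (`stable_propagates`, by induction on `v`). The edges make the set of these
`v` a lower set (`exists_eq_matching`); conversely every lower set gives a stable matching
(`stable_matching`). In an exposed rotation each man awaits some element, and his successor awaits
the same or a smaller one; choosing a minimal one shows that the rotation is that of a minimal
element of the complement (`exists_eq_rot`). Hence the rotations eliminated on the way to a matching
are those of its lower set, and precedence is the order of the poset (`realizes`).

Six attributes suffice for prescribing three favourites. Agent number `t` gets the vector `(t, t²,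
…, t⁶)` on the moment curve, so linear functions are polynomials of degree at most six up to their
constant terms, which do not affect comparisons. The polynomial `t - n (t-x)² (1 + n² (t-y)² (1 + n⁴
(t-z)²))` has its largest values on `0, …, n-1` at `x`, `y`, `z` in this order, and it has no ties
because of the summend `t`. Further coordinates are zero.

The program inserts the agents one by one into linked cycles and writes one row of powers and one
row of coefficients per agent and side. Everything is done by counting loops with loop-free bodies,
so the time is linear. Word sizes follow from a static analysis of the bodies, which tracks
exponents of a number `M` polynomial in `p + q + 2` and is evaluated by the kernel. -/

namespace StableMatching

open Function

/-! ## Cycles of permutations and periodic orbits -/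

section Cycles

variable {ι : Type*} {f : Equiv.Perm ι} {s : Set ι} {d x : ι}

/-- A property that propagates along a cycle up to `d` holds at `d`. -/
theorem isCycleOn_propagate_to (hs : s.Finite) (h : f.IsCycleOn s) (hd : d ∈ s) {Q : ι → Prop}
    (hQ : ∀ y ∈ s, y ≠ d → Q y → Q (f y)) (hx : x ∈ s) (hQx : Q x) : Q d := by
  obtain ⟨k, hk⟩ := h.exists_pow_eq' hs hx hd
  induction k generalizing x with
  | zero => simpa [← hk] using hQx
  | succ k ih =>
    by_cases hxd : x = d
    · rwa [← hxd]
    · exact ih (h.apply_mem_iff.2 hx) (hQ x hx hxd hQx) (by rw [← hk, pow_succ]; rfl)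

/-- A property that holds at `d` and propagates along a cycle until it returns to `d` holds
everywhere on the cycle. -/
theorem isCycleOn_propagate_from (hs : s.Finite) (h : f.IsCycleOn s) (hd : d ∈ s) {Q : ι → Prop}
    (hQ : ∀ y ∈ s, f y ≠ d → Q y → Q (f y)) (hQd : Q d) (hx : x ∈ s) : Q x := by
  obtain ⟨k, hk⟩ := h.exists_pow_eq' hs hd hx
  induction k generalizing x with
  | zero => rw [← hk]; simpa using hQd
  | succ k ih =>
    by_cases hxd : x = d
    · rwa [hxd]
    · have e : f ((f ^ k) d) = x := by rw [← hk, pow_succ']; rfl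
      have hm : (f ^ k) d ∈ s := by rw [← h.apply_mem_iff, e]; exact hx
      rw [← e]
      exact hQ _ hm (by rwa [e]) (ih hm rfl)

/-- Inserting a fixed point into a cycle. -/
theorem isCycleOn_mul_swap [DecidableEq ι] (hs : s.Finite) (h : f.IsCycleOn s) (hd : d ∈ s)
    {e : ι} (he : e ∉ s) (hfe : f e = e) : (f * Equiv.swap d e).IsCycleOn (insert e s) := by
  have hde : d ≠ e := fun h => he (h ▸ hd)
  set g := f * Equiv.swap d e with hg
  have gd : g d = e := by simp [hg, hfe]
  have ge : g e = f d := by simp [hg]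
  have gx : ∀ x ∈ s, x ≠ d → g x = f x := fun x hx hxd => by
    have : x ≠ e := fun h => he (h ▸ hx)
    simp [hg, Equiv.swap_apply_of_ne_of_ne hxd this]
  -- The arc from `d` to `f d` is replaced by the path `d`, `e`, `f d`; all other arcs of the cycle
  -- are kept.
  have key : ∀ x ∈ insert e s, g.SameCycle d x := by
    have hes : g.SameCycle d e := ⟨1, by simpa using gd⟩
    rintro x (rfl | hx)
    · exact hes
    · refine isCycleOn_propagate_from hs h hd (Q := fun x => g.SameCycle d x) ?_
        (Equiv.Perm.SameCycle.refl _ _) hx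
      intro y hy _ hQ
      by_cases hyd : y = d
      · rw [hyd, ← ge]; exact Equiv.Perm.sameCycle_apply_right.2 hes
      · rw [← gx y hy hyd]; exact Equiv.Perm.sameCycle_apply_right.2 hQ
  refine ⟨⟨?_, g.injective.injOn, ?_⟩, fun x hx y hy => (key x hx).symm.trans (key y hy)⟩
  · rintro x (rfl | hx)
    · rw [ge]; exact Or.inr (h.apply_mem_iff.2 hd)
    · by_cases hxd : x = d
      · rw [hxd, gd]; exact Or.inl rfl
      · rw [gx x hx hxd]; exact Or.inr (h.apply_mem_iff.2 hx)
  · rintro x (rfl | hx)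
    · exact ⟨d, Or.inr hd, gd⟩
    · obtain ⟨y, hy, rfl⟩ := h.1.surjOn hx
      by_cases hyd : y = d
      · exact ⟨e, Or.inl rfl, by rw [ge, hyd]⟩
      · exact ⟨y, Or.inr hy, gx y hy hyd⟩

/-- A duplicate-free cycle whose consecutive elements are related by a function, as long as an
invariant holds, is a periodic orbit. -/
theorem cycle_eq_periodicOrbit {α : Type*} {ρ : Cycle α} {r : α → α → Prop} (hn : ρ.Nodup)
    (hr : ρ.Chain r) {x : α} (hx : x ∈ ρ) {P : α → Prop} (hP : P x) {F : α → α}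
    (hF : ∀ a ∈ ρ, ∀ b ∈ ρ, r a b → P a → P b ∧ b = F a) :
    ρ = periodicOrbit F x ∧ ∀ a ∈ ρ, P a := by
  obtain ⟨l, rfl⟩ : ∃ l : List α, ρ = ((x :: l : List α) : Cycle α) := by
    induction ρ using Quotient.inductionOn' with
    | h l =>
      -- A cycle may be read from any of its elements, so the list is rotated until it starts at
      -- `x`.
      obtain ⟨s, t, rfl⟩ := List.append_of_mem (Cycle.mem_coe_iff.1 hx)
      exact ⟨t ++ s, Quotient.sound' ⟨s.length, by simp⟩⟩
  rw [Cycle.chain_coe_cons, List.isChain_iff_getElem] at hr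
  have hn' : (x :: l).Nodup := hn
  have hmem : ∀ a ∈ x :: (l ++ [x]), a ∈ ((x :: l : List α) : Cycle α) := by
    intro a ha
    rw [Cycle.mem_coe_iff]
    simp only [List.mem_cons, List.mem_append, List.not_mem_nil, or_false] at ha ⊢
    tauto
  have key : ∀ i (hi : i < (x :: (l ++ [x])).length),
      (x :: (l ++ [x]))[i] = F^[i] x ∧ P (x :: (l ++ [x]))[i] := by
    intro i
    induction i with
    | zero => intro _; exact ⟨rfl, hP⟩
    | succ i ih =>
      intro hi
      obtain ⟨h1, h2⟩ := ih (by omega)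
      obtain ⟨h3, h4⟩ := hF _ (hmem _ (List.getElem_mem _)) _ (hmem _ (List.getElem_mem _))
        (hr i hi) h2
      exact ⟨by rw [h4, h1, iterate_succ_apply'], h3⟩
  have key' : ∀ i (hi : i < (x :: l).length), (x :: l)[i] = F^[i] x ∧ P (x :: l)[i] := by
    intro i hi
    have h1 := key i (by simp at hi ⊢; omega)
    have h2 : (x :: (l ++ [x]))[i]'(by simp at hi ⊢; omega) = (x :: l)[i] :=
      List.getElem_append_left (as := x :: l) (bs := [x]) hi
    rwa [h2] at h1
  have hper : F^[l.length + 1] x = x := by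
    have := (key (l.length + 1) (by simp)).1
    rw [← this]; simp
  -- A smaller period would repeat the first entry inside the list, against `Nodup`.
  have hmin : minimalPeriod F x = l.length + 1 := by
    refine le_antisymm (IsPeriodicPt.minimalPeriod_le (Nat.succ_pos _) hper) ?_
    by_contra! hlt
    have h0 : 0 < minimalPeriod F x := IsPeriodicPt.minimalPeriod_pos (Nat.succ_pos _) hper
    have h1 := (key' (minimalPeriod F x) (by simpa using hlt)).1
    rw [iterate_minimalPeriod] at h1
    have := (List.Nodup.getElem_inj_iff hn' (hi := by simpa using hlt) (hj := by simp)
      (i := minimalPeriod F x) (j := 0)).1 (by simpa using h1)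
    omega
  refine ⟨?_, ?_⟩
  · rw [periodicOrbit_def, hmin]
    congr 1
    refine List.ext_getElem (by simp) ?_
    intro i hi _
    rw [(key' i hi).1, List.getElem_map, List.getElem_range]
  · intro a ha
    obtain ⟨i, hi, rfl⟩ := List.getElem_of_mem (Cycle.mem_coe_iff.1 ha)
    exact (key' i hi).2

end Cycles
end StableMatching

namespace StableMatching

open Function

/-! ## Rotation schemes -/

/-- Combinatorial data for a stable matching instance with rotation poset `V`. Each `v` has a
crossing agent `d v`; the other agents are edges from `src` to `tgt`. The permutation `σ` is a cycle
on the agents with source `v`, and `τ` is a cycle on the agents with target `v`. The stable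
partners of man `m` are the women `σ⁻¹ m`, `m` and `τ m`, where `m` is left out if `m` is
crossing. -/
structure RotationScheme (V : Type*) [PartialOrder V] (n : ℕ) where
  σ : Equiv.Perm (Fin n)
  τ : Equiv.Perm (Fin n)
  d : V → Fin n
  src : Fin n → Option V
  tgt : Fin n → Option V
  src_d : ∀ v, src (d v) = some v
  tgt_d : ∀ v, tgt (d v) = some v
  σ_cycle : ∀ v, σ.IsCycleOn {e | src e = some v}
  τ_cycle : ∀ v, τ.IsCycleOn {e | tgt e = some v}
  σ_fixed : ∀ e, src e = none → σ e = e
  τ_fixed : ∀ e, tgt e = none → τ e = e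
  lt_of_edge : ∀ e u v, src e = some u → tgt e = some v → e ≠ d v → u < v
  exists_edge : ∀ u v, u ⋖ v → ∃ e, src e = some u ∧ tgt e = some v
  unique : ∀ e f u v, src e = some u → tgt e = some v → src f = some u → tgt f = some v → e = f
  τ_d_ne : ∀ v, τ (d v) ≠ d v

/-- `x`, `y`, `z`, in this order and with possible repetitions, are on top of a preference
order. -/
def TopThree {ι : Type*} (r : ι → ι → Prop) (x y z : ι) : Prop :=
  (∀ w, w ≠ x → r x w) ∧ (∀ w, w ≠ x → w ≠ y → r y w) ∧ (∀ w, w ≠ x → w ≠ y → w ≠ z → r z w)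

namespace RotationScheme

variable {V : Type*} [PartialOrder V] {n : ℕ} (D : RotationScheme V n)

open Classical in
/-- The second stable partner of a man. -/
noncomputable def manMid (m : Fin n) : Fin n := if D.src m = D.tgt m then D.τ m else m

open Classical in
/-- The second stable partner of a woman, in her order of preference. -/
noncomputable def womanMid (w : Fin n) : Fin n := if D.src w = D.tgt w then D.σ w else w

/-- The preference lists of `I` start with the stable partners prescribed by `D`. -/
structure Governs (I : SMInstance n) : Prop where
  man : ∀ m, TopThree (I.ManPrefers m) (D.σ⁻¹ m) (D.manMid m) (D.τ m)
  woman : ∀ w, TopThree (I.WomanPrefers w) (D.τ⁻¹ w) (D.womanMid w) (D.σ w)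

variable {D}

/-! ### Sources, targets and fixed points of the two permutations -/

theorem src_σ (e : Fin n) : D.src (D.σ e) = D.src e := by
  cases h : D.src e with
  | none => rw [D.σ_fixed e h, h]
  | some v => exact (D.σ_cycle v).apply_mem_iff.2 h

theorem tgt_τ (e : Fin n) : D.tgt (D.τ e) = D.tgt e := by
  cases h : D.tgt e with
  | none => rw [D.τ_fixed e h, h]
  | some v => exact (D.τ_cycle v).apply_mem_iff.2 h

theorem src_σ_inv (e : Fin n) : D.src (D.σ⁻¹ e) = D.src e := by
  have := D.src_σ (D.σ⁻¹ e); simpa using this.symm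

theorem tgt_τ_inv (e : Fin n) : D.tgt (D.τ⁻¹ e) = D.tgt e := by
  have := D.tgt_τ (D.τ⁻¹ e); simpa using this.symm

theorem σ_apply_inv (e : Fin n) : D.σ (D.σ⁻¹ e) = e := by simp

theorem τ_apply_inv (e : Fin n) : D.τ (D.τ⁻¹ e) = e := by simp

theorem σ_inv_apply (e : Fin n) : D.σ⁻¹ (D.σ e) = e := by simp

theorem τ_inv_apply (e : Fin n) : D.τ⁻¹ (D.τ e) = e := by simp

theorem eq_d {e : Fin n} {v : V} (h : D.src e = some v) (h' : D.tgt e = some v) : e = D.d v :=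
  D.unique e (D.d v) v v h h' (D.src_d v) (D.tgt_d v)

/-- A permutation that is a cycle on a set and fixes a point has no other point in this set. -/
theorem eq_of_fixed {s : Set (Fin n)} {f : Equiv.Perm (Fin n)} (hf : f.IsCycleOn s) {x y : Fin n}
    (hx : x ∈ s) (hy : y ∈ s) (h : f x = x) : x = y := by
  by_contra hne
  exact hf.apply_ne ⟨x, hx, y, hy, hne⟩ hx h

theorem eq_d_of_σ_fixed {e : Fin n} {v : V} (h : D.src e = some v) (h' : D.σ e = e) :
    e = D.d v :=
  eq_of_fixed (D.σ_cycle v) h (D.src_d v) h'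

theorem τ_ne {e : Fin n} {v : V} (h : D.tgt e = some v) : D.τ e ≠ e := by
  intro h'
  have := eq_of_fixed (D.τ_cycle v) h (D.tgt_d v) h'
  subst this
  exact D.τ_d_ne v h'

theorem τ_inv_ne {e : Fin n} {v : V} (h : D.tgt e = some v) : D.τ⁻¹ e ≠ e := by
  intro h'
  exact D.τ_ne h (Equiv.Perm.inv_eq_iff_eq.1 h').symm

theorem σ_inv_fixed {e : Fin n} (h : D.src e = none) : D.σ⁻¹ e = e := by
  rw [Equiv.Perm.inv_eq_iff_eq, D.σ_fixed e h]

theorem τ_inv_fixed {e : Fin n} (h : D.tgt e = none) : D.τ⁻¹ e = e := by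
  rw [Equiv.Perm.inv_eq_iff_eq, D.τ_fixed e h]

/-- A common value would share the source of `e` (through `σ`) and its target (through `τ`), hence
equal `e` by `unique`; but `τ` has no fixed point with a target. Without a source, `σ` fixes `e` and
the same conclusion applies. So the first and the last prescribed partner are different. -/
theorem σ_inv_ne_τ {e : Fin n} {v : V} (h : D.tgt e = some v) : D.σ⁻¹ e ≠ D.τ e := by
  intro h'
  have h1 := D.src_σ_inv e
  cases hs : D.src e with
  | none => exact D.τ_ne h (by rw [← h', D.σ_inv_fixed hs])
  | some u =>
    have := D.unique e (D.τ e) u v hs h (by rw [← h', h1, hs]) (by rw [tgt_τ, h])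
    exact D.τ_ne h this.symm

theorem σ_ne_τ_inv {e : Fin n} {v : V} (h : D.tgt e = some v) : D.σ e ≠ D.τ⁻¹ e := by
  intro h'
  cases hs : D.src e with
  | none => exact D.τ_inv_ne h (by rw [← h', D.σ_fixed e hs])
  | some u =>
    have := D.unique e (D.σ e) u v hs h (by rw [src_σ, hs]) (by rw [h', tgt_τ_inv, h])
    exact D.τ_inv_ne h (by rw [← h', ← this])

theorem σ_ne {e : Fin n} {v : V} (h : D.src e = some v) (h' : D.tgt e ≠ some v) : D.σ e ≠ e := by
  intro hf
  have := D.eq_d_of_σ_fixed h hf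
  subst this
  exact h' (D.tgt_d v)

theorem σ_inv_ne {e : Fin n} {v : V} (h : D.src e = some v) (h' : D.tgt e ≠ some v) :
    D.σ⁻¹ e ≠ e := by
  intro hf
  exact D.σ_ne h h' (Equiv.Perm.inv_eq_iff_eq.1 hf).symm

theorem manMid_of_ne {m : Fin n} (h : D.src m ≠ D.tgt m) : D.manMid m = m := if_neg h

theorem womanMid_of_ne {m : Fin n} (h : D.src m ≠ D.tgt m) : D.womanMid m = m := if_neg h

theorem manMid_of_eq {m : Fin n} (h : D.src m = D.tgt m) : D.manMid m = D.τ m := if_pos h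

theorem womanMid_of_eq {m : Fin n} (h : D.src m = D.tgt m) : D.womanMid m = D.σ m := if_pos h

theorem σ_propagate_to {v : V} {Q : Fin n → Prop}
    (hQ : ∀ m, D.src m = some v → m ≠ D.d v → Q m → Q (D.σ m)) {m : Fin n}
    (hm : D.src m = some v) (h : Q m) : Q (D.d v) :=
  isCycleOn_propagate_to (Set.toFinite _) (D.σ_cycle v) (D.src_d v) hQ hm h

theorem τ_propagate_to {v : V} {Q : Fin n → Prop}
    (hQ : ∀ m, D.tgt m = some v → m ≠ D.d v → Q m → Q (D.τ m)) {m : Fin n}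
    (hm : D.tgt m = some v) (h : Q m) : Q (D.d v) :=
  isCycleOn_propagate_to (Set.toFinite _) (D.τ_cycle v) (D.tgt_d v) hQ hm h

theorem σ_propagate_from {v : V} {Q : Fin n → Prop}
    (hQ : ∀ m, D.src m = some v → D.σ m ≠ D.d v → Q m → Q (D.σ m)) (h : Q (D.d v)) {m : Fin n}
    (hm : D.src m = some v) : Q m :=
  isCycleOn_propagate_from (Set.toFinite _) (D.σ_cycle v) (D.src_d v) hQ h hm

theorem τ_propagate_from {v : V} {Q : Fin n → Prop}
    (hQ : ∀ m, D.tgt m = some v → D.τ m ≠ D.d v → Q m → Q (D.τ m)) (h : Q (D.d v)) {m : Fin n}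
    (hm : D.tgt m = some v) : Q m :=
  isCycleOn_propagate_from (Set.toFinite _) (D.τ_cycle v) (D.tgt_d v) hQ h hm

/-! ### The matching of a lower set -/

open Classical in
/-- The partner of man `m` after the rotations in `S` have been eliminated. -/
noncomputable def partner (D : RotationScheme V n) (S : Set V) (m : Fin n) : Fin n :=
  if ∃ v ∈ S, D.tgt m = some v then D.τ m
  else if ∃ v ∈ S, D.src m = some v then m else D.σ⁻¹ m

theorem partner_tgt {S : Set V} {m : Fin n} {v : V} (h : D.tgt m = some v) (hv : v ∈ S) :
    D.partner S m = D.τ m := if_pos ⟨v, hv, h⟩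

theorem partner_mid {S : Set V} {m : Fin n} {u : V} (h : D.src m = some u) (hu : u ∈ S)
    (h' : ∀ v ∈ S, D.tgt m ≠ some v) : D.partner S m = m := by
  rw [partner, if_neg (by push Not; exact h'), if_pos ⟨u, hu, h⟩]

theorem partner_first {S : Set V} {m : Fin n} (h : ∀ v ∈ S, D.src m ≠ some v)
    (h' : ∀ v ∈ S, D.tgt m ≠ some v) : D.partner S m = D.σ⁻¹ m := by
  rw [partner, if_neg (by push Not; exact h'), if_neg (by push Not; exact h)]

/-- The three cases in the definition of `partner`. -/
theorem partner_cases (D : RotationScheme V n) (S : Set V) (m : Fin n) :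
    (∃ v ∈ S, D.tgt m = some v ∧ D.partner S m = D.τ m) ∨
    ((∀ v ∈ S, D.tgt m ≠ some v) ∧ (∃ u ∈ S, D.src m = some u) ∧ D.partner S m = m) ∨
    ((∀ v ∈ S, D.tgt m ≠ some v) ∧ (∀ v ∈ S, D.src m ≠ some v) ∧ D.partner S m = D.σ⁻¹ m) := by
  by_cases h : ∃ v ∈ S, D.tgt m = some v
  · obtain ⟨v, hv, h⟩ := h
    exact Or.inl ⟨v, hv, h, partner_tgt h hv⟩
  · push Not at h
    by_cases h' : ∃ v ∈ S, D.src m = some v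
    · obtain ⟨u, hu, h'⟩ := h'
      exact Or.inr (Or.inl ⟨h, ⟨u, hu, h'⟩, partner_mid h' hu h⟩)
    · push Not at h'
      exact Or.inr (Or.inr ⟨h, h', partner_first h' h⟩)

theorem le_of_edge {e : Fin n} {u v : V} (h : D.src e = some u) (h' : D.tgt e = some v) :
    u ≤ v := by
  by_cases he : e = D.d v
  · subst he
    rw [D.src_d] at h
    exact (Option.some.inj h).ge
  · exact (D.lt_of_edge e u v h h' he).le

/-- Lower closure matters only for a woman claimed both as a last partner `τ e` and as a first
partner `σ⁻¹ f`: she would have her target in `S` and her source outside. -/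
theorem partner_injective (S : LowerSet V) : Injective (D.partner S) := by
  have key1 : ∀ e f, (∃ v ∈ (S : Set V), D.tgt e = some v) → (∀ v ∈ (S : Set V), D.tgt f ≠ some v) →
      D.τ e ≠ f := by
    rintro e f ⟨v, hv, he⟩ hf rfl
    exact hf v hv (by rw [tgt_τ, he])
  have key2 : ∀ e f, (∃ v ∈ (S : Set V), D.tgt e = some v) → (∀ v ∈ (S : Set V), D.tgt f ≠ some v) →
      (∀ v ∈ (S : Set V), D.src f ≠ some v) → D.τ e ≠ D.σ⁻¹ f := by
    rintro e f ⟨v, hv, he⟩ hf hf' h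
    cases hs : D.src f with
    | none => exact key1 e f ⟨v, hv, he⟩ hf (by rw [h, σ_inv_fixed hs])
    | some u =>
      have h1 : D.src (D.τ e) = some u := by rw [h, src_σ_inv, hs]
      have h2 : D.tgt (D.τ e) = some v := by rw [tgt_τ, he]
      exact hf' u (S.lower (le_of_edge h1 h2) hv) hs
  have key3 : ∀ e f, (∃ v ∈ (S : Set V), D.src e = some v) →
      (∀ v ∈ (S : Set V), D.src f ≠ some v) → e ≠ D.σ⁻¹ f := by
    rintro e f ⟨v, hv, he⟩ hf rfl
    exact hf v hv (by rw [← he, src_σ_inv])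
  intro e f h
  rcases D.partner_cases S e with ⟨v, hv, he, h1⟩ | ⟨he, he', h1⟩ | ⟨he, he', h1⟩ <;>
  rcases D.partner_cases S f with ⟨v', hv', hf, h2⟩ | ⟨hf, hf', h2⟩ | ⟨hf, hf', h2⟩ <;>
  rw [h1, h2] at h
  · exact D.τ.injective h
  · exact absurd h (key1 e f ⟨v, hv, he⟩ hf)
  · exact absurd h (key2 e f ⟨v, hv, he⟩ hf hf')
  · exact absurd h.symm (key1 f e ⟨v', hv', hf⟩ he)
  · exact h
  · exact absurd h (key3 e f he' hf')
  · exact absurd h.symm (key2 f e ⟨v', hv', hf⟩ he he')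
  · exact absurd h.symm (key3 f e hf' he')
  · exact (D.σ⁻¹).injective h

/-- The matching reached when the rotations of the lower set `S` have been eliminated. -/
noncomputable def matching (D : RotationScheme V n) (S : LowerSet V) : Matching n :=
  Equiv.ofBijective (D.partner S) (Finite.injective_iff_bijective.1 (partner_injective S))

@[simp] theorem matching_apply (S : LowerSet V) (m : Fin n) :
    D.matching S m = D.partner S m := rfl

/-- The crossing man has no middle partner, so he alone records whether the rotation of `v` has been
eliminated. This makes the lower set recoverable from the matching. -/
theorem matching_d_iff (S : LowerSet V) (v : V) :
    D.matching S (D.d v) = D.τ (D.d v) ↔ v ∈ S := by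
  rw [matching_apply]
  refine ⟨fun h => ?_, fun h => partner_tgt (D.tgt_d v) h⟩
  by_contra hv
  have h1 : ∀ u ∈ (S : Set V), D.tgt (D.d v) ≠ some u := by
    rintro u hu h'
    rw [D.tgt_d] at h'
    exact hv (Option.some.inj h' ▸ hu)
  rw [partner_first (by rw [D.src_d, ← D.tgt_d]; exact h1) h1] at h
  exact σ_inv_ne_τ (D.tgt_d v) h

theorem matching_injective : Injective D.matching := by
  intro S T h
  ext v
  rw [SetLike.mem_coe, SetLike.mem_coe, ← D.matching_d_iff S, ← D.matching_d_iff T, h]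

/-- A man who is matched to his last stable partner has passed all his rotations. -/
theorem mem_of_partner_eq_τ {S : LowerSet V} {m : Fin n} {v : V} (hm : D.tgt m = some v)
    (h : D.partner S m = D.τ m) : v ∈ S := by
  rcases D.partner_cases S m with ⟨v', hv', he, h1⟩ | ⟨he, he', h1⟩ | ⟨he, he', h1⟩
  · rw [hm] at he
    exact Option.some.inj he ▸ hv'
  · exact absurd (h.symm.trans h1) (τ_ne hm)
  · exact absurd (h1.symm.trans h) (σ_inv_ne_τ hm)

end RotationScheme

end StableMatching

namespace StableMatching

open Function

namespace RotationScheme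

variable {V : Type*} [PartialOrder V] {n : ℕ} {D : RotationScheme V n} {I : SMInstance n}

/-! ### Stable matchings correspond to lower sets -/

theorem man_asymm {m w w' : Fin n} (h : I.ManPrefers m w w') : ¬ I.ManPrefers m w' w :=
  fun h' => lt_asymm (α := Fin n) h h'

theorem woman_asymm {m w w' : Fin n} (h : I.WomanPrefers m w w') : ¬ I.WomanPrefers m w' w :=
  fun h' => lt_asymm (α := Fin n) h h'

theorem man_irrefl {m w : Fin n} : ¬ I.ManPrefers m w w := fun h => lt_irrefl (α := Fin n) _ h

theorem woman_irrefl {m w : Fin n} : ¬ I.WomanPrefers m w w := fun h => lt_irrefl (α := Fin n) _ h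

/-- If the partner of `m` is among the stable partners of `m`, then he is among hers. -/
theorem symm_cases {μ : Matching n} {w : Fin n}
    (h : ∀ m, μ m = D.σ⁻¹ m ∨ (μ m = m ∧ D.src m ≠ D.tgt m) ∨ μ m = D.τ m) :
    (μ.symm w = D.τ⁻¹ w ∨ (μ.symm w = w ∧ D.src w ≠ D.tgt w) ∨ μ.symm w = D.σ w) := by
  have h1 : μ (μ.symm w) = w := by simp
  rcases h (μ.symm w) with h2 | ⟨h2, h3⟩ | h2 <;> rw [h1] at h2
  · exact Or.inr (Or.inr (Equiv.Perm.eq_inv_iff_eq.1 h2).symm)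
  · right; left; rw [← h2] at h3; exact ⟨h2.symm, h3⟩
  · exact Or.inl (Equiv.Perm.eq_inv_iff_eq.2 h2.symm)

/-- In every stable matching each man is matched to one of the prescribed partners. -/
theorem stable_cases (hI : D.Governs I) {μ : Matching n} (hμ : I.Stable μ) (m : Fin n) :
    μ m = D.σ⁻¹ m ∨ (μ m = m ∧ D.src m ≠ D.tgt m) ∨ μ m = D.τ m := by
  -- Man `m` is the first choice of woman `τ m`, so he can always fall back on her.
  have hlast : ¬ I.ManPrefers m (D.τ m) (μ m) := by
    intro h
    refine hμ m (D.τ m) ⟨h, ?_⟩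
    have h1 := (hI.woman (D.τ m)).1 (μ.symm (D.τ m))
    rw [τ_inv_apply] at h1
    refine h1 fun h2 => ?_
    rw [Equiv.symm_apply_eq] at h2
    rw [h2] at h
    exact man_irrefl h
  by_contra! hne
  refine hlast ((hI.man m).2.2 (μ m) hne.1 ?_ hne.2.2)
  by_cases hc : D.src m = D.tgt m
  · rw [manMid_of_eq hc]; exact hne.2.2
  · rw [manMid_of_ne hc]; exact fun h => hc (hne.2.1 h)

/-- In a stable matching, a man who is an edge and has passed the rotation of his source is
followed by a man who has left his first partner. -/
theorem stable_σ (hI : D.Governs I) {μ : Matching n} (hμ : I.Stable μ) {m : Fin n} {u : V}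
    (hs : D.src m = some u) (hm : m ≠ D.d u) (h : μ m ≠ D.σ⁻¹ m) :
    μ (D.σ m) ≠ D.σ⁻¹ (D.σ m) := by
  intro h'
  rw [σ_inv_apply] at h'
  have htu : D.tgt m ≠ some u := fun ht => hm (eq_d hs ht)
  have hst : D.src m ≠ D.tgt m := fun h => htu (h ▸ hs)
  have hmm : μ m ≠ m := fun h2 => σ_ne hs htu (μ.injective (h'.trans h2.symm))
  have hτ : μ m = D.τ m := by
    rcases stable_cases hI hμ m with h1 | h1 | h1
    exacts [absurd h1 h, absurd h1.1 hmm, h1]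
  -- If man `σ m` keeps woman `m`, then man `m` must already be with `τ m`. Both members of the pair
  -- `(m, m)` are now with their last favourites and prefer their middle ones.
  refine hμ m m ⟨?_, ?_⟩
  · have := (hI.man m).2.1 (μ m) h
    rw [manMid_of_ne hst] at this
    exact this hmm
  · have h2 : μ.symm m = D.σ m := by rw [Equiv.symm_apply_eq, h']
    have := (hI.woman m).2.1 (μ.symm m)
    rw [womanMid_of_ne hst, h2] at this
    rw [h2]
    refine this ?_ (σ_ne hs htu)
    cases ht : D.tgt m with
    | none => exact absurd (hτ.trans (D.τ_fixed m ht)) hmm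
    | some v => exact σ_ne_τ_inv ht

/-- In a stable matching, the man following a man matched to his last partner is matched to his
last partner, provided that he is at his second one at least. -/
theorem stable_τ (hI : D.Governs I) {μ : Matching n} (hμ : I.Stable μ) {m : Fin n} {v : V}
    (ht : D.tgt m = some v) (h : μ m = D.τ m)
    (h' : D.src (D.τ m) = none ∨ μ (D.τ m) ≠ D.σ⁻¹ (D.τ m)) : μ (D.τ m) = D.τ (D.τ m) := by
  -- Woman `τ m` is taken by man `m`, so man `τ m` cannot be at his middle partner.
  have hne : μ (D.τ m) ≠ D.τ m := fun h2 => τ_ne ht (μ.injective (h2.trans h.symm))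
  rcases stable_cases hI hμ (D.τ m) with h1 | h1 | h1
  · rcases h' with h' | h'
    · rw [σ_inv_fixed h'] at h1
      exact absurd h1 hne
    · exact absurd h1 h'
  · exact absurd h1.1 hne
  · exact h1

/-- The first choice of `σ (τ m)` is woman `τ m`, who is held by `m`. If `m` were `σ (τ m)`, then
`m` and `τ m` would have the same source and target, against `unique`. -/
theorem stable_σ_of_τ {μ : Matching n} {m : Fin n} {v : V}
    (ht : D.tgt m = some v) (h : μ m = D.τ m) {u : V} (hs : D.src (D.τ m) = some u) :
    μ (D.σ (D.τ m)) ≠ D.σ⁻¹ (D.σ (D.τ m)) := by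
  intro h'
  rw [σ_inv_apply, ← h] at h'
  have h2 := μ.injective h'
  have h3 : D.src m = some u := by rw [← h2, src_σ, h, hs]
  have := D.unique m (D.τ m) u v h3 ht hs (by rw [tgt_τ, ht])
  exact τ_ne ht this.symm

/-- For lack of a middle partner, a crossing man who has left his first partner has reached his last
one. This transfers progress from the `σ`-cycle to the `τ`-cycle. -/
theorem stable_d (hI : D.Governs I) {μ : Matching n} (hμ : I.Stable μ) {v : V} :
    μ (D.d v) ≠ D.σ⁻¹ (D.d v) ↔ μ (D.d v) = D.τ (D.d v) := by
  constructor
  · intro h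
    rcases stable_cases hI hμ (D.d v) with h1 | h1 | h1
    · exact absurd h1 h
    · exact absurd (by rw [D.src_d, D.tgt_d]) h1.2
    · exact h1
  · intro h h'
    exact σ_inv_ne_τ (D.tgt_d v) (h'.symm.trans h)

/-- Along the cycle of `v`, men who have reached their last partner are followed by men who
have passed the rotation of their source. -/
def Propagates (D : RotationScheme V n) (μ : Matching n) (v : V) : Prop :=
  ∀ m, D.tgt m = some v → D.τ m ≠ D.d v → μ m = D.τ m →
    D.src (D.τ m) = none ∨ μ (D.τ m) ≠ D.σ⁻¹ (D.τ m)

/-- `stable_τ` carries the last partner around the `τ`-cycle from `d v`; its proviso about the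
source is what `Propagates` supplies, and it is not needed for the return to `d v`. -/
theorem Propagates.all_τ (hI : D.Governs I) {μ : Matching n} (hμ : I.Stable μ) {v : V}
    (hv : Propagates D μ v) (h : μ (D.d v) = D.τ (D.d v)) {m : Fin n} (hm : D.tgt m = some v) :
    μ m = D.τ m :=
  τ_propagate_from (Q := fun m => μ m = D.τ m)
    (fun m hm hne h => stable_τ hI hμ hm h (hv m hm hne h)) h hm

theorem stable_d_of_σ (hI : D.Governs I) {μ : Matching n} (hμ : I.Stable μ) {v : V}
    {m : Fin n} (hm : D.src m = some v) (h : μ m ≠ D.σ⁻¹ m) : μ (D.d v) = D.τ (D.d v) :=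
  (stable_d hI hμ).1 (σ_propagate_to (Q := fun m => μ m ≠ D.σ⁻¹ m)
    (fun _ hm hne h => stable_σ hI hμ hm hne h) hm h)

/-- `stable_σ` advances along the `σ`-cycle except from `d v`. There the `τ`-cycle helps: its last
man `τ⁻¹ (d v)` has taken woman `d v`, who is the first choice of `σ (d v)`. -/
theorem Propagates.all_σ (hI : D.Governs I) {μ : Matching n} (hμ : I.Stable μ) {v : V}
    (hv : Propagates D μ v) (h : μ (D.d v) = D.τ (D.d v)) {m : Fin n} (hm : D.src m = some v) :
    μ m ≠ D.σ⁻¹ m := by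
  refine σ_propagate_from (Q := fun m => μ m ≠ D.σ⁻¹ m) ?_ ((stable_d hI hμ).2 h) hm
  intro m hm _ hQ
  by_cases hmd : m = D.d v
  · have ht : D.tgt (D.τ⁻¹ (D.d v)) = some v := by rw [tgt_τ_inv, D.tgt_d]
    have := stable_σ_of_τ ht (hv.all_τ hI hμ h ht) (u := v) (by rw [τ_apply_inv, D.src_d])
    rwa [τ_apply_inv, ← hmd] at this
  · exact stable_σ hI hμ hm hmd hQ

/-- Let `u` be the source of `τ m`, so that `u < v`. Since `m` holds woman `τ m`, man `σ (τ m)` has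
left his first partner. Progress runs along the `σ`-cycle to `d u`, and the induction hypothesis for
`u` brings it back to every man with source `u`, among them `τ m`. -/
theorem stable_propagates [Finite V] (hI : D.Governs I) {μ : Matching n} (hμ : I.Stable μ)
    (v : V) : Propagates D μ v := by
  induction v using WellFoundedLT.induction with
  | ind v ih =>
    intro m hm hne h
    cases hs : D.src (D.τ m) with
    | none => exact Or.inl rfl
    | some u =>
      right
      intro h'
      have ht : D.tgt (D.τ m) = some v := by rw [tgt_τ, hm]
      have hu := ih u (D.lt_of_edge _ u v hs ht hne)
      have h1 := stable_σ_of_τ hm h hs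
      have h2 := stable_d_of_σ hI hμ (by rw [src_σ, hs]) h1
      exact hu.all_σ hI hμ h2 hs h'

/-- Progress runs along the `τ`-cycle towards `d v`. For the last step, the man before `d v` has
taken woman `d v`, so `σ (d v)` has moved, and the `σ`-cycle leads on to man `d v`. -/
theorem stable_d_of_τ [Finite V] (hI : D.Governs I) {μ : Matching n} (hμ : I.Stable μ) {v : V}
    {m : Fin n} (hm : D.tgt m = some v) (h : μ m = D.τ m) : μ (D.d v) = D.τ (D.d v) := by
  refine τ_propagate_to (Q := fun m => μ m = D.τ m) ?_ hm h
  intro m hm hne h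
  by_cases hd : D.τ m = D.d v
  · have hs : D.src (D.τ m) = some v := by rw [hd, D.src_d]
    have := stable_d_of_σ hI hμ (by rw [src_σ, hs]) (stable_σ_of_τ hm h hs)
    rwa [hd]
  · exact stable_τ hI hμ hm h (stable_propagates hI hμ v m hm hd h)

/-- In a finite poset every strict inequality below `b` passes through an element covered by `b`, so
closure along Hasse edges is enough. -/
theorem isLowerSet_of_covBy [Finite V] {S : Set V} (h : ∀ u v, u ⋖ v → v ∈ S → u ∈ S) :
    IsLowerSet S := by
  intro b a hab hb
  induction b using WellFoundedLT.induction with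
  | ind b ih =>
    rcases hab.eq_or_lt with rfl | hlt
    · exact hb
    · obtain ⟨c, hac, hcb⟩ := exists_le_covBy_of_lt hlt
      exact ih c hcb.lt hac (h c b hcb hb)

/-- Every stable matching is the matching of a lower set. -/
theorem exists_eq_matching [Finite V] (hI : D.Governs I) {μ : Matching n} (hμ : I.Stable μ) :
    ∃ S : LowerSet V, μ = D.matching S := by
  have hL : ∀ e v, D.tgt e = some v → (μ e = D.τ e ↔ μ (D.d v) = D.τ (D.d v)) := fun e v he =>
    ⟨stable_d_of_τ hI hμ he, fun h => (stable_propagates hI hμ v).all_τ hI hμ h he⟩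
  have hF : ∀ e v, D.src e = some v → (μ e ≠ D.σ⁻¹ e ↔ μ (D.d v) = D.τ (D.d v)) := fun e v he =>
    ⟨stable_d_of_σ hI hμ he, fun h => (stable_propagates hI hμ v).all_σ hI hμ h he⟩
  -- The crossing men define the lower set. It is closed under covers because the man of an edge
  -- from `u` to `v` who has reached his last partner has also left his first one.
  refine ⟨⟨{v | μ (D.d v) = D.τ (D.d v)}, isLowerSet_of_covBy ?_⟩, ?_⟩
  · intro u v huv hv
    obtain ⟨e, he, he'⟩ := D.exists_edge u v huv
    refine (hF e u he).1 fun h => σ_inv_ne_τ he' (h.symm.trans ?_)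
    exact (hL e v he').2 hv
  · ext1 m
    rw [matching_apply]
    rcases D.partner_cases _ m with ⟨v, hv, he, h1⟩ | ⟨he, ⟨u, hu, he'⟩, h1⟩ | ⟨he, he', h1⟩ <;>
      refine Eq.trans ?_ h1.symm
    · exact (hL m v he).2 hv
    · rcases stable_cases hI hμ m with h | h | h
      · exact absurd h ((hF m u he').2 hu)
      · exact h.1
      · cases ht : D.tgt m with
        | none => rw [h, D.τ_fixed m ht]
        | some v => exact absurd ht (he v ((hL m v ht).1 h))
    · cases hs : D.src m with
      | some u =>
        by_contra h
        exact he' u ((hF m u hs).1 h) hs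
      | none =>
        rw [σ_inv_fixed hs]
        rcases stable_cases hI hμ m with h | h | h
        · rw [h, σ_inv_fixed hs]
        · exact h.1
        · cases ht : D.tgt m with
          | none => rw [h, D.τ_fixed m ht]
          | some v => exact absurd ht (he v ((hL m v ht).1 h))

theorem matching_cases (S : LowerSet V) (m : Fin n) :
    D.matching S m = D.σ⁻¹ m ∨ (D.matching S m = m ∧ D.src m ≠ D.tgt m) ∨
      D.matching S m = D.τ m := by
  rcases D.partner_cases S m with ⟨v, hv, he, h1⟩ | ⟨he, ⟨u, hu, he'⟩, h1⟩ | ⟨he, he', h1⟩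
  · exact Or.inr (Or.inr h1)
  · exact Or.inr (Or.inl ⟨h1, fun h => he u hu (h ▸ he')⟩)
  · exact Or.inl h1

/-- The matching of a lower set is stable. -/
theorem stable_matching (hI : D.Governs I) (S : LowerSet V) : I.Stable (D.matching S) := by
  rintro m w ⟨hm, hw⟩
  set μ := D.matching S with hμ
  have hself : μ m ≠ w := by rintro rfl; exact man_irrefl hm
  have hsymm : m ≠ μ.symm w := fun h => hself (by rw [h]; simp)
  -- The possible blockers are excluded by their rank on her list: a woman with her first choice
  -- wants nobody, her last choice never improves on her partner, and a man for whom she is the last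
  -- favourite already has somebody at least as good.
  have hsw : μ.symm w ≠ D.τ⁻¹ w := fun h => by
    rw [h] at hw hsymm
    exact woman_asymm hw ((hI.woman w).1 m hsymm)
  by_cases hmw : m = D.σ w
  · subst hmw
    rcases symm_cases (D.matching_cases S) (w := w) with h | ⟨h, h'⟩ | h
    · exact hsw h
    · rw [← hμ] at h
      rw [h] at hw hsymm
      by_cases h2 : D.σ w = D.τ⁻¹ w
      · have ht : D.tgt w = none := by
          by_contra ht
          obtain ⟨v, hv⟩ := Option.ne_none_iff_exists'.1 ht
          exact σ_ne_τ_inv hv h2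
        rw [τ_inv_fixed ht] at h2
        exact hsymm h2
      · have := (hI.woman w).2.1 (D.σ w) h2
        rw [womanMid_of_ne h'] at this
        exact woman_asymm hw (this hsymm)
    · exact hsymm h.symm
  by_cases hmτ : m = D.τ⁻¹ w
  · have hwm : w = D.τ m := by rw [hmτ]; simp
    rcases D.matching_cases S m with h | ⟨h, h'⟩ | h <;> rw [← hμ] at h <;> rw [h] at hm hself
    · exact man_asymm hm ((hI.man m).1 w hself.symm)
    · by_cases h2 : w = D.σ⁻¹ m
      · exact hmw (by rw [h2]; simp)
      · have := (hI.man m).2.1 w h2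
        rw [manMid_of_ne h'] at this
        exact man_asymm hm (this hself.symm)
    · exact hself hwm.symm
  have hmid : m = D.womanMid w := by
    by_contra h
    have h3 := (hI.woman w).2.2 m hmτ h hmw
    rcases symm_cases (D.matching_cases S) (w := w) with h2 | ⟨h2, h'⟩ | h2 <;> rw [← hμ] at h2
    · exact hsw h2
    · rw [womanMid_of_ne h'] at h
      rw [h2] at hw
      have := (hI.woman w).2.1 m hmτ
      rw [womanMid_of_ne h'] at this
      exact woman_asymm hw (this h)
    · rw [h2] at hw
      exact woman_asymm hw h3
  by_cases hst : D.src w = D.tgt w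
  · rw [womanMid_of_eq hst] at hmid
    exact hmw hmid
  rw [womanMid_of_ne hst] at hmid
  subst hmid
  -- Only the pair `(m, m)` remains. A man who has gone on to `τ m` has his target in `S`, hence
  -- also his source if there is one, and then `σ m` no longer holds woman `m`.
  rcases D.partner_cases S m with ⟨v, hv, he, h1⟩ | ⟨he, ⟨u, hu, he'⟩, h1⟩ | ⟨he, he', h1⟩
  · rcases symm_cases (D.matching_cases S) (w := m) with h2 | ⟨h2, h'⟩ | h2 <;> rw [← hμ] at h2
    · exact hsw h2
    · exact hsymm h2.symm
    · have h3 : μ (D.σ m) = m := by rw [← h2]; simp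
      cases hs : D.src m with
      | none => exact hmw (D.σ_fixed m hs).symm
      | some u =>
        have hu : u ∈ S := S.lower (le_of_edge hs he) hv
        have hs' : D.src (D.σ m) = some u := by rw [src_σ, hs]
        rcases D.partner_cases S (D.σ m) with ⟨v', hv', hf, h4⟩ | ⟨hf, hf', h4⟩ | ⟨hf, hf', h4⟩ <;>
          replace h4 := h3.symm.trans h4
        · exact σ_ne_τ_inv he (Equiv.Perm.eq_inv_iff_eq.2 h4.symm)
        · exact hmw h4
        · exact hf' u hu hs'
  · exact hself h1
  · change μ m = _ at h1
    rw [h1] at hm hself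
    exact man_asymm hm ((hI.man m).1 m hself.symm)

end RotationScheme

end StableMatching

namespace StableMatching

open Function

namespace RotationScheme

variable {V : Type*} [PartialOrder V] {n : ℕ} {D : RotationScheme V n} {I : SMInstance n}

/-! ### The rotations -/

open Classical in
/-- The man following `m` in the rotation of `v`. -/
noncomputable def nxt (D : RotationScheme V n) (v : V) (m : Fin n) : Fin n :=
  if D.tgt m = some v then (if D.τ m = D.d v then D.σ (D.d v) else D.τ m) else D.σ m

open Classical in
/-- The partner of `m` before the rotation of `v`. -/
noncomputable def before (D : RotationScheme V n) (v : V) (m : Fin n) : Fin n :=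
  if D.src m = some v then D.σ⁻¹ m else m

open Classical in
/-- The partner of `m` after the rotation of `v`. -/
noncomputable def after (D : RotationScheme V n) (v : V) (m : Fin n) : Fin n :=
  if D.tgt m = some v then D.τ m else m

/-- The men in the rotation of `v`. -/
def Incident (D : RotationScheme V n) (v : V) (m : Fin n) : Prop :=
  D.src m = some v ∨ D.tgt m = some v

theorem incident_d (v : V) : D.Incident v (D.d v) := Or.inl (D.src_d v)

theorem incident_d_iff {u v : V} : D.Incident v (D.d u) ↔ u = v := by
  simp [Incident, D.src_d, D.tgt_d]

theorem nxt_of_tgt {v : V} {m : Fin n} (h : D.tgt m = some v) (h' : D.τ m ≠ D.d v) :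
    D.nxt v m = D.τ m := by rw [nxt, if_pos h, if_neg h']

theorem nxt_of_eq {v : V} {m : Fin n} (h' : D.τ m = D.d v) : D.nxt v m = D.σ (D.d v) := by
  rw [nxt, if_pos (by rw [← tgt_τ, h', D.tgt_d]), if_pos h']

theorem nxt_of_ne {v : V} {m : Fin n} (h : D.tgt m ≠ some v) : D.nxt v m = D.σ m := if_neg h

theorem incident_nxt {v : V} {m : Fin n} (h : D.Incident v m) : D.Incident v (D.nxt v m) := by
  by_cases ht : D.tgt m = some v
  · by_cases hd : D.τ m = D.d v
    · rw [nxt_of_eq hd]; exact Or.inl (by rw [src_σ, D.src_d])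
    · rw [nxt_of_tgt ht hd]; exact Or.inr (by rw [tgt_τ, ht])
  · rw [nxt_of_ne ht]; exact Or.inl (by rw [src_σ]; exact h.resolve_right ht)

/-- The woman gained by `m` is the one given up by the next man. At the end of the `τ`-cycle this is
woman `d v`, whose holder is `σ (d v)` and not `d v`: here the two cycles are welded together. -/
theorem before_nxt {v : V} {m : Fin n} (h : D.Incident v m) :
    D.before v (D.nxt v m) = D.after v m := by
  by_cases ht : D.tgt m = some v
  · rw [after, if_pos ht]
    by_cases hd : D.τ m = D.d v
    · rw [nxt_of_eq hd, before, if_pos (by rw [src_σ, D.src_d]), σ_inv_apply, hd]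
    · rw [nxt_of_tgt ht hd, before, if_neg]
      exact fun hs => hd (eq_d hs (by rw [tgt_τ, ht]))
  · rw [nxt_of_ne ht, after, if_neg ht, before,
      if_pos (by rw [src_σ]; exact h.resolve_right ht), σ_inv_apply]

/-- A property that propagates along the rotation of `v` and holds at the crossing man holds for
all men in the rotation. -/
theorem nxt_induction {v : V} {Q : Fin n → Prop} (hQ : ∀ m, D.Incident v m → Q m → Q (D.nxt v m))
    (h : Q (D.d v)) {m : Fin n} (hm : D.Incident v m) : Q m := by
  have h1 : ∀ m, D.tgt m = some v → Q m := fun m hm =>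
    τ_propagate_from (Q := Q) (fun m hm hne h => by
      have := hQ m (Or.inr hm) h
      rwa [nxt_of_tgt hm hne] at this) h hm
  rcases hm with hm | hm
  · refine σ_propagate_from (Q := Q) (fun m hm _ h => ?_) h hm
    by_cases hmd : m = D.d v
    · have ht : D.tgt (D.τ⁻¹ (D.d v)) = some v := by rw [tgt_τ_inv, D.tgt_d]
      have := hQ _ (Or.inr ht) (h1 _ ht)
      rwa [nxt_of_eq (by simp), ← hmd] at this
    · have := hQ m (Or.inl hm) h
      rwa [nxt_of_ne fun ht => hmd (eq_d hm ht)] at this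
  · exact h1 m hm

theorem exists_iterate_nxt {v : V} {m : Fin n} (hm : D.Incident v m) :
    ∃ k, (D.nxt v)^[k] (D.d v) = m := by
  refine nxt_induction (Q := fun m => ∃ k, (D.nxt v)^[k] (D.d v) = m) ?_ ⟨0, rfl⟩ hm
  rintro m - ⟨k, rfl⟩
  exact ⟨k + 1, iterate_succ_apply' _ _ _⟩

/-- The passage from one pair of the rotation of `v` to the next one. -/
noncomputable def step (D : RotationScheme V n) (v : V) (x : Fin n × Fin n) : Fin n × Fin n :=
  (D.nxt v x.1, D.after v x.1)

theorem incident_iterate_nxt (v : V) (k : ℕ) : D.Incident v ((D.nxt v)^[k] (D.d v)) := by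
  induction k with
  | zero => exact incident_d v
  | succ k ih => rw [iterate_succ_apply']; exact incident_nxt ih

theorem iterate_step (v : V) (k : ℕ) :
    (D.step v)^[k] (D.d v, D.before v (D.d v)) =
      ((D.nxt v)^[k] (D.d v), D.before v ((D.nxt v)^[k] (D.d v))) := by
  induction k with
  | zero => rfl
  | succ k ih =>
    rw [iterate_succ_apply', ih, iterate_succ_apply', step, before_nxt (incident_iterate_nxt v k)]

/-- The orbit of `d v` reaches every incident man, in particular a predecessor of `d v`. This is
`σ⁻¹ (d v)`, or `τ⁻¹ (d v)` if `σ` fixes `d v`. -/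
theorem step_periodic (v : V) :
    (D.d v, D.before v (D.d v)) ∈ periodicPts (D.step v) := by
  have : ∃ m, D.Incident v m ∧ D.nxt v m = D.d v := by
    by_cases h : D.σ (D.d v) = D.d v
    · refine ⟨D.τ⁻¹ (D.d v), Or.inr (by rw [tgt_τ_inv, D.tgt_d]), ?_⟩
      rw [nxt_of_eq (by simp), h]
    · have hs : D.src (D.σ⁻¹ (D.d v)) = some v := by rw [src_σ_inv, D.src_d]
      refine ⟨D.σ⁻¹ (D.d v), Or.inl hs, ?_⟩
      rw [nxt_of_ne, σ_apply_inv]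
      intro ht
      exact h (Equiv.Perm.inv_eq_iff_eq.1 (eq_d hs ht)).symm
  obtain ⟨m, hm, hmd⟩ := this
  obtain ⟨k, rfl⟩ := exists_iterate_nxt hm
  refine mk_mem_periodicPts (Nat.succ_pos k) ?_
  rw [← iterate_succ_apply' (D.nxt v)] at hmd
  rw [IsPeriodicPt, IsFixedPt, iterate_step, hmd]

/-- The rotation of `v`. -/
noncomputable def rot (D : RotationScheme V n) (v : V) : Cycle (Fin n × Fin n) :=
  periodicOrbit (D.step v) (D.d v, D.before v (D.d v))

theorem mem_rot {v : V} {x : Fin n × Fin n} :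
    x ∈ D.rot v ↔ D.Incident v x.1 ∧ x.2 = D.before v x.1 := by
  rw [rot, mem_periodicOrbit_iff (step_periodic v)]
  constructor
  · rintro ⟨k, rfl⟩
    rw [iterate_step]
    exact ⟨incident_iterate_nxt v k, rfl⟩
  · rintro ⟨h, h'⟩
    obtain ⟨k, hk⟩ := exists_iterate_nxt h
    exact ⟨k, by rw [iterate_step, hk, ← h']⟩

theorem rot_injective : Injective D.rot := by
  intro u v h
  have h1 : (D.d u, D.before u (D.d u)) ∈ D.rot u := mem_rot.2 ⟨incident_d u, rfl⟩
  rw [h] at h1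
  exact incident_d_iff.1 (mem_rot.1 h1).1

theorem rot_chain_iff {v : V} {r : Fin n × Fin n → Fin n × Fin n → Prop} :
    (D.rot v).Chain r ↔ ∀ m, D.Incident v m →
      r (m, D.before v m) (D.nxt v m, D.after v m) := by
  rw [rot, periodicOrbit_chain' _ (step_periodic v)]
  have hs : ∀ k, (D.step v)^[k + 1] (D.d v, D.before v (D.d v)) =
      (D.nxt v ((D.nxt v)^[k] (D.d v)), D.after v ((D.nxt v)^[k] (D.d v))) := by
    intro k
    rw [iterate_succ_apply', iterate_step, step]
  constructor
  · intro h m hm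
    obtain ⟨k, rfl⟩ := exists_iterate_nxt hm
    have := h k
    rwa [hs, iterate_step] at this
  · intro h k
    rw [hs, iterate_step]
    exact h _ (incident_iterate_nxt v k)

/-- The next rotation for `m` is that of `v`, when those in `S` have been eliminated. -/
def Awaits (D : RotationScheme V n) (S : LowerSet V) (v : V) (m : Fin n) : Prop :=
  v ∉ S ∧ (D.src m = some v ∨ (D.tgt m = some v ∧ ∀ u, D.src m = some u → u ∈ S))

theorem Awaits.incident {S : LowerSet V} {v : V} {m : Fin n} (h : D.Awaits S v m) :
    D.Incident v m := h.2.imp_right And.left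

theorem Awaits.unique {S : LowerSet V} {u v : V} {m : Fin n} (h : D.Awaits S u m)
    (h' : D.Awaits S v m) : u = v := by
  rcases h with ⟨hu, h | ⟨h, h2⟩⟩ <;> rcases h' with ⟨hv, h' | ⟨h', h2'⟩⟩
  · exact Option.some.inj (h.symm.trans h')
  · exact absurd (h2' u h) hu
  · exact absurd (h2 v h') hv
  · exact Option.some.inj (h.symm.trans h')

theorem Awaits.matching_eq {S : LowerSet V} {v : V} {m : Fin n} (h : D.Awaits S v m) :
    D.matching S m = D.before v m := by
  rw [matching_apply, before]
  obtain ⟨hv, h⟩ := h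
  by_cases hs : D.src m = some v
  · rw [if_pos hs, partner_first]
    · intro u hu hu'
      rw [hs] at hu'
      exact hv (Option.some.inj hu' ▸ hu)
    · intro u hu hu'
      exact hv (S.lower (le_of_edge hs hu') hu)
  · obtain ⟨ht, h⟩ := h.resolve_left hs
    have ht' : ∀ u ∈ (S : Set V), D.tgt m ≠ some u := by
      intro u hu hu'
      rw [ht] at hu'
      exact hv (Option.some.inj hu' ▸ hu)
    rw [if_neg hs]
    cases hs' : D.src m with
    | none => rw [partner_first (by simp [hs']) ht', σ_inv_fixed hs']
    | some u => exact partner_mid hs' (h u hs') ht'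

/-- All men in the rotation of a minimal element of the complement of `S` await this rotation. -/
theorem awaits_of_minimal {S : LowerSet V} {v : V} (hv : v ∉ S) (hmin : ∀ u < v, u ∈ S)
    {m : Fin n} (hm : D.Incident v m) : D.Awaits S v m := by
  refine ⟨hv, ?_⟩
  by_cases hs : D.src m = some v
  · exact Or.inl hs
  · have ht := hm.resolve_left hs
    refine Or.inr ⟨ht, fun u hu => hmin u (D.lt_of_edge m u v hu ht ?_)⟩
    rintro rfl
    exact hs (D.src_d v)

/-- The relation between consecutive pairs of a rotation exposed in `μ`. -/
def Successor (I : SMInstance n) (μ : Matching n) (x y : Fin n × Fin n) : Prop :=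
  I.ManPrefers x.1 x.2 y.2 ∧ I.WomanPrefers y.2 x.1 y.1 ∧
    ∀ w, I.ManPrefers x.1 x.2 w → I.ManPrefers x.1 w y.2 → ¬ I.WomanPrefers w x.1 (μ.symm w)

/-- The partners before and after the rotation are consecutive on the list of `m`, apart from a
woman `m` skipped by nobody: a crossing man has no middle entry. Hence no woman lies between them
and the minimality clause of exposure is vacuous. -/
theorem prefers_after (hI : D.Governs I) {v : V} {m : Fin n} (hm : D.Incident v m) :
    I.ManPrefers m (D.before v m) (D.after v m) ∧
      ∀ w, I.ManPrefers m (D.before v m) w → ¬ I.ManPrefers m w (D.after v m) := by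
  have hM := hI.man m
  rw [before, after]
  by_cases hs : D.src m = some v <;> by_cases ht : D.tgt m = some v
  · rw [if_pos hs, if_pos ht]
    refine ⟨hM.1 _ (σ_inv_ne_τ ht).symm, fun w h1 h2 => ?_⟩
    have hw : w ≠ D.σ⁻¹ m := by rintro rfl; exact man_irrefl h1
    have hw' : w ≠ D.τ m := by rintro rfl; exact man_irrefl h2
    have hst : D.src m = D.tgt m := by rw [hs, ht]
    have := hM.2.1 w hw
    rw [manMid_of_eq hst] at this
    exact man_asymm h2 (this hw')
  · have hst : D.src m ≠ D.tgt m := by rw [hs]; exact Ne.symm ht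
    rw [manMid_of_ne hst] at hM
    rw [if_pos hs, if_neg ht]
    refine ⟨hM.1 _ (σ_inv_ne hs ht).symm, fun w h1 h2 => ?_⟩
    have hw : w ≠ D.σ⁻¹ m := by rintro rfl; exact man_irrefl h1
    have hw' : w ≠ m := by rintro rfl; exact man_irrefl h2
    exact man_asymm h2 (hM.2.1 w hw hw')
  · have hst : D.src m ≠ D.tgt m := by rw [ht]; exact hs
    rw [manMid_of_ne hst] at hM
    rw [if_neg hs, if_pos ht]
    refine ⟨hM.2.1 _ (σ_inv_ne_τ ht).symm (τ_ne ht), fun w h1 h2 => ?_⟩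
    have hw : w ≠ m := by rintro rfl; exact man_irrefl h1
    have hw' : w ≠ D.τ m := by rintro rfl; exact man_irrefl h2
    have hw'' : w ≠ D.σ⁻¹ m := by
      rintro rfl
      exact man_asymm h1 (hM.1 _ hw.symm)
    exact man_asymm h2 (hM.2.2 w hw'' hw hw')
  · exact absurd hm (not_or.2 ⟨hs, ht⟩)

theorem woman_prefers_after (hI : D.Governs I) {v : V} {m : Fin n} (hm : D.Incident v m) :
    I.WomanPrefers (D.after v m) m (D.nxt v m) := by
  rw [after]
  by_cases ht : D.tgt m = some v
  · rw [if_pos ht]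
    have := (hI.woman (D.τ m)).1 (D.nxt v m)
    rw [τ_inv_apply] at this
    refine this ?_
    by_cases hd : D.τ m = D.d v
    · rw [nxt_of_eq hd]
      intro h
      have h1 : D.src m = some v := by rw [← h, src_σ, D.src_d]
      have h2 := eq_d h1 ht
      rw [h2] at hd
      exact D.τ_d_ne v hd
    · rw [nxt_of_tgt ht hd]
      exact τ_ne ht
  · have hs := hm.resolve_right ht
    rw [if_neg ht, nxt_of_ne ht]
    have := (hI.woman m).2.1 (D.σ m)
    rw [womanMid_of_ne (by rw [hs]; exact Ne.symm ht)] at this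
    refine this ?_ (σ_ne hs ht)
    cases ht' : D.tgt m with
    | none => rw [τ_inv_fixed ht']; exact σ_ne hs ht
    | some u => exact σ_ne_τ_inv ht'

/-- The rotation of a minimal element of the complement of `S` is exposed. -/
theorem exposed_rot (hI : D.Governs I) {S : LowerSet V} {v : V} (hv : v ∉ S)
    (hmin : ∀ u < v, u ∈ S) : I.Exposed (D.matching S) (D.rot v) := by
  refine ⟨?_, nodup_periodicOrbit, ?_, ?_⟩
  · rw [rot, Ne, periodicOrbit_eq_nil_iff_not_periodic_pt, not_not]
    exact step_periodic v
  · intro x hx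
    obtain ⟨h1, h2⟩ := mem_rot.1 hx
    rw [h2, (awaits_of_minimal hv hmin h1).matching_eq]
  · rw [rot_chain_iff]
    intro m hm
    have h := prefers_after hI hm
    exact ⟨h.1, woman_prefers_after hI hm, fun w h1 h2 => absurd h2 (h.2 w h1)⟩

theorem not_prefers_σ_inv (hI : D.Governs I) {m w : Fin n} : ¬ I.ManPrefers m w (D.σ⁻¹ m) := by
  intro h
  refine man_asymm h ((hI.man m).1 w ?_)
  rintro rfl
  exact man_irrefl h

theorem not_womanPrefers_τ_inv (hI : D.Governs I) {m w : Fin n} :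
    ¬ I.WomanPrefers w m (D.τ⁻¹ w) := by
  intro h
  refine woman_asymm h ((hI.woman w).1 m ?_)
  rintro rfl
  exact woman_irrefl h

/-- A woman matched to one of her prescribed partners accepts only better prescribed ones. -/
theorem womanPrefers_cases (hI : D.Governs I) {w m m' : Fin n}
    (h : m' = D.τ⁻¹ w ∨ (m' = w ∧ D.src w ≠ D.tgt w) ∨ m' = D.σ w) (hw : I.WomanPrefers w m m') :
    (m = D.τ⁻¹ w ∧ ((m' = w ∧ D.src w ≠ D.tgt w) ∨ m' = D.σ w)) ∨
      (m = w ∧ D.src w ≠ D.tgt w ∧ m' = D.σ w) := by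
  rcases h with rfl | ⟨rfl, h⟩ | rfl
  · exact absurd hw (not_womanPrefers_τ_inv hI)
  · refine Or.inl ⟨?_, Or.inl ⟨rfl, h⟩⟩
    by_contra hm
    have := (hI.woman m').2.1 m hm
    rw [womanMid_of_ne h] at this
    by_cases hmm : m = m'
    · rw [hmm] at hw; exact woman_irrefl hw
    · exact woman_asymm hw (this hmm)
  · by_cases hm : m = D.τ⁻¹ w
    · exact Or.inl ⟨hm, Or.inr rfl⟩
    · have hne : m ≠ D.σ w := by rintro rfl; exact woman_irrefl hw
      have hmid : m = D.womanMid w := by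
        by_contra h
        exact woman_asymm hw ((hI.woman w).2.2 m hm h hne)
      by_cases hst : D.src w = D.tgt w
      · rw [womanMid_of_eq hst] at hmid
        exact absurd hmid hne
      · rw [womanMid_of_ne hst] at hmid
        exact Or.inr ⟨hmid, hst, rfl⟩

/-- The successor of a pair in the matching of a lower set. -/
theorem successor_matching (hI : D.Governs I) {S : LowerSet V} {m m' : Fin n}
    (h : Successor I (D.matching S) (m, D.matching S m) (m', D.matching S m')) :
    ∃ v, D.Awaits S v m ∧
      ((D.Awaits S v m' ∧ m' = D.nxt v m ∧ D.matching S m' = D.after v m) ∨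
        ∃ u < v, D.Awaits S u m') := by
  obtain ⟨hm, hw, hno⟩ := h
  dsimp only at hm hw hno
  set μ := D.matching S with hμ
  have hne : m' ≠ m := by rintro rfl; exact man_irrefl hm
  have hM := hI.man m
  have hc := symm_cases (D.matching_cases S) (w := μ m')
  rw [← hμ, Equiv.symm_apply_apply] at hc
  -- The woman accepts `m` either as her first choice, and then she is `τ m`, or as her middle
  -- choice, and then she is woman `m` and her present partner is `σ m`.
  rcases womanPrefers_cases hI hc hw with ⟨h1, h2⟩ | ⟨h1, h2, h3⟩
  · have h1' : μ m' = D.τ m := (Equiv.Perm.eq_inv_iff_eq.1 h1).symm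
    rw [h1'] at hm h2 hno
    have hmτ : μ m ≠ D.τ m := fun h => man_irrefl (h ▸ hm)
    cases ht : D.tgt m with
    | none =>
      rw [D.τ_fixed m ht] at h2 hm hmτ
      have hst : D.src m ≠ D.tgt m := by
        intro hst
        rw [ht] at hst
        rcases D.matching_cases S m with h | h | h
        · rw [σ_inv_fixed hst] at h; exact hmτ h
        · exact hmτ h.1
        · rw [D.τ_fixed m ht] at h; exact hmτ h
      rcases h2 with h2 | h2
      · exact absurd h2.1 hne
      · obtain ⟨u, hu⟩ := Option.ne_none_iff_exists'.1 (ht ▸ hst)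
        have huS : u ∉ S := fun huS => hmτ (partner_mid hu huS (by simp [ht]))
        refine ⟨u, ⟨huS, Or.inl hu⟩, Or.inl ⟨⟨huS, Or.inl (by rw [h2, src_σ, hu])⟩, ?_, ?_⟩⟩
        · rw [nxt_of_ne (by simp [ht]), h2]
        · rw [after, if_neg (by simp [ht]), h1', D.τ_fixed m ht]
    | some v =>
      have hvS : v ∉ S := fun hv => hmτ (partner_tgt ht hv)
      -- If the rotation of the source of `m` were still pending, he would be with `σ⁻¹ m`. Woman
      -- `m` comes before `τ m` on his list and would accept him, because `v ∉ S` keeps her from her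
      -- first choice. So `τ m` would not be the first such woman.
      have haw : D.Awaits S v m := by
        by_contra haw
        have hs : D.src m ≠ some v := fun hs => haw ⟨hvS, Or.inl hs⟩
        have : ∃ u, D.src m = some u ∧ u ∉ S := by
          by_contra! hcon
          exact haw ⟨hvS, Or.inr ⟨ht, hcon⟩⟩
        obtain ⟨u, hu, huS⟩ := this
        have hst : D.src m ≠ D.tgt m := by rw [ht]; exact hs
        have hut : D.tgt m ≠ some u := fun h => hst (hu.trans h.symm)
        have hfirst : μ m = D.σ⁻¹ m := by
          have : D.Awaits S u m := ⟨huS, Or.inl hu⟩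
          rw [hμ, this.matching_eq, before, if_pos hu]
        rw [hfirst] at hm hno
        have hM' := hM.2.1 _ (σ_inv_ne_τ ht).symm
        rw [manMid_of_ne hst] at hM'
        refine hno m (hM.1 _ (σ_inv_ne hu hut).symm) (hM' (τ_ne ht)) ?_
        have hW := (hI.woman m).2.1 (μ.symm m)
        rw [womanMid_of_ne hst] at hW
        refine hW (fun h => ?_) (fun h => ?_)
        · rw [Equiv.symm_apply_eq] at h
          refine hvS (mem_of_partner_eq_τ (D := D) (m := D.τ⁻¹ m) (by rw [tgt_τ_inv, ht]) ?_)
          rw [← matching_apply, ← hμ, ← h, τ_apply_inv]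
        · rw [Equiv.symm_apply_eq, hfirst] at h
          exact σ_inv_ne hu hut h.symm
      refine ⟨v, haw, ?_⟩
      have hafter : μ m' = D.after v m := by rw [after, if_pos ht, h1']
      by_cases hd : D.τ m = D.d v
      · rw [nxt_of_eq hd]
        rw [hd, D.src_d, D.tgt_d] at h2
        have h3 : m' = D.σ (D.d v) := by simpa using h2
        exact Or.inl ⟨⟨hvS, Or.inl (by rw [h3, src_σ, D.src_d])⟩, h3, hafter⟩
      · have htτ : D.tgt (D.τ m) = some v := by rw [tgt_τ, ht]
        -- Woman `τ m` is held by man `τ m`, who then awaits `v` himself, or still by `σ (τ m)`, who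
        -- then awaits their common source, an element below `v`.
        by_cases hm' : m' = D.τ m
        · refine Or.inl ⟨⟨hvS, Or.inr ⟨by rw [hm', htτ], fun u hu => ?_⟩⟩,
            by rw [nxt_of_tgt ht hd, hm'], hafter⟩
          by_contra huS
          have : D.Awaits S u m' := ⟨huS, Or.inl hu⟩
          have h3 := this.matching_eq
          rw [← hμ, h1', before, if_pos hu, ← hm'] at h3
          refine σ_inv_ne hu ?_ h3.symm
          intro h4
          rw [hm'] at h4 hu
          rw [htτ] at h4
          rw [← h4] at hu
          exact hd (eq_d hu htτ)
        · have h3 : m' = D.σ (D.τ m) := by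
            rcases h2 with h2 | h2
            · exact absurd h2.1 hm'
            · exact h2
          cases hs : D.src (D.τ m) with
          | none => exact absurd (h3.trans (D.σ_fixed _ hs)) hm'
          | some u =>
            have hsm : D.src m' = some u := by rw [h3, src_σ, hs]
            refine Or.inr ⟨u, D.lt_of_edge _ u v hs htτ hd, ?_, Or.inl hsm⟩
            intro huS
            rcases D.partner_cases S m' with ⟨v', hv', hf, h4⟩ | ⟨hf, hf', h4⟩ | ⟨hf, hf', h4⟩ <;>
              replace h4 := h1'.symm.trans h4
            · exact hne (D.τ.injective h4).symm
            · exact hm' h4.symm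
            · exact hf' u huS hsm
  · rw [← h1] at h2 h3 hm hno
    have hmm : μ m ≠ m := fun h => man_irrefl (h ▸ hm)
    have haw : ∃ u, D.src m = some u ∧ u ∉ S := by
      rcases D.partner_cases S m with ⟨v, hv, he, h4⟩ | ⟨he, he', h4⟩ | ⟨he, he', h4⟩
      · exfalso
        change μ m = _ at h4
        have hM' := hM.2.1 (μ m)
        rw [manMid_of_ne h2, h4] at hM'
        rw [h4] at hm
        exact man_asymm hm (hM' (σ_inv_ne_τ he).symm (τ_ne he))
      · exact absurd h4 hmm
      · cases hs : D.src m with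
        | none => rw [σ_inv_fixed hs] at h4; exact absurd h4 hmm
        | some u => exact ⟨u, rfl, fun hu => he' u hu hs⟩
    obtain ⟨u, hu, huS⟩ := haw
    have hut : D.tgt m ≠ some u := fun h => h2 (hu.trans h.symm)
    refine ⟨u, ⟨huS, Or.inl hu⟩, Or.inl ⟨⟨huS, Or.inl (by rw [h3, src_σ, hu])⟩, ?_, ?_⟩⟩
    · rw [nxt_of_ne hut, h3]
    · rw [after, if_neg hut, ← h1]

/-- The rotations exposed in the matching of a lower set are those of the minimal elements of its
complement. -/
theorem exists_eq_rot [Finite V] (hI : D.Governs I) {S : LowerSet V} {ρ : Cycle (Fin n × Fin n)}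
    (h : I.Exposed (D.matching S) ρ) : ∃ v, v ∉ S ∧ (∀ u < v, u ∈ S) ∧ ρ = D.rot v := by
  obtain ⟨hnil, hnodup, hμ, hchain⟩ := h
  obtain ⟨x, hx⟩ : ∃ x, x ∈ ρ := by
    by_contra! hcon
    induction ρ using Cycle.induction_on with
    | nil => exact hnil rfl
    | cons a l _ => exact hcon a (by simp)
  have hpair : ∀ x ∈ ρ, x = (x.1, D.matching S x.1) := fun x hx => by rw [hμ x hx]
  have hsucc : ∀ a ∈ ρ, ∀ b ∈ ρ, Successor I (D.matching S) a b → ∃ v, D.Awaits S v a.1 ∧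
      ((D.Awaits S v b.1 ∧ b = D.step v a) ∨ ∃ u < v, D.Awaits S u b.1) := by
    intro a ha b hb hab
    rw [hpair a ha, hpair b hb] at hab
    obtain ⟨v, h1, h2⟩ := successor_matching hI hab
    refine ⟨v, h1, h2.imp_left fun ⟨h3, h4, h5⟩ => ⟨h3, ?_⟩⟩
    rw [hpair b hb, step, h5, ← h4]
  -- If nobody awaited anything, no two pairs of `ρ` would be related, so `ρ` would vacuously be an
  -- orbit of `id`, a single pair succeeding itself.
  have hex : ∃ v, ∃ x ∈ ρ, D.Awaits S v x.1 := by
    have := cycle_eq_periodicOrbit hnodup hchain hx (P := fun _ => True) trivial (F := id)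
    by_contra! hcon
    have h2 := (this fun a ha b hb hab => by
      obtain ⟨v, h1, _⟩ := hsucc a ha b hb hab
      exact absurd h1 (hcon v a ha)).1
    have hx1 : ρ = (([x] : List (Fin n × Fin n)) : Cycle _) := by
      rw [h2, periodicOrbit_def, show minimalPeriod id x = 1 from
        minimalPeriod_eq_one_iff_isFixedPt.2 rfl]
      rfl
    rw [hx1, Cycle.chain_singleton] at hchain
    exact man_irrefl hchain.1
  -- For a minimal awaited element the alternative of a smaller one is excluded at every step, so
  -- the whole of `ρ` follows `step v`.
  obtain ⟨v, ⟨x, hx, hvx⟩, hmin⟩ := WellFounded.has_min (wellFounded_lt (α := V))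
    {v | ∃ x ∈ ρ, D.Awaits S v x.1} hex
  obtain ⟨hρ, hall⟩ := cycle_eq_periodicOrbit hnodup hchain hx (P := fun x => D.Awaits S v x.1) hvx
    (F := D.step v) (by
      intro a ha b hb hab hva
      obtain ⟨v', h1, h2⟩ := hsucc a ha b hb hab
      obtain rfl := hva.unique h1
      rcases h2 with h2 | ⟨u, hu, h2⟩
      · exact h2
      · exact absurd hu (hmin u ⟨b, hb, h2⟩))
  have hrot : ρ = D.rot v := by
    obtain ⟨k, hk⟩ := exists_iterate_nxt hvx.incident
    have : x = (D.step v)^[k] (D.d v, D.before v (D.d v)) := by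
      rw [iterate_step, hk, hpair x hx, hvx.matching_eq]
    rw [hρ, this, periodicOrbit_apply_iterate_eq (step_periodic v), rot]
  refine ⟨v, hvx.1, ?_, hrot⟩
  intro u hu
  -- The man of an edge from `c` to `v` belongs to the rotation and awaits `v`, which is possible
  -- only if `c ∈ S`.
  obtain ⟨c, huc, hcv⟩ := exists_le_covBy_of_lt hu
  obtain ⟨e, he, he'⟩ := D.exists_edge c v hcv
  have hmem : (e, D.before v e) ∈ ρ := by rw [hrot]; exact mem_rot.2 ⟨Or.inr he', rfl⟩
  rcases (hall _ hmem).2 with h | ⟨_, h⟩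
  · rw [he] at h
    exact absurd (Option.some.inj h) hcv.ne
  · exact S.lower huc (h c he)

/-! ### Elimination -/

/-- The lower set obtained by adding a minimal element of the complement. -/
def addMinimal (S : LowerSet V) (v : V) (hmin : ∀ u < v, u ∈ S) : LowerSet V :=
  ⟨insert v (S : Set V), by
    rintro a b hab (rfl | ha)
    · rcases hab.eq_or_lt with rfl | h
      · exact Or.inl rfl
      · exact Or.inr (hmin b h)
    · exact Or.inr (S.lower hab ha)⟩

theorem matching_addMinimal_of_incident {S : LowerSet V} {v : V} (hv : v ∉ S)
    (hmin : ∀ u < v, u ∈ S) {m : Fin n} (hm : D.Incident v m) :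
    D.matching (addMinimal S v hmin) m = D.after v m := by
  rw [matching_apply, after]
  by_cases ht : D.tgt m = some v
  · rw [if_pos ht]
    exact partner_tgt ht (Or.inl rfl)
  · rw [if_neg ht]
    have hs := hm.resolve_right ht
    refine partner_mid hs (Or.inl rfl) ?_
    rintro u (rfl | hu) h
    · exact ht h
    · exact hv (S.lower (le_of_edge hs h) hu)

theorem matching_addMinimal_of_not_incident {S : LowerSet V} {v : V}
    (hmin : ∀ u < v, u ∈ S) {m : Fin n} (hm : ¬ D.Incident v m) :
    D.matching (addMinimal S v hmin) m = D.matching S m := by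
  have h : ∀ o : Option V, o ≠ some v →
      ((∃ u ∈ (addMinimal S v hmin : Set V), o = some u) ↔ ∃ u ∈ (S : Set V), o = some u) := by
    intro o ho
    constructor
    · rintro ⟨u, rfl | hu, h⟩
      · exact absurd h ho
      · exact ⟨u, hu, h⟩
    · rintro ⟨u, hu, h⟩
      exact ⟨u, Or.inr hu, h⟩
  rw [Incident, not_or] at hm
  classical
  exact if_congr (h _ hm.2) rfl (if_congr (h _ hm.1) rfl rfl)

theorem isElimination_rot_iff {S : LowerSet V} {v : V} (hv : v ∉ S) (hmin : ∀ u < v, u ∈ S)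
    {μ : Matching n} : SMInstance.IsElimination (D.matching S) (D.rot v) μ ↔
      μ = D.matching (addMinimal S v hmin) := by
  have hnot : ∀ m, (∀ x ∈ D.rot v, x.1 ≠ m) ↔ ¬ D.Incident v m := by
    intro m
    constructor
    · exact fun h hm => h (m, D.before v m) (mem_rot.2 ⟨hm, rfl⟩) rfl
    · rintro h x hx rfl
      exact h (mem_rot.1 hx).1
  rw [SMInstance.IsElimination, rot_chain_iff]
  simp only [hnot]
  constructor
  · rintro ⟨h1, h2⟩
    ext1 m
    by_cases hm : D.Incident v m
    · rw [h2 m hm, matching_addMinimal_of_incident hv hmin hm]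
    · rw [h1 m hm, matching_addMinimal_of_not_incident hmin hm]
  · rintro rfl
    exact ⟨fun m hm => matching_addMinimal_of_not_incident hmin hm,
      fun m hm => matching_addMinimal_of_incident hv hmin hm⟩

theorem matching_bot_apply (m : Fin n) : D.matching ⊥ m = D.σ⁻¹ m :=
  partner_first (by simp) (by simp)

/-- For the empty lower set every man has the top of his list, so no other matching is optimal. -/
theorem manOptimal_iff (hI : D.Governs I) {μ : Matching n} :
    I.ManOptimal μ ↔ μ = D.matching ⊥ := by
  have htop : ∀ m w, I.manRank m (D.matching ⊥ m) ≤ I.manRank m w := by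
    intro m w
    rw [matching_bot_apply]
    exact not_lt.1 (not_prefers_σ_inv hI)
  constructor
  · rintro ⟨_, h⟩
    ext1 m
    exact (I.manRank m).injective
      (le_antisymm (h _ (stable_matching hI ⊥) m) (htop m _))
  · rintro rfl
    exact ⟨stable_matching hI ⊥, fun ν _ m => htop m _⟩

theorem reachedBy_eq [Finite V] (hI : D.Governs I) {μ : Matching n}
    {R : Set (Cycle (Fin n × Fin n))} (h : I.ReachedBy μ R) :
    ∃ S : LowerSet V, μ = D.matching S ∧ R = D.rot '' S := by
  induction h with
  | base h => exact ⟨⊥, (manOptimal_iff hI).1 h, by simp⟩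
  | step _ _ hexp helim ih =>
    obtain ⟨S, rfl, rfl⟩ := ih
    obtain ⟨v, hv, hmin, rfl⟩ := exists_eq_rot hI hexp
    refine ⟨addMinimal S v hmin, (isElimination_rot_iff hv hmin).1 helim, ?_⟩
    exact (Set.image_insert_eq).symm

theorem reachedBy_matching [Finite V] (hI : D.Governs I) (S : LowerSet V) :
    I.ReachedBy (D.matching S) (D.rot '' S) := by
  obtain ⟨k, hk⟩ : ∃ k, (S : Set V).ncard = k := ⟨_, rfl⟩
  induction k generalizing S with
  | zero =>
    rw [Set.ncard_eq_zero (Set.toFinite _)] at hk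
    have : S = ⊥ := SetLike.coe_injective (by simpa using hk)
    subst this
    simpa using SMInstance.ReachedBy.base ((manOptimal_iff hI).2 rfl)
  | succ k ih =>
    have hne : (S : Set V).Nonempty := (Set.ncard_pos (Set.toFinite _)).1 (by omega)
    -- Removing a maximal element leaves a lower set, from which one elimination leads back to `S`.
    obtain ⟨v, hv⟩ := (Set.toFinite (S : Set V)).exists_maximal hne
    let T : LowerSet V := ⟨(S : Set V) \ {v}, by
      rintro a b hab ⟨ha, hav⟩
      refine ⟨S.lower hab ha, ?_⟩
      rintro rfl
      exact hav (hv.eq_of_le ha hab).symm⟩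
    have hvT : v ∉ T := fun h => h.2 rfl
    have hmin : ∀ u < v, u ∈ T := fun u hu => ⟨S.lower hu.le hv.prop, hu.ne⟩
    have hT : (T : Set V).ncard = k := by
      have := Set.ncard_sdiff_singleton_of_mem hv.prop
      change ((S : Set V) \ {v}).ncard = k
      omega
    have hS : S = addMinimal T v hmin := SetLike.coe_injective
      (Set.insert_sdiff_self_of_mem hv.prop).symm
    have := SMInstance.ReachedBy.step (ih T hT) (stable_matching hI T) (exposed_rot hI hvT hmin)
      ((isElimination_rot_iff hvT hmin).2 rfl)
    rw [← hS, ← Set.image_insert_eq] at this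
    convert this using 2
    exact (Set.insert_sdiff_self_of_mem hv.prop).symm

/-- Every elimination sequence ending in a matching eliminates the rotations of its lower set, and
the lower set is determined by the matching. Thus the union over all sequences in `eliminated` adds
nothing. -/
theorem eliminated_matching [Finite V] (hI : D.Governs I) (S : LowerSet V) :
    I.eliminated (D.matching S) = D.rot '' S := by
  ext ρ
  constructor
  · rintro ⟨R, hR, hρ⟩
    obtain ⟨T, h1, rfl⟩ := reachedBy_eq hI hR
    rwa [matching_injective h1]
  · exact fun h => ⟨_, reachedBy_matching hI S, h⟩

theorem rot_exposed_Iio (hI : D.Governs I) (v : V) :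
    I.Exposed (D.matching (LowerSet.Iio v)) (D.rot v) :=
  exposed_rot hI (by simp) (fun u hu => by simpa using hu)

/-- An instance governed by a rotation scheme for `V` realizes `V`. -/
theorem realizes [Finite V] (hI : D.Governs I) : I.Realizes V := by
  let φ : V → I.rotations := fun v =>
    ⟨D.rot v, D.matching (LowerSet.Iio v), stable_matching hI _, rot_exposed_Iio hI v⟩
  have hφ : Bijective φ := by
    constructor
    · intro u v h
      exact rot_injective (congrArg Subtype.val h)
    · rintro ⟨ρ, μ, hμ, hρ⟩
      obtain ⟨S, rfl⟩ := exists_eq_matching hI hμ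
      obtain ⟨v, _, _, rfl⟩ := exists_eq_rot hI hρ
      exact ⟨v, rfl⟩
  refine ⟨⟨Equiv.ofBijective φ hφ, ?_⟩⟩
  intro u v
  change I.Precedes (φ u) (φ v) ↔ u < v
  constructor
  · intro h
    -- The test case is the least lower set at which the rotation of `v` is exposed.
    have := h _ (stable_matching hI _) (rot_exposed_Iio hI v)
    rw [eliminated_matching hI, Set.mem_image] at this
    obtain ⟨w, hw, hwu⟩ := this
    obtain rfl := rot_injective hwu
    simpa using hw
  · intro h μ hμ hexp
    obtain ⟨S, rfl⟩ := exists_eq_matching hI hμ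
    obtain ⟨w, hw, hmin, hwv⟩ := exists_eq_rot hI hexp
    obtain rfl := rot_injective hwv
    rw [eliminated_matching hI]
    exact ⟨u, hmin u h, rfl⟩

end RotationScheme

end StableMatching

namespace StableMatching

open Function

/-! ## Verification of programs -/

@[simp] theorem State.reg_setReg (s : State) (d : ℕ) (v : ℤ) (r : ℕ) :
    (s.setReg d v).reg r = if r = d then v else s.reg r := by
  simp [State.setReg, Function.update_apply]

@[simp] theorem State.arr_setReg (s : State) (d : ℕ) (v : ℤ) : (s.setReg d v).arr = s.arr := rfl

@[simp] theorem State.reg_setArr (s : State) (a i : ℕ) (v : ℤ) :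
    (s.setArr a i v).reg = s.reg := rfl

@[simp] theorem State.arr_setArr (s : State) (a i : ℕ) (v : ℤ) (b j : ℕ) :
    (s.setArr a i v).arr b j = if b = a ∧ j = i then v else s.arr b j := by
  by_cases hb : b = a
  · subst hb
    simp [State.setArr, Function.update_apply]
  · simp [State.setArr, hb]

namespace Program

/-- The effect of a program without loops. -/
def eff : Program → State → State
  | const d c, s => s.setReg d c
  | add d x y, s => s.setReg d (s.reg x + s.reg y)
  | sub d x y, s => s.setReg d (s.reg x - s.reg y)
  | mul d x y, s => s.setReg d (s.reg x * s.reg y)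
  | load d a x, s => s.setReg d (s.arr a (s.reg x).toNat)
  | store a x y, s => s.setArr a (s.reg x).toNat (s.reg y)
  | seq P Q, s => Q.eff (P.eff s)
  | branch x P Q, s => if 0 < s.reg x then P.eff s else Q.eff s
  | loop _ _, s => s

/-- A bound for the number of steps of a program without loops. -/
def cost : Program → ℕ
  | seq P Q => P.cost + Q.cost
  | branch _ P Q => P.cost + Q.cost + 1
  | _ => 1

/-- The registers written by a program. -/
def regsWritten : Program → List ℕ
  | const d _ => [d]
  | add d _ _ => [d]
  | sub d _ _ => [d]
  | mul d _ _ => [d]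
  | load d _ _ => [d]
  | store _ _ _ => []
  | seq P Q => P.regsWritten ++ Q.regsWritten
  | branch _ P Q => P.regsWritten ++ Q.regsWritten
  | loop _ P => P.regsWritten

/-- The arrays written by a program. -/
def arrsWritten : Program → List ℕ
  | store a _ _ => [a]
  | seq P Q => P.arrsWritten ++ Q.arrsWritten
  | branch _ P Q => P.arrsWritten ++ Q.arrsWritten
  | loop _ P => P.arrsWritten
  | _ => []

theorem eff_reg_of_notMem {P : Program} {r : ℕ} (h : r ∉ P.regsWritten) (s : State) :
    (P.eff s).reg r = s.reg r := by
  induction P generalizing s with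
  | seq P Q ihP ihQ =>
    rw [regsWritten, List.mem_append, not_or] at h
    rw [eff, ihQ h.2, ihP h.1]
  | branch x P Q ihP ihQ =>
    rw [regsWritten, List.mem_append, not_or] at h
    rw [eff]
    split_ifs
    exacts [ihP h.1 s, ihQ h.2 s]
  | loop => rfl
  | _ => simp_all [regsWritten, eff]

theorem eff_arr_of_notMem {P : Program} {a : ℕ} (h : a ∉ P.arrsWritten) (s : State) :
    (P.eff s).arr a = s.arr a := by
  induction P generalizing s with
  | seq P Q ihP ihQ =>
    rw [arrsWritten, List.mem_append, not_or] at h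
    rw [eff, ihQ h.2, ihP h.1]
  | branch x P Q ihP ihQ =>
    rw [arrsWritten, List.mem_append, not_or] at h
    rw [eff]
    split_ifs
    exacts [ihP h.1 s, ihQ h.2 s]
  | loop => rfl
  | _ => first | rfl | (ext; simp_all [arrsWritten, eff])

/-- Bounds for registers: `some (e, true)` stands for an integer between `0` and `M ^ e`, and
`some (e, false)` for one between `-M ^ e` and `M ^ e`. -/
abbrev Bounds := ℕ → Option (ℕ × Bool)

/-- The arrays that hold indices. -/
def isIndexArray (a : ℕ) : Bool := a < 2 || 5 < a

/-- Static analysis of a program without loops: the bounds after its execution, or `none` if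
words of absolute value above `M ^ B` or negative array indices cannot be excluded. -/
def analyze (B : ℕ) : Program → Bounds → Option Bounds
  | const d c, b => if c = 0 ∨ c = 1 then some (update b d (some (1, true))) else none
  | add d x y, b =>
    match b x, b y with
    | some (e, p), some (f, q) =>
      if max e f + 1 ≤ B then some (update b d (some (max e f + 1, p && q))) else none
    | _, _ => none
  | sub d x y, b =>
    match b x, b y with
    | some (e, _), some (f, _) =>
      if max e f + 1 ≤ B then some (update b d (some (max e f + 1, false))) else none
    | _, _ => none
  | mul d x y, b =>
    match b x, b y with
    | some (e, p), some (f, q) =>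
      if e + f ≤ B then some (update b d (some (e + f, p && q))) else none
    | _, _ => none
  | load d a x, b =>
    match b x with
    | some (_, true) => if isIndexArray a then some (update b d (some (4, true))) else none
    | _ => none
  | store a x y, b =>
    match b x, b y with
    | some (_, true), some (f, q) =>
      if f ≤ B ∧ (isIndexArray a → q = true ∧ f ≤ 4) then some b else none
    | _, _ => none
  | seq P Q, b => (P.analyze B b).bind fun b' => Q.analyze B b'
  | branch _ P Q, b =>
    match P.analyze B b, Q.analyze B b with
    | some b₁, some b₂ => some fun r =>
      match b₁ r, b₂ r with
      | some (e, p), some (f, q) => some (max e f, p && q)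
      | _, _ => none
    | _, _ => none
  | loop _ _, _ => none

/-- The registers of `s` obey the bounds `b`. -/
def Obeys (M : ℕ) (b : Bounds) (s : State) : Prop :=
  ∀ r e p, b r = some (e, p) → |s.reg r| ≤ (M : ℤ) ^ e ∧ (p = true → 0 ≤ s.reg r)

/-- The index arrays of `s` hold numbers between `0` and `M ^ 4`. -/
def ArraysBounded (M : ℕ) (s : State) : Prop :=
  ∀ a, isIndexArray a = true → ∀ i, 0 ≤ s.arr a i ∧ s.arr a i ≤ (M : ℤ) ^ 4

theorem Obeys.setReg {M : ℕ} {b : Bounds} {s : State} (h : Obeys M b s) {d e : ℕ} {p : Bool}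
    {v : ℤ} (hv : |v| ≤ (M : ℤ) ^ e) (hp : p = true → 0 ≤ v) :
    Obeys M (update b d (some (e, p))) (s.setReg d v) := by
  intro r e' p' hr
  rw [State.reg_setReg]
  by_cases hrd : r = d
  · subst hrd
    rw [update_self, Option.some.injEq, Prod.mk.injEq] at hr
    obtain ⟨rfl, rfl⟩ := hr
    rw [if_pos rfl]
    exact ⟨hv, hp⟩
  · rw [update_of_ne hrd] at hr
    rw [if_neg hrd]
    exact h r e' p' hr

theorem pow_le_pow_of_le {M : ℕ} (hM : 2 ≤ M) {e f : ℕ} (h : e ≤ f) :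
    (M : ℤ) ^ e ≤ (M : ℤ) ^ f :=
  pow_le_pow_right₀ (by exact_mod_cast (by omega : 1 ≤ M)) h

/-- Since `2 ≤ M`, doubling costs at most one exponent. This is the rule for sums and differences in
`analyze`. -/
theorem abs_add_abs_le {M : ℕ} (hM : 2 ≤ M) {x y : ℤ} {e f : ℕ} (hx : |x| ≤ (M : ℤ) ^ e)
    (hy : |y| ≤ (M : ℤ) ^ f) : |x| + |y| ≤ (M : ℤ) ^ (max e f + 1) := by
  have h1 := hx.trans (pow_le_pow_of_le hM (le_max_left e f))
  have h2 := hy.trans (pow_le_pow_of_le hM (le_max_right e f))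
  have h3 : (2 : ℤ) ≤ M := by exact_mod_cast hM
  have h4 : (0 : ℤ) ≤ (M : ℤ) ^ max e f := by positivity
  rw [pow_succ]
  nlinarith

theorem abs_mul_le_pow {M : ℕ} {x y : ℤ} {e f : ℕ} (hx : |x| ≤ (M : ℤ) ^ e)
    (hy : |y| ≤ (M : ℤ) ^ f) : |x * y| ≤ (M : ℤ) ^ (e + f) := by
  rw [abs_mul, pow_add]
  exact mul_le_mul hx hy (abs_nonneg _) (by positivity)

/-- The analysis is an abstract interpretation by exponents. Contents of index arrays are tracked
only by the uniform bound `M ^ 4`, which every load assumes and every store restores; output arrays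
are never read. -/
theorem analyze_sound {M : ℕ} (hM : 2 ≤ M) {B : ℕ} (hB : 4 ≤ B) {P : Program} {b b' : Bounds}
    {s : State} (h : P.analyze B b = some b') (hs : Obeys M b s) (ha : ArraysBounded M s) :
    (∃ t ≤ P.cost, Exec ((M : ℤ) ^ B) P s t (P.eff s)) ∧ Obeys M b' (P.eff s) ∧
      ArraysBounded M (P.eff s) := by
  induction P generalizing b b' s with
  | const d c =>
    simp only [analyze, Option.ite_none_right_eq_some, Option.some.injEq] at h
    obtain ⟨hc, rfl⟩ := h
    have h1 : |c| ≤ (M : ℤ) ^ 1 := by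
      have : (2 : ℤ) ≤ M := by exact_mod_cast hM
      rw [pow_one]
      rcases hc with rfl | rfl
      · simp
      · rw [abs_one]; omega
    exact ⟨⟨1, le_rfl, Exec.const (h1.trans (pow_le_pow_of_le hM (by omega)))⟩,
      hs.setReg h1 fun _ => by omega, ha⟩
  | add d x y =>
    rw [analyze] at h
    split at h
    · next e p f q hx hy =>
      simp only [Option.ite_none_right_eq_some, Option.some.injEq] at h
      obtain ⟨hc, rfl⟩ := h
      obtain ⟨hx1, hx2⟩ := hs _ _ _ hx
      obtain ⟨hy1, hy2⟩ := hs _ _ _ hy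
      have h1 := (abs_add_le (s.reg x) (s.reg y)).trans (abs_add_abs_le hM hx1 hy1)
      refine ⟨⟨1, le_rfl, Exec.add (h1.trans (pow_le_pow_of_le hM hc))⟩,
        hs.setReg h1 fun hpq => ?_, ha⟩
      rw [Bool.and_eq_true] at hpq
      exact add_nonneg (hx2 hpq.1) (hy2 hpq.2)
    · simp at h
  | sub d x y =>
    rw [analyze] at h
    split at h
    · next e p f q hx hy =>
      simp only [Option.ite_none_right_eq_some, Option.some.injEq] at h
      obtain ⟨hc, rfl⟩ := h
      obtain ⟨hx1, hx2⟩ := hs _ _ _ hx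
      obtain ⟨hy1, hy2⟩ := hs _ _ _ hy
      have h1 := (abs_sub (s.reg x) (s.reg y)).trans (abs_add_abs_le hM hx1 hy1)
      exact ⟨⟨1, le_rfl, Exec.sub (h1.trans (pow_le_pow_of_le hM hc))⟩,
        hs.setReg h1 fun hpq => by simp at hpq, ha⟩
    · simp at h
  | mul d x y =>
    rw [analyze] at h
    split at h
    · next e p f q hx hy =>
      simp only [Option.ite_none_right_eq_some, Option.some.injEq] at h
      obtain ⟨hc, rfl⟩ := h
      obtain ⟨hx1, hx2⟩ := hs _ _ _ hx
      obtain ⟨hy1, hy2⟩ := hs _ _ _ hy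
      have h1 := abs_mul_le_pow hx1 hy1
      refine ⟨⟨1, le_rfl, Exec.mul (h1.trans (pow_le_pow_of_le hM hc))⟩,
        hs.setReg h1 fun hpq => ?_, ha⟩
      rw [Bool.and_eq_true] at hpq
      exact mul_nonneg (hx2 hpq.1) (hy2 hpq.2)
    · simp at h
  | load d a x =>
    rw [analyze] at h
    split at h
    · next e hx =>
      simp only [Option.ite_none_right_eq_some, Option.some.injEq] at h
      obtain ⟨hc, rfl⟩ := h
      obtain ⟨hx1, hx2⟩ := hs _ _ _ hx
      obtain ⟨h0, h1⟩ := ha a hc (s.reg x).toNat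
      have h2 : |s.arr a (s.reg x).toNat| ≤ (M : ℤ) ^ 4 := by rwa [abs_of_nonneg h0]
      exact ⟨⟨1, le_rfl, Exec.load (hx2 rfl) (h2.trans (pow_le_pow_of_le hM hB))⟩,
        hs.setReg h2 fun _ => h0, ha⟩
    · simp at h
  | store a x y =>
    rw [analyze] at h
    split at h
    · next e f q hx hy =>
      simp only [Option.ite_none_right_eq_some, Option.some.injEq] at h
      obtain ⟨⟨hc, hc'⟩, rfl⟩ := h
      obtain ⟨hx1, hx2⟩ := hs _ _ _ hx
      obtain ⟨hy1, hy2⟩ := hs _ _ _ hy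
      refine ⟨⟨1, le_rfl, Exec.store (hx2 rfl) (hy1.trans (pow_le_pow_of_le hM hc))⟩, hs, ?_⟩
      intro a' ha' i
      rw [eff, State.arr_setArr]
      split_ifs with h
      · rw [h.1] at ha'
        obtain ⟨hq, hf⟩ := hc' ha'
        exact ⟨hy2 hq, (le_abs_self _).trans (hy1.trans (pow_le_pow_of_le hM hf))⟩
      · exact ha a' ha' i
    · simp at h
  | seq P Q ihP ihQ =>
    rw [analyze, Option.bind_eq_some_iff] at h
    obtain ⟨b₁, h1, h2⟩ := h
    obtain ⟨⟨t, ht, hP⟩, hs1, ha1⟩ := ihP h1 hs ha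
    obtain ⟨⟨t', ht', hQ⟩, hs2, ha2⟩ := ihQ h2 hs1 ha1
    exact ⟨⟨t + t', add_le_add ht ht', Exec.seq hP hQ⟩, hs2, ha2⟩
  | branch x P Q ihP ihQ =>
    rw [analyze] at h
    split at h
    · next b₁ b₂ h1 h2 =>
      rw [Option.some.injEq] at h
      subst h
      obtain ⟨⟨t, ht, hP⟩, hs1, ha1⟩ := ihP h1 hs ha
      obtain ⟨⟨t', ht', hQ⟩, hs2, ha2⟩ := ihQ h2 hs ha
      rw [eff, cost]
      by_cases hx : 0 < s.reg x
      · rw [if_pos hx]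
        refine ⟨⟨t + 1, by omega, Exec.branch_pos hx hP⟩, ?_, ha1⟩
        intro r e p hr
        dsimp only at hr
        split at hr
        · next e₁ p₁ e₂ p₂ h1 h2 =>
          simp only [Option.some.injEq, Prod.mk.injEq] at hr
          obtain ⟨rfl, rfl⟩ := hr
          obtain ⟨h3, h4⟩ := hs1 _ _ _ h1
          exact ⟨h3.trans (pow_le_pow_of_le hM (le_max_left _ _)),
            fun hp => h4 (Bool.and_eq_true _ _ ▸ hp).1⟩
        · simp at hr
      · rw [if_neg hx]
        refine ⟨⟨t' + 1, by omega, Exec.branch_neg hx hQ⟩, ?_, ha2⟩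
        intro r e p hr
        dsimp only at hr
        split at hr
        · next e₁ p₁ e₂ p₂ h1 h2 =>
          simp only [Option.some.injEq, Prod.mk.injEq] at hr
          obtain ⟨rfl, rfl⟩ := hr
          obtain ⟨h3, h4⟩ := hs2 _ _ _ h2
          exact ⟨h3.trans (pow_le_pow_of_le hM (le_max_right _ _)),
            fun hp => h4 (Bool.and_eq_true _ _ ▸ hp).2⟩
        · simp at hr
    · simp at h
  | loop x P => simp [analyze] at h

/-! ### Counting loops -/

/-- Repeat `body` as often as register `c` says, with the number of earlier repetitions in
register `7`. Registers `3` and `4` hold `1` and `0`. -/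
def forLoop (c : ℕ) (body : Program) : Program :=
  seq (add 6 c 4) (seq (add 7 4 4) (loop 6 (seq body (seq (add 7 7 3) (sub 6 6 3)))))

/-- Registers `0` to `5` hold the numbers `n`, `q`, `p`, `1`, `0`, `k`. -/
structure HasParams (n q p k : ℕ) (s : State) : Prop where
  reg0 : s.reg 0 = n
  reg1 : s.reg 1 = q
  reg2 : s.reg 2 = p
  reg3 : s.reg 3 = 1
  reg4 : s.reg 4 = 0
  reg5 : s.reg 5 = k

/-- The bounds available to the body of a counting loop. -/
def loopBounds : Bounds := fun r => if r < 8 then some (1, true) else none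

theorem HasParams.congr {n q p k : ℕ} {s s' : State} (h : HasParams n q p k s)
    (h' : ∀ r < 6, s'.reg r = s.reg r) : HasParams n q p k s' := by
  constructor
  · rw [h' 0 (by norm_num), h.reg0]
  · rw [h' 1 (by norm_num), h.reg1]
  · rw [h' 2 (by norm_num), h.reg2]
  · rw [h' 3 (by norm_num), h.reg3]
  · rw [h' 4 (by norm_num), h.reg4]
  · rw [h' 5 (by norm_num), h.reg5]

theorem HasParams.obeys {n q p k M i j : ℕ} (hM : 2 ≤ M) {s : State} (h : HasParams n q p k s)
    (hn : n ≤ M) (hq : q ≤ M) (hp : p ≤ M) (hk : k ≤ M) (h6 : s.reg 6 = j) (hj : j ≤ M)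
    (h7 : s.reg 7 = i) (hi : i ≤ M) : Obeys M loopBounds s := by
  intro r e pos hr
  rw [loopBounds] at hr
  split_ifs at hr with hr8
  simp only [Option.some.injEq, Prod.mk.injEq] at hr
  obtain ⟨rfl, rfl⟩ := hr
  have key : ∀ m : ℕ, m ≤ M → s.reg r = m → |s.reg r| ≤ (M : ℤ) ^ 1 ∧ (true → 0 ≤ s.reg r) := by
    intro m hm hr
    rw [hr, pow_one, abs_of_nonneg (by positivity)]
    exact ⟨by exact_mod_cast hm, fun _ => by positivity⟩
  interval_cases r
  · exact key n hn h.reg0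
  · exact key q hq h.reg1
  · exact key p hp h.reg2
  · exact key 1 (by omega) (by simpa using h.reg3)
  · exact key 0 (by omega) (by simpa using h.reg4)
  · exact key k hk h.reg5
  · exact key j hj h6
  · exact key i hi h7

/-- The body leaves registers `0` to `7` alone, so `loopBounds` holds anew before each pass and a
single analysis serves all of them. A pass costs three further steps (two counter updates and the
test), and three more account for the initialization and the final test. -/
theorem forLoop_exec {n q p k M B c cnt : ℕ} (hM : 2 ≤ M) (hB : 4 ≤ B)
    (hn : n ≤ M) (hq : q ≤ M) (hp : p ≤ M) (hk : k ≤ M) (hcM : cnt ≤ M) {body : Program}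
    (hbody : (body.analyze B loopBounds).isSome = true) (hw : ∀ r < 8, r ∉ body.regsWritten)
    {I : ℕ → (ℕ → ℕ → ℤ) → Prop}
    (hI : ∀ i < cnt, ∀ s, HasParams n q p k s → s.reg 7 = i → I i s.arr → I (i + 1) (body.eff s).arr)
    {s : State} (hs : HasParams n q p k s) (hc : s.reg c = cnt) (ha : ArraysBounded M s)
    (h0 : I 0 s.arr) :
    ∃ t s', Exec ((M : ℤ) ^ B) (forLoop c body) s t s' ∧ t ≤ cnt * (body.cost + 3) + 3 ∧
      HasParams n q p k s' ∧ ArraysBounded M s' ∧ I cnt s'.arr := by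
  obtain ⟨b', hb'⟩ := Option.isSome_iff_exists.1 hbody
  have hpow : ∀ x : ℤ, 0 ≤ x → x ≤ M → |x| ≤ (M : ℤ) ^ B := by
    intro x h1 h2
    rw [abs_of_nonneg h1]
    have := pow_le_pow_of_le hM (e := 1) (f := B) (by omega)
    rw [pow_one] at this
    exact h2.trans this
  -- Induction on the number `j` of remaining passes, held in register `6`; register `7` is then
  -- `cnt - j`.
  have main : ∀ j ≤ cnt, ∀ s : State, HasParams n q p k s → s.reg 6 = j →
      s.reg 7 = ((cnt - j : ℕ) : ℤ) → ArraysBounded M s → I (cnt - j) s.arr →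
      ∃ t s', Exec ((M : ℤ) ^ B) (loop 6 (seq body (seq (add 7 7 3) (sub 6 6 3)))) s t s' ∧
        t ≤ j * (body.cost + 3) + 1 ∧ HasParams n q p k s' ∧ ArraysBounded M s' ∧
          I cnt s'.arr := by
    intro j
    induction j with
    | zero =>
      intro _ s hs h6 _ ha hi
      exact ⟨1, s, Exec.loop_neg (by rw [h6]; simp), by omega, hs, ha, hi⟩
    | succ j ih =>
      intro hj s hs h6 h7 ha hi
      obtain ⟨⟨t₁, ht₁, he₁⟩, -, ha₁⟩ := analyze_sound hM hB hb'
        (hs.obeys hM hn hq hp hk h6 (by omega) h7 (by omega)) ha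
      have hfr : ∀ r < 8, (body.eff s).reg r = s.reg r := fun r hr =>
        eff_reg_of_notMem (hw r hr) s
      set s₁ := body.eff s with hs₁
      have hi₁ := hI _ (by omega) s hs h7 hi
      have e7 : s₁.reg 7 + s₁.reg 3 = ((cnt - j : ℕ) : ℤ) := by
        rw [hfr 7 (by norm_num), hfr 3 (by norm_num), h7, hs.reg3]
        omega
      set s₂ := s₁.setReg 7 (s₁.reg 7 + s₁.reg 3) with hs₂
      have e6 : s₂.reg 6 - s₂.reg 3 = (j : ℤ) := by
        simp only [hs₂, State.reg_setReg]
        norm_num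
        rw [hfr 6 (by norm_num), hfr 3 (by norm_num), h6, hs.reg3]
        push_cast; ring
      have he₂ : Exec ((M : ℤ) ^ B) (add 7 7 3) s₁ 1 s₂ :=
        Exec.add (hpow _ (by rw [e7]; positivity) (by rw [e7]; norm_cast; omega))
      set s₃ := s₂.setReg 6 (s₂.reg 6 - s₂.reg 3) with hs₃
      have he₃ : Exec ((M : ℤ) ^ B) (sub 6 6 3) s₂ 1 s₃ :=
        Exec.sub (hpow _ (by rw [e6]; positivity) (by rw [e6]; norm_cast; omega))
      have hsub : cnt - (j + 1) + 1 = cnt - j := by omega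
      rw [hsub] at hi₁
      have hp₃ : HasParams n q p k s₃ := hs.congr fun r hr => by
        rw [hs₃, State.reg_setReg, if_neg (by omega), hs₂, State.reg_setReg, if_neg (by omega),
          hfr r (by omega)]
      obtain ⟨t, s', he, ht, h1, h2, h3⟩ := ih (by omega) s₃ hp₃
        (by rw [hs₃, State.reg_setReg, if_pos rfl, e6])
        (by rw [hs₃, State.reg_setReg, if_neg (by norm_num), hs₂, State.reg_setReg, if_pos rfl, e7])
        ha₁ hi₁
      refine ⟨_, s', Exec.loop_pos (by rw [h6]; positivity)
        (Exec.seq he₁ (Exec.seq he₂ he₃)) he, ?_, h1, h2, h3⟩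
      rw [add_mul]
      omega
  have e6 : s.reg c + s.reg 4 = cnt := by rw [hc, hs.reg4, add_zero]
  set s₁ := s.setReg 6 (s.reg c + s.reg 4) with hs₁
  have e7 : s₁.reg 4 + s₁.reg 4 = 0 := by
    simp only [hs₁, State.reg_setReg]; norm_num; exact hs.reg4
  have he₁ : Exec ((M : ℤ) ^ B) (add 6 c 4) s 1 s₁ :=
    Exec.add (hpow _ (by rw [e6]; positivity) (by rw [e6]; exact_mod_cast hcM))
  set s₂ := s₁.setReg 7 (s₁.reg 4 + s₁.reg 4) with hs₂
  have he₂ : Exec ((M : ℤ) ^ B) (add 7 4 4) s₁ 1 s₂ :=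
    Exec.add (hpow _ (by rw [e7]) (by rw [e7]; positivity))
  have hp₂ : HasParams n q p k s₂ := hs.congr fun r hr => by
    rw [hs₂, State.reg_setReg, if_neg (by omega), hs₁, State.reg_setReg, if_neg (by omega)]
  obtain ⟨t, s', he, ht, h1, h2, h3⟩ := main cnt le_rfl s₂ hp₂
    (by rw [hs₂, State.reg_setReg, if_neg (by norm_num), hs₁, State.reg_setReg, if_pos rfl, e6])
    (by rw [hs₂, State.reg_setReg, if_pos rfl, e7]; simp) ha (by rw [Nat.sub_self]; exact h0)
  exact ⟨_, s', Exec.seq he₁ (Exec.seq he₂ he), by omega, h1, h2, h3⟩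

end Program

end StableMatching

namespace StableMatching

open Function

namespace Program

/-! ### Insertion into cycles -/

/-- The array `a` stores the permutation `f`. -/
def Stores {n : ℕ} (arr : ℕ → ℕ → ℤ) (a : ℕ) (f : Equiv.Perm (Fin n)) : Prop :=
  ∀ x : Fin n, arr a x = ((f x : ℕ) : ℤ)

/-- Insert the index in register `9` after the one in register `8` in the permutation stored in
array `a`, whose inverse is stored in array `b`. -/
def insertAfter (a b : ℕ) : Program :=
  seq (load 10 a 8) (seq (store a 9 10) (seq (store b 10 9) (seq (store a 8 9) (store b 9 8))))

/-- With `f d` in register `10`, the four stores create the path `d`, `e`, `f d` in `a` and its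
reverse in `b`. Keeping the inverse alongside is what later makes `σ⁻¹` and `τ⁻¹` available in
constant time. -/
theorem eff_insertAfter {n : ℕ} {a b : ℕ} (hab : a ≠ b) {s : State} {f : Equiv.Perm (Fin n)}
    (ha : Stores s.arr a f) (hb : Stores s.arr b f⁻¹) {d e : Fin n} (hd : s.reg 8 = (d : ℕ))
    (he : s.reg 9 = (e : ℕ)) (hfe : f e = e) (hde : d ≠ e) :
    Stores ((insertAfter a b).eff s).arr a (f * Equiv.swap d e) ∧
      Stores ((insertAfter a b).eff s).arr b (f * Equiv.swap d e)⁻¹ := by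
  have hval : (d : ℕ) ≠ (e : ℕ) := fun h => hde (Fin.ext h)
  constructor
  · intro x
    simp only [insertAfter, eff, State.arr_setArr, State.reg_setArr, State.reg_setReg,
      State.arr_setReg, hd, he, Int.toNat_natCast]
    by_cases hxd : x = d
    · subst hxd
      simp [hab, hfe]
    · by_cases hxe : x = e
      · subst hxe
        simp [hab, Fin.val_inj, hxd, ha d]
      · simp [hab, Fin.val_inj, hxd, hxe, Equiv.swap_apply_of_ne_of_ne, ha x]
  · intro x
    simp only [insertAfter, eff, State.arr_setArr, State.reg_setArr, State.reg_setReg,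
      State.arr_setReg, hd, he, Int.toNat_natCast, ha d]
    have hfd : f d ≠ e := fun h => hde (f.injective (h.trans hfe.symm))
    by_cases hxe : x = e
    · subst hxe
      have h1 : f⁻¹ x = x := by rw [Equiv.Perm.inv_eq_iff_eq, hfe]
      simp [mul_inv_rev, h1, -Equiv.Perm.coe_inv]
    · by_cases hxd : x = f d
      · subst hxd
        simp [hab.symm, hfd, Fin.val_inj, mul_inv_rev]
      · have h1 : f⁻¹ x ≠ d := fun h => hxd (Equiv.Perm.inv_eq_iff_eq.1 h)
        have h2 : f⁻¹ x ≠ e := fun h => hxe ((Equiv.Perm.inv_eq_iff_eq.1 h).trans hfe)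
        have h3 := hb x
        have h4 : (f * Equiv.swap d e)⁻¹ x = f⁻¹ x := by
          rw [mul_inv_rev, Equiv.swap_inv, Equiv.Perm.mul_apply,
            Equiv.swap_apply_of_ne_of_ne h1 h2]
        rw [h4, ← h3]
        simp [hab.symm, Fin.val_inj, hxe, hxd]

theorem insertAfter_arr {a b c : ℕ} (ha : c ≠ a) (hb : c ≠ b) (s : State) :
    ((insertAfter a b).eff s).arr c = s.arr c :=
  eff_arr_of_notMem (by simp [insertAfter, arrsWritten, ha, hb]) s

theorem insertAfter_reg {a b r : ℕ} (h : r ≠ 10) (s : State) :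
    ((insertAfter a b).eff s).reg r = s.reg r :=
  eff_reg_of_notMem (by simp [insertAfter, regsWritten, h]) s

/-! ### Polynomials -/

open Polynomial

/-- Registers `20` to `26` hold the coefficients of `P`. -/
def HasPoly (s : State) (P : ℤ[X]) : Prop := ∀ j ≤ 6, s.reg (20 + j) = P.coeff j

/-- Multiply the polynomial in registers `20` to `26` by `X - c`, where `c` is in register `x`. -/
def mulLinear (x : ℕ) : Program :=
  let f := fun j => seq (mul 12 x (21 + j)) (sub (21 + j) (20 + j) 12)
  seq (f 5) (seq (f 4) (seq (f 3) (seq (f 2) (seq (f 1) (seq (f 0)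
    (seq (mul 12 x 20) (sub 20 4 12)))))))

/-- Multiply the polynomial in registers `20` to `26` by the number in register `x`. -/
def mulScalar (x : ℕ) : Program :=
  seq (mul 20 x 20) (seq (mul 21 x 21) (seq (mul 22 x 22) (seq (mul 23 x 23) (seq (mul 24 x 24)
    (seq (mul 25 x 25) (mul 26 x 26))))))

/-- The coefficients are updated from the top, so each one still finds its lower neighbour
unchanged. No degree bound is required, since truncation after the sixth power is compatible with
multiplication. -/
theorem HasPoly.mulLinear {s : State} {P : ℤ[X]} (h : HasPoly s P) {x : ℕ} (hx : x < 12)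
    {c : ℤ} (hc : s.reg x = c) (h4 : s.reg 4 = 0) :
    HasPoly ((mulLinear x).eff s) (P * (X - C c)) := by
  have h0 := h 0 (by norm_num)
  have h1 := h 1 (by norm_num)
  have h2 := h 2 (by norm_num)
  have h3 := h 3 (by norm_num)
  have h4' := h 4 (by norm_num)
  have h5 := h 5 (by norm_num)
  have h6 := h 6 (by norm_num)
  norm_num at h0 h1 h2 h3 h4' h5 h6
  have e12 : x ≠ 12 := by omega
  have e20 : x ≠ 20 := by omega
  have e21 : x ≠ 21 := by omega
  have e22 : x ≠ 22 := by omega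
  have e23 : x ≠ 23 := by omega
  have e24 : x ≠ 24 := by omega
  have e25 : x ≠ 25 := by omega
  have e26 : x ≠ 26 := by omega
  intro j hj
  rcases j with _ | j
  · simp [Program.mulLinear, eff, e12, e21, e22, e23, e24, e25, e26, hc, h4, h0, mul_sub,
      mul_comm c]
  · rw [coeff_mul_X_sub_C]
    have hj' : j ≤ 5 := by omega
    interval_cases j <;>
    simp [Program.mulLinear, eff, e12, e21, e22, e23, e24, e25, e26, hc, h0, h1, h2, h3,
      h4', h5, h6, mul_comm c]

theorem HasPoly.mulScalar {s : State} {P : ℤ[X]} (h : HasPoly s P) {x : ℕ} (hx : x < 20)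
    {c : ℤ} (hc : s.reg x = c) : HasPoly ((mulScalar x).eff s) (C c * P) := by
  have e20 : x ≠ 20 := by omega
  have e21 : x ≠ 21 := by omega
  have e22 : x ≠ 22 := by omega
  have e23 : x ≠ 23 := by omega
  have e24 : x ≠ 24 := by omega
  have e25 : x ≠ 25 := by omega
  intro j hj
  rw [coeff_C_mul, ← h j hj]
  interval_cases j <;> simp [Program.mulScalar, eff, e20, e21, e22, e23, e24, e25, hc]

theorem HasPoly.add_one {s : State} {P : ℤ[X]} (h : HasPoly s P) (h3 : s.reg 3 = 1) :
    HasPoly ((add 20 20 3).eff s) (P + 1) := by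
  intro j hj
  have := h j hj
  rw [coeff_add, coeff_one, ← this]
  rcases j with _ | j
  · simp [eff, h3]
  · simp [eff]

theorem HasPoly.add_X {s : State} {P : ℤ[X]} (h : HasPoly s P) (h3 : s.reg 3 = 1) :
    HasPoly ((add 21 21 3).eff s) (P + X) := by
  intro j hj
  have := h j hj
  rw [coeff_add, coeff_X, ← this]
  by_cases hj1 : j = 1
  · subst hj1
    simp [eff, h3]
  · simp [eff, Ne.symm hj1, show 20 + j ≠ 21 by omega]

/-- Initialize the polynomial in registers `20` to `26` with `1`. -/
def initPoly : Program :=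
  seq (const 20 1) (seq (const 21 0) (seq (const 22 0) (seq (const 23 0) (seq (const 24 0)
    (seq (const 25 0) (const 26 0))))))

theorem hasPoly_initPoly (s : State) : HasPoly (initPoly.eff s) 1 := by
  intro j hj
  rw [coeff_one]
  interval_cases j <;> simp [initPoly, eff]

/-- A polynomial that has its largest values on `{0, …, n - 1}` at `x`, `y`, `z`, in this
order. -/
noncomputable def rankPoly (n x y z : ℤ) : ℤ[X] :=
  C (-n) * ((C (n * n) * ((C (n * n * (n * n)) * ((1 * (X - C z)) * (X - C z)) + 1)
    * (X - C y) * (X - C y)) + 1) * (X - C x) * (X - C x)) + X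

/-- Compute the coefficients of the ranking polynomial with top three as in registers `8`, `9`,
`10`. -/
def computePoly : Program :=
  seq (mul 13 0 0) (seq (mul 14 13 13) (seq (sub 15 4 0) (seq initPoly
    (seq (mulLinear 10) (seq (mulLinear 10) (seq (mulScalar 14) (seq (add 20 20 3)
      (seq (mulLinear 9) (seq (mulLinear 9) (seq (mulScalar 13) (seq (add 20 20 3)
        (seq (mulLinear 8) (seq (mulLinear 8) (seq (mulScalar 15) (add 21 21 3)))))))))))))))

theorem mulLinear_reg {x r : ℕ} (h : r < 20) (h' : r ≠ 12) (s : State) :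
    ((mulLinear x).eff s).reg r = s.reg r :=
  eff_reg_of_notMem (by simp [mulLinear, regsWritten]; omega) s

theorem mulScalar_reg {x r : ℕ} (h : r < 20) (s : State) :
    ((mulScalar x).eff s).reg r = s.reg r :=
  eff_reg_of_notMem (by simp [mulScalar, regsWritten]; omega) s

theorem initPoly_reg {r : ℕ} (h : r < 20) (s : State) :
    (initPoly.eff s).reg r = s.reg r :=
  eff_reg_of_notMem (by simp [initPoly, regsWritten]; omega) s

/-- `rankPoly` is written in the nested order in which the program multiplies; the weights `n²`,
`n⁴` and `-n` are in registers `13`, `14` and `15`. -/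
theorem hasPoly_computePoly {s : State} {n x y z : ℤ} (h0 : s.reg 0 = n) (h3 : s.reg 3 = 1)
    (h4 : s.reg 4 = 0) (h8 : s.reg 8 = x) (h9 : s.reg 9 = y) (h10 : s.reg 10 = z) :
    HasPoly (computePoly.eff s) (rankPoly n x y z) := by
  simp only [computePoly, eff]
  set s₁ := ((s.setReg 13 (s.reg 0 * s.reg 0)).setReg 14 _).setReg 15 _ with hs₁
  have g3 : s₁.reg 3 = 1 := by simp [hs₁, h3]
  have g4 : s₁.reg 4 = 0 := by simp [hs₁, h4]
  have g8 : s₁.reg 8 = x := by simp [hs₁, h8]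
  have g9 : s₁.reg 9 = y := by simp [hs₁, h9]
  have g10 : s₁.reg 10 = z := by simp [hs₁, h10]
  have g13 : s₁.reg 13 = n * n := by simp [hs₁, h0]
  have g14 : s₁.reg 14 = n * n * (n * n) := by simp [hs₁, h0]
  have g15 : s₁.reg 15 = -n := by simp [hs₁, h0, h4]
  clear_value s₁
  have k2 := ((hasPoly_initPoly s₁).mulLinear (x := 10) (by norm_num)
    (by rw [initPoly_reg (by norm_num), g10]) (by rw [initPoly_reg (by norm_num), g4]))
  set s₂ := (mulLinear 10).eff (initPoly.eff s₁) with hs₂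
  have f2 : ∀ r < 20, r ≠ 12 → s₂.reg r = s₁.reg r := fun r hr hr' => by
    rw [hs₂, mulLinear_reg hr hr', initPoly_reg hr]
  clear_value s₂
  have k3 := k2.mulLinear (x := 10) (by norm_num) (by rw [f2 _ (by norm_num) (by norm_num), g10])
    (by rw [f2 _ (by norm_num) (by norm_num), g4])
  set s₃ := (mulLinear 10).eff s₂ with hs₃
  have f3 : ∀ r < 20, r ≠ 12 → s₃.reg r = s₁.reg r := fun r hr hr' => by
    rw [hs₃, mulLinear_reg hr hr', f2 r hr hr']
  clear_value s₃
  have k4 := (k3.mulScalar (x := 14) (by norm_num)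
    (by rw [f3 _ (by norm_num) (by norm_num), g14])).add_one
    (by rw [mulScalar_reg (by norm_num), f3 _ (by norm_num) (by norm_num), g3])
  simp only [eff] at k4
  set s₄ := ((mulScalar 14).eff s₃).setReg 20 _ with hs₄
  have f4 : ∀ r < 20, r ≠ 12 → s₄.reg r = s₁.reg r := fun r hr hr' => by
    rw [hs₄, State.reg_setReg, if_neg (by omega), mulScalar_reg hr, f3 r hr hr']
  clear_value s₄
  have k5 := k4.mulLinear (x := 9) (by norm_num) (by rw [f4 _ (by norm_num) (by norm_num), g9])
    (by rw [f4 _ (by norm_num) (by norm_num), g4])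
  set s₅ := (mulLinear 9).eff s₄ with hs₅
  have f5 : ∀ r < 20, r ≠ 12 → s₅.reg r = s₁.reg r := fun r hr hr' => by
    rw [hs₅, mulLinear_reg hr hr', f4 r hr hr']
  clear_value s₅
  have k6 := k5.mulLinear (x := 9) (by norm_num) (by rw [f5 _ (by norm_num) (by norm_num), g9])
    (by rw [f5 _ (by norm_num) (by norm_num), g4])
  set s₆ := (mulLinear 9).eff s₅ with hs₆
  have f6 : ∀ r < 20, r ≠ 12 → s₆.reg r = s₁.reg r := fun r hr hr' => by
    rw [hs₆, mulLinear_reg hr hr', f5 r hr hr']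
  clear_value s₆
  have k7 := (k6.mulScalar (x := 13) (by norm_num)
    (by rw [f6 _ (by norm_num) (by norm_num), g13])).add_one
    (by rw [mulScalar_reg (by norm_num), f6 _ (by norm_num) (by norm_num), g3])
  simp only [eff] at k7
  set s₇ := ((mulScalar 13).eff s₆).setReg 20 _ with hs₇
  have f7 : ∀ r < 20, r ≠ 12 → s₇.reg r = s₁.reg r := fun r hr hr' => by
    rw [hs₇, State.reg_setReg, if_neg (by omega), mulScalar_reg hr, f6 r hr hr']
  clear_value s₇
  have k8 := k7.mulLinear (x := 8) (by norm_num) (by rw [f7 _ (by norm_num) (by norm_num), g8])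
    (by rw [f7 _ (by norm_num) (by norm_num), g4])
  set s₈ := (mulLinear 8).eff s₇ with hs₈
  have f8 : ∀ r < 20, r ≠ 12 → s₈.reg r = s₁.reg r := fun r hr hr' => by
    rw [hs₈, mulLinear_reg hr hr', f7 r hr hr']
  clear_value s₈
  have k9 := k8.mulLinear (x := 8) (by norm_num) (by rw [f8 _ (by norm_num) (by norm_num), g8])
    (by rw [f8 _ (by norm_num) (by norm_num), g4])
  set s₉ := (mulLinear 8).eff s₈ with hs₉
  have f9 : ∀ r < 20, r ≠ 12 → s₉.reg r = s₁.reg r := fun r hr hr' => by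
    rw [hs₉, mulLinear_reg hr hr', f8 r hr hr']
  clear_value s₉
  exact (k9.mulScalar (x := 15) (by norm_num)
    (by rw [f9 _ (by norm_num) (by norm_num), g15])).add_X
    (by rw [mulScalar_reg (by norm_num), f9 _ (by norm_num) (by norm_num), g3])

theorem rankPoly_natDegree (n x y z : ℤ) : (rankPoly n x y z).natDegree ≤ 6 := by
  unfold rankPoly
  compute_degree

theorem rankPoly_eval (n x y z t : ℤ) : (rankPoly n x y z).eval t =
    t - n * ((t - x) ^ 2 * (1 + n ^ 2 * ((t - y) ^ 2 * (1 + n ^ 4 * (t - z) ^ 2)))) := by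
  simp only [rankPoly, eval_add, eval_mul, eval_sub, eval_C, eval_X, eval_one]
  ring

/-- The constant term is the same for all candidates and can be dropped. Six coefficients remain,
whence six attributes. -/
theorem rankPoly_eval_zero_add (n x y z t : ℤ) : (rankPoly n x y z).eval t =
    (rankPoly n x y z).coeff 0 +
      ∑ j ∈ Finset.range 6, (rankPoly n x y z).coeff (j + 1) * t ^ (j + 1) := by
  rw [eval_eq_sum_range' (n := 7) (by have := rankPoly_natDegree n x y z; omega),
    Finset.sum_range_succ', add_comm]
  simp

end Program

end StableMatching

namespace StableMatching

open Function Polynomial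

namespace Program

/-! ### Ranking -/

/-- The penalty subtracted by the ranking polynomial. -/
def penalty (n x y z t : ℤ) : ℤ :=
  (t - x) ^ 2 * (1 + n ^ 2 * ((t - y) ^ 2 * (1 + n ^ 4 * (t - z) ^ 2)))

/-- Penalties are integers, so the smaller one wins by at least `n`, while the summand `t` can make
up only for less than `n`. -/
theorem rankPoly_eval_lt {n x y z a b : ℤ} (hn : 0 ≤ n) (ha : 0 ≤ a) (hb : b < n)
    (h : penalty n x y z a < penalty n x y z b) :
    (rankPoly n x y z).eval b < (rankPoly n x y z).eval a := by
  rw [rankPoly_eval, rankPoly_eval]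
  change b - n * penalty n x y z b < a - n * penalty n x y z a
  nlinarith

/-- Candidates with equal penalties are separated by the summand `t`. -/
theorem rankPoly_eval_injective {n x y z a b : ℤ} (ha : 0 ≤ a) (ha' : a < n) (hb : 0 ≤ b)
    (hb' : b < n) (h : (rankPoly n x y z).eval a = (rankPoly n x y z).eval b) : a = b := by
  rcases lt_trichotomy (penalty n x y z a) (penalty n x y z b) with h1 | h1 | h1
  · exact absurd h.symm (rankPoly_eval_lt (by omega) ha hb' h1).ne
  · rw [rankPoly_eval, rankPoly_eval] at h
    change a - n * penalty n x y z a = b - n * penalty n x y z b at h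
    rw [h1] at h
    omega
  · exact absurd h (rankPoly_eval_lt (by omega) hb ha' h1).ne

theorem one_le_sq_of_ne {a b : ℤ} (h : a ≠ b) : 1 ≤ (a - b) ^ 2 := by
  have h1 := sub_ne_zero.2 h
  have h2 : 0 < (a - b) ^ 2 := by positivity
  omega

theorem sq_sub_le {n a b : ℤ} (ha : 0 ≤ a) (ha' : a < n) (hb : 0 ≤ b) (hb' : b < n) :
    (a - b) ^ 2 ≤ n ^ 2 := by
  apply sq_le_sq'
  · omega
  · omega

theorem penalty_first_lt {n x y z t : ℤ} (h : t ≠ x) :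
    penalty n x y z x < penalty n x y z t := by
  have h1 := one_le_sq_of_ne h
  have h2 : 0 ≤ n ^ 2 * ((t - y) ^ 2 * (1 + n ^ 4 * (t - z) ^ 2)) := by positivity
  simp only [penalty, sub_self]
  nlinarith

/-- At `y` only `(y - x)² ≤ n²` is left, whereas away from `x` and `y` the weight `n²` makes the
penalty at least `1 + n²`. -/
theorem penalty_second_lt {n x y z t : ℤ} (hx : 0 ≤ x) (hx' : x < n) (hy : 0 ≤ y) (hy' : y < n)
    (h : t ≠ x) (h' : t ≠ y) : penalty n x y z y < penalty n x y z t := by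
  have h1 := one_le_sq_of_ne h
  have h2 := one_le_sq_of_ne h'
  have h3 := sq_sub_le hy hy' hx hx'
  have h4 : 0 ≤ n ^ 4 * (t - z) ^ 2 := by positivity
  have h5 : 1 ≤ (t - y) ^ 2 * (1 + n ^ 4 * (t - z) ^ 2) := by nlinarith
  have h6 : n ^ 2 ≤ n ^ 2 * ((t - y) ^ 2 * (1 + n ^ 4 * (t - z) ^ 2)) :=
    le_mul_of_one_le_right (by positivity) h5
  simp only [penalty, sub_self]
  nlinarith

/-- At `z` the penalty is at most `n² (1 + n⁴)`, whereas away from all three favourites it is at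
least `1 + n² (1 + n⁴)`. The favourites need not be distinct, as agents with fewer than three
require. -/
theorem penalty_third_lt {n x y z t : ℤ} (hx : 0 ≤ x) (hx' : x < n) (hy : 0 ≤ y) (hy' : y < n)
    (hz : 0 ≤ z) (hz' : z < n) (h : t ≠ x) (h' : t ≠ y) (h'' : t ≠ z) :
    penalty n x y z z < penalty n x y z t := by
  have h1 := one_le_sq_of_ne h
  have h2 := one_le_sq_of_ne h'
  have h3 := one_le_sq_of_ne h''
  have h4 := sq_sub_le hz hz' hx hx'
  have h5 := sq_sub_le hz hz' hy hy'
  have hn4 : 0 ≤ n ^ 4 := by positivity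
  have hn2 : 0 ≤ n ^ 2 := by positivity
  have h6 : 1 + n ^ 4 ≤ (t - y) ^ 2 * (1 + n ^ 4 * (t - z) ^ 2) :=
    calc 1 + n ^ 4 ≤ 1 + n ^ 4 * (t - z) ^ 2 :=
          add_le_add_right (le_mul_of_one_le_right hn4 h3) 1
      _ ≤ _ := le_mul_of_one_le_left (by positivity) h2
  have h7 : 1 + n ^ 2 * (1 + n ^ 4) ≤ penalty n x y z t :=
    calc 1 + n ^ 2 * (1 + n ^ 4)
        ≤ 1 + n ^ 2 * ((t - y) ^ 2 * (1 + n ^ 4 * (t - z) ^ 2)) :=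
          add_le_add_right (mul_le_mul_of_nonneg_left h6 hn2) 1
      _ ≤ _ := le_mul_of_one_le_left (by positivity) h1
  have h8 : penalty n x y z z ≤ n ^ 2 * (1 + n ^ 2 * n ^ 2) := by
    have h9 : 1 + n ^ 2 * (z - y) ^ 2 ≤ 1 + n ^ 2 * n ^ 2 :=
      add_le_add_right (mul_le_mul_of_nonneg_left h5 hn2) 1
    simp only [penalty, sub_self]
    calc _ = (z - x) ^ 2 * (1 + n ^ 2 * (z - y) ^ 2) := by ring
      _ ≤ _ := mul_le_mul h4 h9 (by positivity) hn2
  have h10 : n ^ 2 * (1 + n ^ 2 * n ^ 2) = n ^ 2 * (1 + n ^ 4) := by ring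
  omega

/-- An injective integer score on `Fin n` gives a ranking by decreasing score. -/
theorem exists_rank {n : ℕ} (f : Fin n → ℤ) (hf : Injective f) :
    ∃ e : Equiv.Perm (Fin n), ∀ a b, e a < e b ↔ f b < f a := by
  have hinj : Injective fun a => -f a := neg_injective.comp hf
  have hcard : (Finset.univ.image fun a => -f a).card = n := by
    rw [Finset.card_image_of_injective _ hinj, Finset.card_fin]
  let o := (Finset.univ.image fun a => -f a).orderIsoOfFin hcard
  let g : Fin n → Fin n := fun a =>
    o.symm ⟨-f a, Finset.mem_image_of_mem _ (Finset.mem_univ a)⟩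
  have hg : ∀ a b, g a < g b ↔ f b < f a := by
    intro a b
    simp only [g, o.symm.lt_iff_lt, Subtype.mk_lt_mk, neg_lt_neg_iff]
  have hgi : Injective g := by
    intro a b hab
    have := o.symm.injective hab
    exact hinj (congrArg Subtype.val this)
  exact ⟨Equiv.ofBijective g (Finite.injective_iff_bijective.1 hgi), hg⟩

/-! ### Output -/

/-- Write registers `21` to `26` to the first six cells of the row of array `a` whose number is in
register `7`. -/
def writeRow (a : ℕ) : Program :=
  let f := fun j => seq (store a 11 j) (add 11 11 3)
  seq (mul 11 7 5) (seq (f 21) (seq (f 22) (seq (f 23) (seq (f 24) (seq (f 25) (f 26))))))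

/-- The first `i` rows of array `a`, of length `k`, have been written. -/
def RowsWritten {n : ℕ} (k : ℕ) (arr : ℕ → ℕ → ℤ) (a i : ℕ) (F : Fin n → ℕ → ℤ) : Prop :=
  ∀ (x : Fin n) (j : ℕ), j < k →
    arr a (x * k + j) = if (x : ℕ) < i ∧ j < 6 then F x j else 0

theorem row_index {k x x' j j' : ℕ} (hj : j < k) (hj' : j' < k) :
    x * k + j = x' * k + j' ↔ x = x' ∧ j = j' := by
  constructor
  · intro h
    have h1 : (x * k + j) / k = x := by
      rw [mul_comm, Nat.mul_add_div (by omega), Nat.div_eq_of_lt hj, add_zero]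
    have h2 : (x' * k + j') / k = x' := by
      rw [mul_comm, Nat.mul_add_div (by omega), Nat.div_eq_of_lt hj', add_zero]
    have h3 : x = x' := by rw [← h1, h, h2]
    subst h3
    exact ⟨rfl, by omega⟩
  · rintro ⟨rfl, rfl⟩; rfl

/-- Rows have length `k`, but only six cells of each are written; the others keep their initial zero
and pad the profiles to `k` attributes. -/
theorem writeRow_rowsWritten {n k a i : ℕ} (hk : 6 ≤ k) {F : Fin n → ℕ → ℤ} {s : State}
    (hi : i < n) (h3 : s.reg 3 = 1) (h5 : s.reg 5 = k) (h7 : s.reg 7 = i)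
    (hF : ∀ j < 6, s.reg (21 + j) = F ⟨i, hi⟩ j) (h : RowsWritten k s.arr a i F) :
    RowsWritten k ((writeRow a).eff s).arr a (i + 1) F := by
  intro x j hj
  have e : ∀ m : ℕ, ((i : ℤ) * k + m).toNat = i * k + m := fun m => by
    rw [← Int.toNat_natCast (i * k + m)]; push_cast; rfl
  have e0 : ((i : ℤ) * k).toNat = i * k + 0 := by simpa using e 0
  have e1 : ((i : ℤ) * k + 1).toNat = i * k + 1 := by simpa using e 1
  have e2 : ((i : ℤ) * k + 1 + 1).toNat = i * k + 2 := by
    rw [← e 2]; congr 1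
  have e3 : ((i : ℤ) * k + 1 + 1 + 1).toNat = i * k + 3 := by
    rw [← e 3]; congr 1
  have e4 : ((i : ℤ) * k + 1 + 1 + 1 + 1).toNat = i * k + 4 := by
    rw [← e 4]; congr 1
  have e5 : ((i : ℤ) * k + 1 + 1 + 1 + 1 + 1).toNat = i * k + 5 := by
    rw [← e 5]; congr 1
  have f0 := hF 0 (by norm_num)
  have f1 := hF 1 (by norm_num)
  have f2 := hF 2 (by norm_num)
  have f3 := hF 3 (by norm_num)
  have f4 := hF 4 (by norm_num)
  have f5 := hF 5 (by norm_num)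
  norm_num at f0 f1 f2 f3 f4 f5
  have hrow := h x j hj
  simp only [writeRow, eff, State.arr_setArr, State.reg_setArr, State.reg_setReg,
    State.arr_setReg, h3, h5, h7]
  norm_num [e0, e1, e2, e3, e4, e5]
  rw [hrow]
  have r0 := row_index (k := k) (x := x) (x' := i) hj (by omega : 0 < k)
  simp only [add_zero] at r0
  simp only [r0, row_index hj (by omega : 1 < k), row_index hj (by omega : 2 < k),
    row_index hj (by omega : 3 < k), row_index hj (by omega : 4 < k),
    row_index hj (by omega : 5 < k), f0, f1, f2, f3, f4, f5]
  by_cases hx : (x : ℕ) = i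
  · obtain rfl : x = ⟨i, hi⟩ := Fin.ext hx
    by_cases hj6 : j < 6
    · interval_cases j <;> simp
    · have : j ≠ 5 ∧ j ≠ 4 ∧ j ≠ 3 ∧ j ≠ 2 ∧ j ≠ 1 ∧ j ≠ 0 := by omega
      simp [this, hj6]
  · have : (x : ℕ) ≤ i ↔ (x : ℕ) < i := by omega
    simp [hx, this]

theorem writeRow_reg {a r : ℕ} (h : r ≠ 11) (s : State) : ((writeRow a).eff s).reg r = s.reg r :=
  eff_reg_of_notMem (by simp [writeRow, regsWritten, h]) s

theorem writeRow_arr {a b : ℕ} (h : b ≠ a) (s : State) : ((writeRow a).eff s).arr b = s.arr b :=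
  eff_arr_of_notMem (by simp [writeRow, arrsWritten, h]) s

/-- Put the powers of register `7` into registers `21` to `26`. -/
def powers : Program :=
  seq (add 21 7 4) (seq (mul 22 21 7) (seq (mul 23 22 7) (seq (mul 24 23 7) (seq (mul 25 24 7)
    (mul 26 25 7)))))

theorem powers_reg_of_lt {s : State} {i : ℤ} (h4 : s.reg 4 = 0) (h7 : s.reg 7 = i) :
    ∀ j < 6, (powers.eff s).reg (21 + j) = i ^ (j + 1) := by
  intro j hj
  interval_cases j <;> simp [powers, eff, h4, h7] <;> ring

theorem powers_reg {r : ℕ} (h : r < 20) (s : State) : (powers.eff s).reg r = s.reg r :=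
  eff_reg_of_notMem (by simp [powers, regsWritten]; omega) s

/-- Put into registers `8`, `9`, `10` the favourites of the agent `i` in register `7`: the
entries `i` of arrays `a` and `b` are the first and the last one, and the second one is the last one
if register `16` is positive, and `i` otherwise. -/
def loadFavourites (a b : ℕ) : Program :=
  seq (load 8 a 7) (seq (load 10 b 7) (branch 16 (load 9 b 7) (add 9 7 4)))

theorem eff_loadFavourites {a b i : ℕ} {s : State} (h4 : s.reg 4 = 0) (h7 : s.reg 7 = i) :
    ((loadFavourites a b).eff s).reg 8 = s.arr a i ∧
    ((loadFavourites a b).eff s).reg 9 = (if 0 < s.reg 16 then s.arr b i else i) ∧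
    ((loadFavourites a b).eff s).reg 10 = s.arr b i := by
  by_cases h : 0 < s.reg 16 <;> simp [loadFavourites, eff, h, h4, h7]

theorem loadFavourites_reg {a b r : ℕ} (h : r < 8 ∨ 10 < r) (s : State) :
    ((loadFavourites a b).eff s).reg r = s.reg r :=
  eff_reg_of_notMem (by simp [loadFavourites, regsWritten]; omega) s

theorem loadFavourites_arr {a b : ℕ} (s : State) : ((loadFavourites a b).eff s).arr = s.arr := by
  ext c
  rw [eff_arr_of_notMem (by simp [loadFavourites, arrsWritten])]

theorem computePoly_reg {r : ℕ} (h : r < 12 ∨ r = 16) (s : State) :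
    (computePoly.eff s).reg r = s.reg r :=
  eff_reg_of_notMem
    (by simp [computePoly, mulLinear, mulScalar, initPoly, regsWritten]; omega) s

theorem computePoly_arr (s : State) : (computePoly.eff s).arr = s.arr := by
  ext c
  rw [eff_arr_of_notMem
    (by simp [computePoly, mulLinear, mulScalar, initPoly, arrsWritten])]

/-- Write row `i` of the array `c` of linear functions, where `i` is in register `7`. -/
def writeFun (a b c : ℕ) : Program :=
  seq (loadFavourites a b) (seq computePoly (writeRow c))

theorem writeFun_reg {a b c r : ℕ} (h : r < 8 ∨ r = 16) (s : State) :
    ((writeFun a b c).eff s).reg r = s.reg r := by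
  simp only [writeFun, eff]
  rw [writeRow_reg (by omega), computePoly_reg (by omega), loadFavourites_reg (by omega)]

theorem writeFun_arr {a b c d : ℕ} (h : d ≠ c) (s : State) :
    ((writeFun a b c).eff s).arr d = s.arr d := by
  simp only [writeFun, eff]
  rw [writeRow_arr h, computePoly_arr, loadFavourites_arr]

/-- The coefficients of the linear functions of agents with given favourites. -/
noncomputable def funRow {n : ℕ} (f g : Equiv.Perm (Fin n)) (p : ℕ) (x : Fin n) (j : ℕ) : ℤ :=
  (rankPoly n (f x : ℕ) (if (x : ℕ) < p then (g x : ℕ) else (x : ℕ)) (g x : ℕ)).coeff (j + 1)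

theorem writeFun_rowsWritten {n q p k a b c i : ℕ} (hk : 6 ≤ k) {s : State} (hi : i < n)
    (hs : HasParams n q p k s) (h7 : s.reg 7 = i) (h16 : s.reg 16 = (p : ℤ) - i)
    {f g : Equiv.Perm (Fin n)} (hf : Stores s.arr a f) (hg : Stores s.arr b g)
    (h : RowsWritten k s.arr c i (funRow f g p)) :
    RowsWritten k ((writeFun a b c).eff s).arr c (i + 1) (funRow f g p) := by
  simp only [writeFun, eff]
  obtain ⟨h8, h9, h10⟩ := eff_loadFavourites (a := a) (b := b) hs.reg4 h7
  set s₁ := (loadFavourites a b).eff s with hs₁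
  have f1 : ∀ r < 8, s₁.reg r = s.reg r := fun r hr => loadFavourites_reg (Or.inl hr) s
  have f1' : s₁.arr = s.arr := loadFavourites_arr s
  clear_value s₁
  have hp := hasPoly_computePoly ((f1 0 (by norm_num)).trans hs.reg0)
    ((f1 3 (by norm_num)).trans hs.reg3) ((f1 4 (by norm_num)).trans hs.reg4) h8 h9 h10
  have f2 : ∀ r < 8, (computePoly.eff s₁).reg r = s.reg r := fun r hr => by
    rw [computePoly_reg (by omega), f1 r hr]
  refine writeRow_rowsWritten hk hi ((f2 3 (by norm_num)).trans hs.reg3)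
    ((f2 5 (by norm_num)).trans hs.reg5) ((f2 7 (by norm_num)).trans h7) ?_
    (by rwa [computePoly_arr, f1'])
  intro j hj
  have := hp (j + 1) (by omega)
  rw [show 21 + j = 20 + (j + 1) by ring, this, funRow]
  have ef := hf ⟨i, hi⟩
  have eg := hg ⟨i, hi⟩
  dsimp only at ef eg
  have hcond : (0 < s.reg 16) ↔ i < p := by rw [h16]; omega
  simp only [ef, eg, hcond]

/-- Write the profiles of the man and the woman with the index in register `7`. -/
def outputBody : Program :=
  seq powers (seq (writeRow 2) (seq (writeRow 4) (seq (sub 16 2 7)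
    (seq (writeFun 7 8 3) (writeFun 9 6 5)))))

/-- The vectors of the agents. -/
def vecRow {n : ℕ} (x : Fin n) (j : ℕ) : ℤ := ((x : ℕ) : ℤ) ^ (j + 1)

/-- The arrays after the output of the first `i` agents of both groups. -/
structure OutputWritten {n : ℕ} (σ τ : Equiv.Perm (Fin n)) (p k i : ℕ) (arr : ℕ → ℕ → ℤ) :
    Prop where
  arr6 : Stores arr 6 σ
  arr7 : Stores arr 7 σ⁻¹
  arr8 : Stores arr 8 τ
  arr9 : Stores arr 9 τ⁻¹
  arr2 : RowsWritten k arr 2 i (vecRow (n := n))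
  arr3 : RowsWritten k arr 3 i (funRow σ⁻¹ τ p)
  arr4 : RowsWritten k arr 4 i (vecRow (n := n))
  arr5 : RowsWritten k arr 5 i (funRow τ⁻¹ σ p)

theorem outputBody_written {n q p k i : ℕ} (hk : 6 ≤ k) {σ τ : Equiv.Perm (Fin n)} {s : State}
    (hi : i < n) (hs : HasParams n q p k s) (h7 : s.reg 7 = i)
    (h : OutputWritten σ τ p k i s.arr) :
    OutputWritten σ τ p k (i + 1) (outputBody.eff s).arr := by
  simp only [outputBody, eff]
  have hpow := powers_reg_of_lt hs.reg4 h7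
  set s₁ := powers.eff s with hs₁
  have f1 : ∀ r < 20, s₁.reg r = s.reg r := fun r hr => powers_reg hr s
  have f1' : s₁.arr = s.arr := rfl
  clear_value s₁
  have k2 := writeRow_rowsWritten (a := 2) hk hi ((f1 3 (by norm_num)).trans hs.reg3)
    ((f1 5 (by norm_num)).trans hs.reg5) ((f1 7 (by norm_num)).trans h7) hpow
    (F := vecRow) (by rw [f1']; exact h.arr2)
  set s₂ := (writeRow 2).eff s₁ with hs₂
  have f2 : ∀ r < 8, s₂.reg r = s.reg r := fun r hr => by
    rw [hs₂, writeRow_reg (by omega), f1 r (by omega)]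
  have f2' : ∀ a, a ≠ 2 → s₂.arr a = s.arr a := fun a ha => by rw [hs₂, writeRow_arr ha, f1']
  have hpow₂ : ∀ j < 6, s₂.reg (21 + j) = vecRow (⟨i, hi⟩ : Fin n) j := fun j hj => by
    rw [hs₂, writeRow_reg (by omega), hpow j hj]; rfl
  clear_value s₂
  have k4 := writeRow_rowsWritten (a := 4) hk hi ((f2 3 (by norm_num)).trans hs.reg3)
    ((f2 5 (by norm_num)).trans hs.reg5) ((f2 7 (by norm_num)).trans h7) hpow₂
    (F := vecRow) (by intro x j hj; rw [f2' 4 (by norm_num)]; exact h.arr4 x j hj)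
  set s₃ := (writeRow 4).eff s₂ with hs₃
  have f3 : ∀ r < 8, s₃.reg r = s.reg r := fun r hr => by
    rw [hs₃, writeRow_reg (by omega), f2 r (by omega)]
  have f3' : ∀ a, a ≠ 2 → a ≠ 4 → s₃.arr a = s.arr a := fun a ha ha' => by
    rw [hs₃, writeRow_arr ha', f2' a ha]
  have f3'' : s₃.arr 2 = s₂.arr 2 := by rw [hs₃, writeRow_arr (by norm_num)]
  clear_value s₃
  set s₄ := s₃.setReg 16 (s₃.reg 2 - s₃.reg 7) with hs₄
  have f4 : ∀ r < 8, s₄.reg r = s.reg r := fun r hr => by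
    rw [hs₄, State.reg_setReg, if_neg (by omega), f3 r hr]
  have h16 : s₄.reg 16 = (p : ℤ) - i := by
    rw [hs₄, State.reg_setReg, if_pos rfl, f3 2 (by norm_num), f3 7 (by norm_num), hs.reg2, h7]
  have f4' : s₄.arr = s₃.arr := rfl
  clear_value s₄
  have hs₄' : HasParams n q p k s₄ := hs.congr fun r hr => f4 r (by omega)
  have k3 := writeFun_rowsWritten (a := 7) (b := 8) (c := 3) hk hi hs₄'
    ((f4 7 (by norm_num)).trans h7) h16 (f := σ⁻¹) (g := τ)
    (by intro x; rw [f4', f3' 7 (by norm_num) (by norm_num)]; exact h.arr7 x)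
    (by intro x; rw [f4', f3' 8 (by norm_num) (by norm_num)]; exact h.arr8 x)
    (by intro x j hj; rw [f4', f3' 3 (by norm_num) (by norm_num)]; exact h.arr3 x j hj)
  set s₅ := (writeFun 7 8 3).eff s₄ with hs₅
  have f5 : ∀ r < 8, s₅.reg r = s.reg r := fun r hr => by
    rw [hs₅, writeFun_reg (Or.inl hr), f4 r hr]
  have h16' : s₅.reg 16 = (p : ℤ) - i := by rw [hs₅, writeFun_reg (Or.inr rfl), h16]
  have f5' : ∀ a, a ≠ 3 → s₅.arr a = s₃.arr a := fun a ha => by rw [hs₅, writeFun_arr ha, f4']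
  clear_value s₅
  have hs₅' : HasParams n q p k s₅ := hs.congr fun r hr => f5 r (by omega)
  have k5 := writeFun_rowsWritten (a := 9) (b := 6) (c := 5) hk hi hs₅'
    ((f5 7 (by norm_num)).trans h7) h16' (f := τ⁻¹) (g := σ)
    (by intro x; rw [f5' 9 (by norm_num), f3' 9 (by norm_num) (by norm_num)]; exact h.arr9 x)
    (by intro x; rw [f5' 6 (by norm_num), f3' 6 (by norm_num) (by norm_num)]; exact h.arr6 x)
    (by intro x j hj; rw [f5' 5 (by norm_num), f3' 5 (by norm_num) (by norm_num)]
        exact h.arr5 x j hj)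
  have f6 : ∀ a, a ≠ 5 → ((writeFun 9 6 5).eff s₅).arr a = s₅.arr a := fun a ha =>
    writeFun_arr ha s₅
  have hkeep : ∀ a, a ≠ 2 → a ≠ 3 → a ≠ 4 → a ≠ 5 →
      ((writeFun 9 6 5).eff s₅).arr a = s.arr a := fun a h2 h3 h4 h5 => by
    rw [f6 a h5, f5' a h3, f3' a h2 h4]
  refine ⟨?_, ?_, ?_, ?_, ?_, ?_, ?_, k5⟩
  · intro x; rw [hkeep 6 (by norm_num) (by norm_num) (by norm_num) (by norm_num)]; exact h.arr6 x
  · intro x; rw [hkeep 7 (by norm_num) (by norm_num) (by norm_num) (by norm_num)]; exact h.arr7 x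
  · intro x; rw [hkeep 8 (by norm_num) (by norm_num) (by norm_num) (by norm_num)]; exact h.arr8 x
  · intro x; rw [hkeep 9 (by norm_num) (by norm_num) (by norm_num) (by norm_num)]; exact h.arr9 x
  · intro x j hj
    rw [f6 2 (by norm_num), f5' 2 (by norm_num), f3'']
    exact k2 x j hj
  · intro x j hj
    rw [f6 3 (by norm_num)]
    exact k3 x j hj
  · intro x j hj
    rw [f6 4 (by norm_num), f5' 4 (by norm_num)]
    exact k4 x j hj

theorem outputBody_analyze : (outputBody.analyze 100 loopBounds).isSome = true := by
  decide +kernel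

theorem outputBody_regsWritten : ∀ r < 8, r ∉ outputBody.regsWritten := by
  decide +kernel

end Program

end StableMatching

namespace StableMatching

open Function

/-! ## The rotation scheme of a Hasse diagram -/

theorem isCycleOn_congr {ι : Type*} {f g : Equiv.Perm ι} {s : Set ι} (hs : s.Finite)
    (h : f.IsCycleOn s) (hg : ∀ x ∈ s, g x = f x) : g.IsCycleOn s := by
  refine ⟨h.1.congr fun x hx => (hg x hx).symm, fun x hx y hy => ?_⟩
  refine isCycleOn_propagate_from hs h hx (Q := fun y => g.SameCycle x y) ?_
    (Equiv.Perm.SameCycle.refl _ _) hy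
  intro z hz _ hQ
  rw [← hg z hz]
  exact Equiv.Perm.sameCycle_apply_right.2 hQ

/-- The permutation `f` moves only elements of `A`, and it is a cycle on those with a given
label. -/
structure LabelledCycles {ι V : Type*} (lab : ι → Option V) (A : Set ι) (f : Equiv.Perm ι) :
    Prop where
  cycle : ∀ v, f.IsCycleOn {x | x ∈ A ∧ lab x = some v}
  fixed : ∀ x ∉ A, f x = x
  fixed_none : ∀ x, lab x = none → f x = x

/-- Only the class of the label `v` changes, and there `isCycleOn_mul_swap` applies, as `e` is still
a fixed point. -/
theorem LabelledCycles.insert {ι V : Type*} [Finite ι] [DecidableEq ι] {lab : ι → Option V}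
    {A : Set ι} {f : Equiv.Perm ι} (h : LabelledCycles lab A f) {d e : ι} (hd : d ∈ A) (he : e ∉ A)
    {v : V} (hdv : lab d = some v) (hev : lab e = some v) :
    LabelledCycles lab (insert e A) (f * Equiv.swap d e) := by
  refine ⟨fun u => ?_, fun x hx => ?_, fun x hx => ?_⟩
  · by_cases huv : u = v
    · subst huv
      have := isCycleOn_mul_swap (Set.toFinite _) (h.cycle u) (d := d) ⟨hd, hdv⟩ (e := e)
        (fun h => he h.1) (h.fixed e he)
      convert this using 1
      ext x
      simp only [Set.mem_ofPred_eq, Set.mem_insert_iff]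
      constructor
      · rintro ⟨rfl | h1, h2⟩
        exacts [Or.inl rfl, Or.inr ⟨h1, h2⟩]
      · rintro (rfl | ⟨h1, h2⟩)
        exacts [⟨Or.inl rfl, hev⟩, ⟨Or.inr h1, h2⟩]
    · have hset : {x | x ∈ Insert.insert e A ∧ lab x = some u} = {x | x ∈ A ∧ lab x = some u} := by
        ext x
        simp only [Set.mem_ofPred_eq, Set.mem_insert_iff]
        refine and_congr_left fun hx => or_iff_right ?_
        rintro rfl
        exact huv (Option.some.inj (hx.symm.trans hev))
      rw [hset]
      refine isCycleOn_congr (Set.toFinite _) (h.cycle u) ?_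
      rintro x ⟨hxA, hx⟩
      have h1 : x ≠ d := by rintro rfl; exact huv (Option.some.inj (hx.symm.trans hdv))
      have h2 : x ≠ e := by rintro rfl; exact he hxA
      rw [Equiv.Perm.mul_apply, Equiv.swap_apply_of_ne_of_ne h1 h2]
  · rw [Set.mem_insert_iff, not_or] at hx
    have h1 : x ≠ d := by rintro rfl; exact hx.2 hd
    rw [Equiv.Perm.mul_apply, Equiv.swap_apply_of_ne_of_ne h1 hx.1, h.fixed x hx.2]
  · have h1 : x ≠ d := by rintro rfl; simp [hdv] at hx
    have h2 : x ≠ e := by rintro rfl; simp [hev] at hx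
    rw [Equiv.Perm.mul_apply, Equiv.swap_apply_of_ne_of_ne h1 h2, h.fixed_none x hx]

/-- Insert `e 0`, `e 1`, … one after the other into the cycles of `f`, after `d 0`, `d 1`, …. -/
def insertMany {ι : Type*} [DecidableEq ι] (d e : ℕ → ι) (f : Equiv.Perm ι) : ℕ → Equiv.Perm ι
  | 0 => f
  | j + 1 => insertMany d e f j * Equiv.swap (d j) (e j)

theorem LabelledCycles.insertMany {ι V : Type*} [Finite ι] [DecidableEq ι] {lab : ι → Option V}
    {A : Set ι} {f : Equiv.Perm ι} (h : LabelledCycles lab A f) {d e : ℕ → ι} {m : ℕ}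
    (hd : ∀ j < m, d j ∈ A) (he : ∀ j < m, e j ∉ A)
    (hinj : ∀ i < m, ∀ j < m, e i = e j → i = j)
    (hlab : ∀ j < m, ∃ v, lab (d j) = some v ∧ lab (e j) = some v) (j : ℕ) (hj : j ≤ m) :
    LabelledCycles lab (A ∪ {x | ∃ i < j, x = e i}) (insertMany d e f j) := by
  induction j with
  | zero => simpa [StableMatching.insertMany] using h
  | succ j ih =>
    obtain ⟨v, h1, h2⟩ := hlab j (by omega)
    have := (ih (by omega)).insert (d := d j) (e := e j) (Or.inl (hd j (by omega))) (by
      rintro (h3 | ⟨i, hi, h3⟩)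
      · exact he j (by omega) h3
      · have := hinj j (by omega) i (by omega) h3
        omega) h1 h2
    rw [StableMatching.insertMany]
    convert this using 1
    ext x
    simp only [Set.mem_union, Set.mem_ofPred_eq, Set.mem_insert_iff, Nat.lt_succ_iff_lt_or_eq]
    constructor
    · rintro (h | ⟨i, hi | rfl, h⟩)
      exacts [Or.inr (Or.inl h), Or.inr (Or.inr ⟨i, hi, h⟩), Or.inl h]
    · rintro (h | h | ⟨i, hi, h⟩)
      exacts [Or.inr ⟨j, Or.inr rfl, h⟩, Or.inl h, Or.inr ⟨i, Or.inl hi, h⟩]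

/-- This shows that the next agent to be inserted is still fixed, as `eff_insertAfter` requires. -/
theorem insertMany_fixed {ι : Type*} [DecidableEq ι] {d e : ℕ → ι} {f : Equiv.Perm ι} {x : ι}
    (hf : f x = x) {j : ℕ} (h : ∀ i < j, x ≠ d i ∧ x ≠ e i) : insertMany d e f j x = x := by
  induction j with
  | zero => exact hf
  | succ j ih =>
    obtain ⟨h1, h2⟩ := h j (by omega)
    rw [insertMany, Equiv.Perm.mul_apply, Equiv.swap_apply_of_ne_of_ne h1 h2]
    exact ih fun i hi => h i (by omega)

namespace HasseDiagram

/-! ### Numbering of the agents and their cycles -/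

variable {X : Type*} [PartialOrder X] (H : HasseDiagram X)

/-- The number of men of the instance for `H`: a crossing man and an auxiliary one for each
element, one for each edge, and a spare one. -/
def size : ℕ := 2 * H.p + H.q + 1

/-- The agent with a given number. -/
def idx (j : ℕ) : Fin H.size := Fin.ofNat (2 * H.p + H.q + 1) j

theorem val_idx {j : ℕ} (h : j < H.size) : (H.idx j : ℕ) = j := Nat.mod_eq_of_lt h

/-- The number of the tail of the `i`-th edge. -/
def tailAt (i : ℕ) : ℕ := (H.edges.map fun e => (e.1 : ℕ)).getD i 0

/-- The number of the head of the `i`-th edge. -/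
def headAt (i : ℕ) : ℕ := (H.edges.map fun e => (e.2 : ℕ)).getD i 0

theorem tailAt_eq {i : ℕ} (h : i < H.q) : H.tailAt i = (H.edges[i]'h).1 := by
  have h' : i < H.edges.length := h
  simp [tailAt, h']
  rfl

theorem headAt_eq {i : ℕ} (h : i < H.q) : H.headAt i = (H.edges[i]'h).2 := by
  have h' : i < H.edges.length := h
  simp [headAt, h']
  rfl

theorem tailAt_lt {i : ℕ} (h : i < H.q) : H.tailAt i < H.p := by
  rw [tailAt_eq H h]; exact Fin.isLt _

theorem headAt_lt {i : ℕ} (h : i < H.q) : H.headAt i < H.p := by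
  rw [headAt_eq H h]; exact Fin.isLt _

theorem edge_injective {i j : ℕ} (hi : i < H.q) (hj : j < H.q) (ht : H.tailAt i = H.tailAt j)
    (hh : H.headAt i = H.headAt j) : i = j := by
  rw [tailAt_eq H hi, tailAt_eq H hj, Fin.val_inj] at ht
  rw [headAt_eq H hi, headAt_eq H hj, Fin.val_inj] at hh
  exact (H.nodup.getElem_inj_iff).1 (Prod.ext ht hh)

theorem covBy_of_edge {i : ℕ} (hi : i < H.q) {u v : X} (hu : (H.label u : ℕ) = H.tailAt i)
    (hv : (H.label v : ℕ) = H.headAt i) : u ⋖ v := by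
  rw [tailAt_eq H hi, Fin.val_inj] at hu
  rw [headAt_eq H hi, Fin.val_inj] at hv
  rw [← H.mem_edges, hu, hv]
  exact List.getElem_mem _

theorem exists_edge_of_covBy {u v : X} (h : u ⋖ v) :
    ∃ i < H.q, (H.label u : ℕ) = H.tailAt i ∧ (H.label v : ℕ) = H.headAt i := by
  obtain ⟨i, hi, he⟩ := List.getElem_of_mem ((H.mem_edges u v).2 h)
  exact ⟨i, hi, by rw [tailAt_eq H hi, he], by rw [headAt_eq H hi, he]⟩

/-- The element with a given number. -/
def elt (i : ℕ) : Option X := if h : i < H.p then some (H.label.symm ⟨i, h⟩) else none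

theorem elt_eq_some {i : ℕ} {v : X} : H.elt i = some v ↔ (H.label v : ℕ) = i := by
  rw [elt]
  split_ifs with h
  · rw [Option.some.injEq, Equiv.symm_apply_eq, Fin.ext_iff, eq_comm]
  · simp only [false_iff]
    rintro rfl
    exact h (Fin.isLt _)

theorem exists_elt {i : ℕ} (h : i < H.p) : ∃ v, H.elt i = some v := by
  rw [elt, dif_pos h]
  exact ⟨_, rfl⟩

/-- The source of an agent. -/
def src (x : Fin H.size) : Option X :=
  if (x : ℕ) < H.p then H.elt x
  else if (x : ℕ) < 2 * H.p then none
  else if (x : ℕ) - 2 * H.p < H.q then H.elt (H.tailAt (x - 2 * H.p)) else none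

/-- The target of an agent. -/
def tgt (x : Fin H.size) : Option X :=
  if (x : ℕ) < H.p then H.elt x
  else if (x : ℕ) < 2 * H.p then H.elt (x - H.p)
  else if (x : ℕ) - 2 * H.p < H.q then H.elt (H.headAt (x - 2 * H.p)) else none

theorem idx_cases (x : Fin H.size) : (∃ i < H.p, x = H.idx i) ∨ (∃ i < H.p, x = H.idx (H.p + i)) ∨
    (∃ i < H.q, x = H.idx (2 * H.p + i)) ∨ x = H.idx (2 * H.p + H.q) := by
  have hx : (x : ℕ) < 2 * H.p + H.q + 1 := x.isLt
  have hxi : x = H.idx x := Fin.ext (H.val_idx x.isLt).symm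
  by_cases h1 : (x : ℕ) < H.p
  · exact Or.inl ⟨x, h1, hxi⟩
  by_cases h2 : (x : ℕ) < 2 * H.p
  · exact Or.inr (Or.inl ⟨x - H.p, by omega, by rw [Nat.add_sub_of_le (by omega)]; exact hxi⟩)
  by_cases h3 : (x : ℕ) < 2 * H.p + H.q
  · exact Or.inr (Or.inr (Or.inl ⟨x - 2 * H.p, by omega, by
      rw [Nat.add_sub_of_le (by omega)]; exact hxi⟩))
  · have : (x : ℕ) = 2 * H.p + H.q := by omega
    exact Or.inr (Or.inr (Or.inr (by rw [← this]; exact hxi)))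

theorem val_crossing {i : ℕ} (h : i < H.p) : (H.idx i : ℕ) = i :=
  H.val_idx (by rw [size]; omega)

theorem val_dummy {i : ℕ} (h : i < H.p) : (H.idx (H.p + i) : ℕ) = H.p + i :=
  H.val_idx (by rw [size]; omega)

theorem val_edge {i : ℕ} (h : i < H.q) : (H.idx (2 * H.p + i) : ℕ) = 2 * H.p + i :=
  H.val_idx (by rw [size]; omega)

theorem val_spare : (H.idx (2 * H.p + H.q) : ℕ) = 2 * H.p + H.q :=
  H.val_idx (by rw [size]; omega)

theorem src_crossing {i : ℕ} (h : i < H.p) : H.src (H.idx i) = H.elt i := by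
  rw [src, val_crossing H h, if_pos h]

theorem tgt_crossing {i : ℕ} (h : i < H.p) : H.tgt (H.idx i) = H.elt i := by
  rw [tgt, val_crossing H h, if_pos h]

theorem src_dummy {i : ℕ} (h : i < H.p) : H.src (H.idx (H.p + i)) = none := by
  rw [src, val_dummy H h, if_neg (by omega), if_pos (by omega)]

theorem tgt_dummy {i : ℕ} (h : i < H.p) : H.tgt (H.idx (H.p + i)) = H.elt i := by
  rw [tgt, val_dummy H h, if_neg (by omega), if_pos (by omega), Nat.add_sub_cancel_left]

theorem src_edge {i : ℕ} (h : i < H.q) : H.src (H.idx (2 * H.p + i)) = H.elt (H.tailAt i) := by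
  rw [src, val_edge H h, if_neg (by omega), if_neg (by omega), Nat.add_sub_cancel_left, if_pos h]

theorem tgt_edge {i : ℕ} (h : i < H.q) : H.tgt (H.idx (2 * H.p + i)) = H.elt (H.headAt i) := by
  rw [tgt, val_edge H h, if_neg (by omega), if_neg (by omega), Nat.add_sub_cancel_left, if_pos h]

theorem src_spare : H.src (H.idx (2 * H.p + H.q)) = none := by
  rw [src, val_spare, if_neg (by omega), if_neg (by omega), Nat.add_sub_cancel_left,
    if_neg (by omega)]

theorem tgt_spare : H.tgt (H.idx (2 * H.p + H.q)) = none := by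
  rw [tgt, val_spare, if_neg (by omega), if_neg (by omega), Nat.add_sub_cancel_left,
    if_neg (by omega)]

/-- The permutation of the agents with a common source, after the insertion of `j` edges. -/
def outPerm (j : ℕ) : Equiv.Perm (Fin H.size) :=
  insertMany (fun i => H.idx (H.tailAt i)) (fun i => H.idx (2 * H.p + i)) 1 j

/-- The permutation of the auxiliary agents, after the insertion of `j` of them. -/
def dummyPerm (j : ℕ) : Equiv.Perm (Fin H.size) :=
  insertMany (fun i => H.idx i) (fun i => H.idx (H.p + i)) 1 j

/-- The permutation of the agents with a common target, after the insertion of `j` edges. -/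
def inPerm (j : ℕ) : Equiv.Perm (Fin H.size) :=
  insertMany (fun i => H.idx (H.headAt i)) (fun i => H.idx (2 * H.p + i)) (H.dummyPerm H.p) j

/-- Among the crossing agents every label occurs once, so the identity is a cycle on each class.
This starts the insertions. -/
theorem labelledCycles_one {lab : Fin H.size → Option X}
    (hlab : ∀ i < H.p, lab (H.idx i) = H.elt i) :
    LabelledCycles lab {x | (x : ℕ) < H.p} 1 := by
  refine ⟨fun v => Equiv.Perm.isCycleOn_one.2 ?_, fun _ _ => rfl, fun _ _ => rfl⟩
  have key : ∀ x : Fin H.size, (x : ℕ) < H.p → lab x = some v → (x : ℕ) = H.label v := by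
    intro x hx h
    have hxi : x = H.idx x := Fin.ext (H.val_idx x.isLt).symm
    rw [hxi, hlab _ hx, elt_eq_some] at h
    exact h.symm
  rintro x ⟨hx, hx'⟩ y ⟨hy, hy'⟩
  exact Fin.ext ((key x hx hx').trans (key y hy hy').symm)

theorem outPerm_cycles : LabelledCycles H.src
    ({x | (x : ℕ) < H.p} ∪ {x | ∃ i < H.q, x = H.idx (2 * H.p + i)}) (H.outPerm H.q) := by
  refine (H.labelledCycles_one fun i hi => H.src_crossing hi).insertMany (m := H.q)
    ?_ ?_ ?_ ?_ H.q le_rfl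
  · intro j hj
    rw [Set.mem_ofPred_eq, val_crossing H (H.tailAt_lt hj)]
    exact H.tailAt_lt hj
  · intro j hj
    rw [Set.mem_ofPred_eq, val_edge H hj]
    omega
  · intro i hi j hj h
    have := congrArg Fin.val h
    rw [val_edge H hi, val_edge H hj] at this
    omega
  · intro j hj
    obtain ⟨v, hv⟩ := H.exists_elt (H.tailAt_lt hj)
    exact ⟨v, by rw [src_crossing H (H.tailAt_lt hj), hv], by rw [src_edge H hj, hv]⟩

theorem dummyPerm_cycles : LabelledCycles H.tgt
    ({x | (x : ℕ) < H.p} ∪ {x | ∃ i < H.p, x = H.idx (H.p + i)}) (H.dummyPerm H.p) := by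
  refine (H.labelledCycles_one fun i hi => H.tgt_crossing hi).insertMany (m := H.p)
    ?_ ?_ ?_ ?_ H.p le_rfl
  · intro j hj
    rw [Set.mem_ofPred_eq, val_crossing H hj]
    exact hj
  · intro j hj
    rw [Set.mem_ofPred_eq, val_dummy H hj]
    omega
  · intro i hi j hj h
    have := congrArg Fin.val h
    rw [val_dummy H hi, val_dummy H hj] at this
    omega
  · intro j hj
    obtain ⟨v, hv⟩ := H.exists_elt hj
    exact ⟨v, by rw [tgt_crossing H hj, hv], by rw [tgt_dummy H hj, hv]⟩

theorem inPerm_cycles : LabelledCycles H.tgt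
    (({x | (x : ℕ) < H.p} ∪ {x | ∃ i < H.p, x = H.idx (H.p + i)}) ∪
      {x | ∃ i < H.q, x = H.idx (2 * H.p + i)}) (H.inPerm H.q) := by
  refine H.dummyPerm_cycles.insertMany (m := H.q) ?_ ?_ ?_ ?_ H.q le_rfl
  · intro j hj
    left
    rw [Set.mem_ofPred_eq, val_crossing H (H.headAt_lt hj)]
    exact H.headAt_lt hj
  · rintro j hj (h | ⟨i, hi, h⟩)
    · rw [Set.mem_ofPred_eq, val_edge H hj] at h
      omega
    · have := congrArg Fin.val h
      rw [val_edge H hj, val_dummy H hi] at this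
      omega
  · intro i hi j hj h
    have := congrArg Fin.val h
    rw [val_edge H hi, val_edge H hj] at this
    omega
  · intro j hj
    obtain ⟨v, hv⟩ := H.exists_elt (H.headAt_lt hj)
    exact ⟨v, by rw [tgt_crossing H (H.headAt_lt hj), hv], by rw [tgt_edge H hj, hv]⟩

theorem outPerm_isCycleOn (v : X) : (H.outPerm H.q).IsCycleOn {x | H.src x = some v} := by
  convert H.outPerm_cycles.cycle v using 1
  ext x
  simp only [Set.mem_ofPred_eq, Set.mem_union]
  refine ⟨fun h => ⟨?_, h⟩, fun h => h.2⟩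
  rcases H.idx_cases x with ⟨i, hi, rfl⟩ | ⟨i, hi, rfl⟩ | ⟨i, hi, rfl⟩ | rfl
  · left; rw [val_crossing H hi]; exact hi
  · simp [src_dummy H hi] at h
  · exact Or.inr ⟨i, hi, rfl⟩
  · simp [src_spare] at h

theorem inPerm_isCycleOn (v : X) : (H.inPerm H.q).IsCycleOn {x | H.tgt x = some v} := by
  convert H.inPerm_cycles.cycle v using 1
  ext x
  simp only [Set.mem_ofPred_eq, Set.mem_union]
  refine ⟨fun h => ⟨?_, h⟩, fun h => h.2⟩
  rcases H.idx_cases x with ⟨i, hi, rfl⟩ | ⟨i, hi, rfl⟩ | ⟨i, hi, rfl⟩ | rfl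
  · left; left; rw [val_crossing H hi]; exact hi
  · exact Or.inl (Or.inr ⟨i, hi, rfl⟩)
  · exact Or.inr ⟨i, hi, rfl⟩
  · simp [tgt_spare] at h

/-- The rotation scheme of a Hasse diagram. -/
def scheme : RotationScheme X H.size where
  σ := H.outPerm H.q
  τ := H.inPerm H.q
  d v := H.idx (H.label v)
  src := H.src
  tgt := H.tgt
  src_d v := by rw [src_crossing H (Fin.isLt _), elt_eq_some]
  tgt_d v := by rw [tgt_crossing H (Fin.isLt _), elt_eq_some]
  σ_cycle := H.outPerm_isCycleOn
  τ_cycle := H.inPerm_isCycleOn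
  σ_fixed := H.outPerm_cycles.fixed_none
  τ_fixed := H.inPerm_cycles.fixed_none
  lt_of_edge e u v hu hv hne := by
    rcases H.idx_cases e with ⟨i, hi, rfl⟩ | ⟨i, hi, rfl⟩ | ⟨i, hi, rfl⟩ | rfl
    · rw [tgt_crossing H hi, elt_eq_some] at hv
      exact absurd (by rw [hv]) hne
    · simp [src_dummy H hi] at hu
    · rw [src_edge H hi, elt_eq_some] at hu
      rw [tgt_edge H hi, elt_eq_some] at hv
      exact (H.covBy_of_edge hi hu hv).lt
    · simp [src_spare] at hu
  exists_edge u v h := by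
    obtain ⟨i, hi, hu, hv⟩ := H.exists_edge_of_covBy h
    exact ⟨H.idx (2 * H.p + i), by rw [src_edge H hi, elt_eq_some, hu],
      by rw [tgt_edge H hi, elt_eq_some, hv]⟩
  unique e f u v heu hev hfu hfv := by
    rcases H.idx_cases e with ⟨i, hi, rfl⟩ | ⟨i, hi, rfl⟩ | ⟨i, hi, rfl⟩ | rfl
    · rw [src_crossing H hi, elt_eq_some] at heu
      rw [tgt_crossing H hi, elt_eq_some] at hev
      have huv : u = v := H.label.injective (Fin.ext (heu.trans hev.symm))
      rcases H.idx_cases f with ⟨j, hj, rfl⟩ | ⟨j, hj, rfl⟩ | ⟨j, hj, rfl⟩ | rfl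
      · rw [src_crossing H hj, elt_eq_some] at hfu
        rw [← heu, hfu]
      · simp [src_dummy H hj] at hfu
      · rw [src_edge H hj, elt_eq_some] at hfu
        rw [tgt_edge H hj, elt_eq_some] at hfv
        exact absurd huv (H.covBy_of_edge hj hfu hfv).ne
      · simp [src_spare] at hfu
    · simp [src_dummy H hi] at heu
    · rw [src_edge H hi, elt_eq_some] at heu
      rw [tgt_edge H hi, elt_eq_some] at hev
      have huv : u ≠ v := (H.covBy_of_edge hi heu hev).ne
      rcases H.idx_cases f with ⟨j, hj, rfl⟩ | ⟨j, hj, rfl⟩ | ⟨j, hj, rfl⟩ | rfl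
      · rw [src_crossing H hj, elt_eq_some] at hfu
        rw [tgt_crossing H hj, elt_eq_some] at hfv
        exact absurd (H.label.injective (Fin.ext (hfu.trans hfv.symm))) huv
      · simp [src_dummy H hj] at hfu
      · rw [src_edge H hj, elt_eq_some] at hfu
        rw [tgt_edge H hj, elt_eq_some] at hfv
        rw [H.edge_injective hi hj (heu.symm.trans hfu) (hev.symm.trans hfv)]
      · simp [src_spare] at hfu
    · simp [src_spare] at heu
  τ_d_ne v := by
    have hv : (H.label v : ℕ) < H.p := Fin.isLt _
    have h1 : H.tgt (H.idx (H.label v)) = some v := by rw [tgt_crossing H hv, elt_eq_some]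
    have h2 : H.tgt (H.idx (H.p + H.label v)) = some v := by rw [tgt_dummy H hv, elt_eq_some]
    -- The auxiliary agent is a second point of the `τ`-cycle of `v`.
    refine (H.inPerm_isCycleOn v).apply_ne ⟨_, h1, _, h2, fun h => ?_⟩ h1
    have := congrArg Fin.val h
    rw [val_crossing H hv, val_dummy H hv] at this
    omega

/-- It lets the program decide by the comparison with `p` which agents lack a middle favourite. The
spare agent may be treated like an edge, since both permutations fix it. -/
theorem src_eq_tgt_iff (x : Fin H.size) :
    H.src x = H.tgt x ↔ (x : ℕ) < H.p ∨ x = H.idx (2 * H.p + H.q) := by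
  rcases H.idx_cases x with ⟨i, hi, rfl⟩ | ⟨i, hi, rfl⟩ | ⟨i, hi, rfl⟩ | rfl
  · rw [src_crossing H hi, tgt_crossing H hi, val_crossing H hi]
    simp [hi]
  · obtain ⟨v, hv⟩ := H.exists_elt hi
    rw [src_dummy H hi, tgt_dummy H hi, hv, val_dummy H hi, Fin.ext_iff, val_dummy H hi, val_spare]
    simp only [reduceCtorEq, false_iff]
    omega
  · obtain ⟨u, hu⟩ := H.exists_elt (H.tailAt_lt hi)
    obtain ⟨v, hv⟩ := H.exists_elt (H.headAt_lt hi)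
    have := (H.covBy_of_edge hi ((elt_eq_some H).1 hu) ((elt_eq_some H).1 hv)).ne
    rw [src_edge H hi, tgt_edge H hi, hu, hv, val_edge H hi, Fin.ext_iff, val_edge H hi, val_spare,
      Option.some.injEq]
    simp only [this, false_iff]
    omega
  · simp [src_spare, tgt_spare]

theorem manMid_eq (x : Fin H.size) : (H.scheme.manMid x : ℕ) =
    if (x : ℕ) < H.p then (H.inPerm H.q x : ℕ) else (x : ℕ) := by
  have h : H.scheme.src x = H.scheme.tgt x ↔ _ := H.src_eq_tgt_iff x
  by_cases hx : (x : ℕ) < H.p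
  · rw [if_pos hx, RotationScheme.manMid, if_pos (h.2 (Or.inl hx))]
    rfl
  · rw [if_neg hx, RotationScheme.manMid]
    by_cases hs : x = H.idx (2 * H.p + H.q)
    · rw [if_pos (h.2 (Or.inr hs)), H.scheme.τ_fixed]
      rw [hs]
      exact H.tgt_spare
    · rw [if_neg (fun h' => (h.1 h').elim hx hs)]

theorem womanMid_eq (x : Fin H.size) : (H.scheme.womanMid x : ℕ) =
    if (x : ℕ) < H.p then (H.outPerm H.q x : ℕ) else (x : ℕ) := by
  have h : H.scheme.src x = H.scheme.tgt x ↔ _ := H.src_eq_tgt_iff x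
  by_cases hx : (x : ℕ) < H.p
  · rw [if_pos hx, RotationScheme.womanMid, if_pos (h.2 (Or.inl hx))]
    rfl
  · rw [if_neg hx, RotationScheme.womanMid]
    by_cases hs : x = H.idx (2 * H.p + H.q)
    · rw [if_pos (h.2 (Or.inr hs)), H.scheme.σ_fixed]
      rw [hs]
      exact H.src_spare
    · rw [if_neg (fun h' => (h.1 h').elim hx hs)]

end HasseDiagram

end StableMatching

namespace StableMatching

open Function

/-! ## The instance and its profiles -/

section Profiles

open Polynomial Program

theorem topThree_of_rankPoly {n : ℕ} {x y z : Fin n} {r : Fin n → Fin n → Prop}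
    (hr : ∀ a b : Fin n, r a b ↔ (rankPoly n (x : ℕ) (y : ℕ) (z : ℕ)).eval ((b : ℕ) : ℤ) <
      (rankPoly n (x : ℕ) (y : ℕ) (z : ℕ)).eval ((a : ℕ) : ℤ)) : TopThree r x y z := by
  have h0 : ∀ a : Fin n, (0 : ℤ) ≤ (a : ℕ) := fun a => by positivity
  have h1 : ∀ a : Fin n, ((a : ℕ) : ℤ) < n := fun a => by exact_mod_cast a.isLt
  have hn : (0 : ℤ) ≤ n := by positivity
  have hne : ∀ a b : Fin n, a ≠ b → ((a : ℕ) : ℤ) ≠ (b : ℕ) := fun a b h h' =>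
    h (Fin.ext (by exact_mod_cast h'))
  refine ⟨fun w hx => ?_, fun w hx hy => ?_, fun w hx hy hz => ?_⟩
  · exact (hr _ _).2 (rankPoly_eval_lt hn (h0 _) (h1 _) (penalty_first_lt (hne _ _ hx)))
  · exact (hr _ _).2 (rankPoly_eval_lt hn (h0 _) (h1 _)
      (penalty_second_lt (h0 _) (h1 _) (h0 _) (h1 _) (hne _ _ hx) (hne _ _ hy)))
  · exact (hr _ _).2 (rankPoly_eval_lt hn (h0 _) (h1 _)
      (penalty_third_lt (h0 _) (h1 _) (h0 _) (h1 _) (h0 _) (h1 _)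
        (hne _ _ hx) (hne _ _ hy) (hne _ _ hz)))

theorem exists_rank_rankPoly {n : ℕ} (x y z : ℤ) : ∃ e : Equiv.Perm (Fin n), ∀ a b, e a < e b ↔
    (rankPoly n x y z).eval ((b : ℕ) : ℤ) < (rankPoly n x y z).eval ((a : ℕ) : ℤ) := by
  refine exists_rank (fun a : Fin n => (rankPoly n x y z).eval ((a : ℕ) : ℤ)) ?_
  intro a b h
  have := rankPoly_eval_injective (by positivity) (by exact_mod_cast a.isLt) (by positivity)
    (by exact_mod_cast b.isLt) h
  exact Fin.ext (by exact_mod_cast this)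

/-- The linear function on `ℝ^k` with the first six coefficients given by `c`. -/
noncomputable def linFun (k : ℕ) (c : ℕ → ℤ) : (Fin k → ℝ) →ₗ[ℝ] ℝ :=
  ∑ j : Fin k, ((if (j : ℕ) < 6 then c j else 0 : ℤ) : ℝ) • LinearMap.proj j

theorem linFun_single {k : ℕ} (c : ℕ → ℤ) (j : Fin k) :
    linFun k c (Pi.single j 1) = ((if (j : ℕ) < 6 then c j else 0 : ℤ) : ℝ) := by
  simp only [linFun, LinearMap.sum_apply, LinearMap.smul_apply, LinearMap.proj_apply, smul_eq_mul]
  rw [Finset.sum_eq_single j]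
  · simp
  · intro i _ hij
    simp [hij]
  · simp

theorem linFun_apply {k : ℕ} (hk : 6 ≤ k) (c v : ℕ → ℤ) :
    linFun k c (fun j => ((if (j : ℕ) < 6 then v j else 0 : ℤ) : ℝ)) =
      ((∑ j ∈ Finset.range 6, c j * v j : ℤ) : ℝ) := by
  simp only [linFun, LinearMap.sum_apply, LinearMap.smul_apply, LinearMap.proj_apply, smul_eq_mul]
  rw [Fin.sum_univ_eq_sum_range (fun j => ((if j < 6 then c j else 0 : ℤ) : ℝ) *
    ((if j < 6 then v j else 0 : ℤ) : ℝ)) k]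
  rw [← Finset.sum_subset (Finset.range_subset_range.2 hk)]
  · push_cast
    refine Finset.sum_congr rfl fun j hj => ?_
    simp [Finset.mem_range.1 hj]
  · intro j _ hj
    simp [Finset.mem_range] at hj
    simp [show ¬ j < 6 by omega]

/-- The omitted constant term cancels, so comparing linear functions on the moment curve is
comparing polynomial values. -/
theorem linFun_funRow_lt_iff {n k : ℕ} (hk : 6 ≤ k) (f g : Equiv.Perm (Fin n)) (p : ℕ)
    (x a b : Fin n) {y : ℕ} (hy : y = if (x : ℕ) < p then (g x : ℕ) else (x : ℕ)) :
    linFun k (funRow f g p x) (fun j => ((if (j : ℕ) < 6 then vecRow b j else 0 : ℤ) : ℝ)) <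
      linFun k (funRow f g p x) (fun j => ((if (j : ℕ) < 6 then vecRow a j else 0 : ℤ) : ℝ)) ↔
    (rankPoly n (f x : ℕ) y (g x : ℕ)).eval ((b : ℕ) : ℤ) <
      (rankPoly n (f x : ℕ) y (g x : ℕ)).eval ((a : ℕ) : ℤ) := by
  have hy' : (y : ℤ) = if (x : ℕ) < p then ((g x : ℕ) : ℤ) else ((x : ℕ) : ℤ) := by
    rw [hy]; split_ifs <;> rfl
  rw [linFun_apply hk, linFun_apply hk, Int.cast_lt, rankPoly_eval_zero_add,
    rankPoly_eval_zero_add, add_lt_add_iff_left, hy']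
  rfl

/-- The profiles given by two permutations. -/
noncomputable def profiles {n : ℕ} (σ τ : Equiv.Perm (Fin n)) (p k : ℕ) : Profiles k n where
  manVec a j := ((if (j : ℕ) < 6 then vecRow a j else 0 : ℤ) : ℝ)
  manFun a := linFun k (funRow σ⁻¹ τ p a)
  womanVec a j := ((if (j : ℕ) < 6 then vecRow a j else 0 : ℤ) : ℝ)
  womanFun a := linFun k (funRow τ⁻¹ σ p a)

theorem outputs_profiles {n : ℕ} {σ τ : Equiv.Perm (Fin n)} {p k : ℕ} {s : State}
    (h0 : s.reg 0 = n) (h : OutputWritten σ τ p k n s.arr) : s.Outputs (profiles σ τ p k) := by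
  refine ⟨h0, fun a j => ⟨?_, ?_, ?_, ?_⟩⟩
  · rw [h.arr2 a j j.isLt]; simp [profiles]
  · rw [h.arr3 a j j.isLt]
    simp only [profiles, linFun_single, a.isLt, true_and]
  · rw [h.arr4 a j j.isLt]; simp [profiles]
  · rw [h.arr5 a j j.isLt]
    simp only [profiles, linFun_single, a.isLt, true_and]

end Profiles

namespace HasseDiagram

open Program

variable {X : Type*} [PartialOrder X] (H : HasseDiagram X)

theorem exists_instance [Finite X] {k : ℕ} (hk : 6 ≤ k) : ∃ I : SMInstance H.size,
    I.InducedBy (profiles (H.outPerm H.q) (H.inPerm H.q) H.p k) ∧ I.Realizes X := by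
  choose rM hM using fun m : Fin H.size => exists_rank_rankPoly (n := H.size)
    ((H.outPerm H.q)⁻¹ m : ℕ) (H.scheme.manMid m : ℕ) (H.inPerm H.q m : ℕ)
  choose rW hW using fun w : Fin H.size => exists_rank_rankPoly (n := H.size)
    ((H.inPerm H.q)⁻¹ w : ℕ) (H.scheme.womanMid w : ℕ) (H.outPerm H.q w : ℕ)
  refine ⟨⟨rM, rW⟩, ⟨fun m w w' => ?_, fun w m m' => ?_⟩, RotationScheme.realizes (D := H.scheme)
    ⟨fun m => topThree_of_rankPoly (hM m), fun w => topThree_of_rankPoly (hW w)⟩⟩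
  · exact (hM m w w').trans (linFun_funRow_lt_iff hk _ _ _ m w w' (H.manMid_eq m)).symm
  · exact (hW w m m').trans (linFun_funRow_lt_iff hk _ _ _ w m m' (H.womanMid_eq w)).symm

end HasseDiagram

/-! ## The program -/

namespace Program

/-- Set up the registers; the number of attributes is already in register `5`. -/
def setup : Program :=
  seq (const 3 1) (seq (const 4 0) (seq (add 2 0 4) (seq (add 0 0 0) (seq (add 0 0 1)
    (add 0 0 3)))))

/-- Initialize the permutations at the index in register `7`. -/
def identityBody : Program := seq (store 6 7 7) (seq (store 7 7 7) (seq (store 8 7 7) (store 9 7 7)))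

/-- Insert an auxiliary agent. -/
def dummyBody : Program := seq (add 8 7 4) (seq (add 9 2 7) (insertAfter 8 9))

/-- Insert an edge at its tail and at its head. -/
def edgeBody : Program :=
  seq (add 9 2 2) (seq (add 9 9 7) (seq (load 8 0 7) (seq (insertAfter 6 7)
    (seq (load 8 1 7) (insertAfter 8 9)))))

/-- The program that computes the profiles with `k` attributes. -/
def profileProgram (k : ℕ) : Program :=
  seq (const 5 k) (seq setup (seq (forLoop 0 identityBody) (seq (forLoop 2 dummyBody)
    (seq (forLoop 1 edgeBody) (forLoop 0 outputBody)))))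

/-- The bounds for the input registers. -/
def inputBounds : Bounds := fun r => if r < 2 then some (1, true) else none

theorem setup_analyze : (setup.analyze 100 inputBounds).isSome = true := by decide +kernel

theorem identityBody_analyze : (identityBody.analyze 100 loopBounds).isSome = true := by
  decide +kernel

theorem dummyBody_analyze : (dummyBody.analyze 100 loopBounds).isSome = true := by decide +kernel

theorem edgeBody_analyze : (edgeBody.analyze 100 loopBounds).isSome = true := by decide +kernel

/-! ### Loop invariants and the complete run -/

variable {X : Type*} [PartialOrder X] {H : HasseDiagram X}

/-- The input and output arrays are as at the start. -/
def Untouched (H : HasseDiagram X) (arr : ℕ → ℕ → ℤ) : Prop := ∀ a < 6, arr a = H.input.arr a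

theorem Untouched.eff {s : State} (h : Untouched H s.arr) {P : Program}
    (hP : ∀ a < 6, a ∉ P.arrsWritten) : Untouched H (P.eff s).arr := fun a ha => by
  rw [eff_arr_of_notMem (hP a ha), h a ha]

/-- The arrays after the insertion of `i` auxiliary agents. -/
structure DummiesInserted (H : HasseDiagram X) (i : ℕ) (arr : ℕ → ℕ → ℤ) : Prop where
  untouched : Untouched H arr
  arr6 : Stores arr 6 (H.outPerm 0)
  arr7 : Stores arr 7 (H.outPerm 0)⁻¹
  arr8 : Stores arr 8 (H.dummyPerm i)
  arr9 : Stores arr 9 (H.dummyPerm i)⁻¹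

/-- The arrays after the insertion of `i` edges. -/
structure EdgesInserted (H : HasseDiagram X) (i : ℕ) (arr : ℕ → ℕ → ℤ) : Prop where
  untouched : Untouched H arr
  arr6 : Stores arr 6 (H.outPerm i)
  arr7 : Stores arr 7 (H.outPerm i)⁻¹
  arr8 : Stores arr 8 (H.inPerm i)
  arr9 : Stores arr 9 (H.inPerm i)⁻¹

/-- The first `i` cells of the permutation arrays hold the identity. -/
def IdentityWritten (H : HasseDiagram X) (i : ℕ) (arr : ℕ → ℕ → ℤ) : Prop :=
  Untouched H arr ∧ ∀ j < i, arr 6 j = j ∧ arr 7 j = j ∧ arr 8 j = j ∧ arr 9 j = j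

theorem identityBody_written {i : ℕ} {s : State} (h7 : s.reg 7 = i)
    (h : IdentityWritten H i s.arr) : IdentityWritten H (i + 1) (identityBody.eff s).arr := by
  refine ⟨h.1.eff (by decide), fun j hj => ?_⟩
  by_cases hji : j = i
  · subst hji
    simp [identityBody, eff, h7]
  · simpa [identityBody, eff, h7, hji] using h.2 j (by omega)

theorem dummyBody_inserted {n q k i : ℕ} {s : State} (hi : i < H.p)
    (hs : HasParams n q H.p k s) (h7 : s.reg 7 = i) (h : DummiesInserted H i s.arr) :
    DummiesInserted H (i + 1) (dummyBody.eff s).arr := by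
  have hu := h.untouched.eff (P := dummyBody) (by decide)
  simp only [dummyBody, eff] at hu ⊢
  set s₁ := (s.setReg 8 (s.reg 7 + s.reg 4)).setReg 9 _ with hs₁
  have e1 : s₁.arr = s.arr := rfl
  have e8 : s₁.reg 8 = (H.idx i : ℕ) := by
    rw [H.val_crossing hi]; simp [hs₁, h7, hs.reg4]
  have e9 : s₁.reg 9 = (H.idx (H.p + i) : ℕ) := by
    rw [H.val_dummy hi]; simp [hs₁, h7, hs.reg2]
  clear_value s₁
  have hfix : H.dummyPerm i (H.idx (H.p + i)) = H.idx (H.p + i) := by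
    refine insertMany_fixed rfl fun j hj => ⟨fun h' => ?_, fun h' => ?_⟩ <;>
    have := congrArg Fin.val h' <;> rw [H.val_dummy hi] at this
    · rw [H.val_crossing (by omega)] at this; omega
    · rw [H.val_dummy (by omega)] at this; omega
  have hne : H.idx i ≠ H.idx (H.p + i) := fun h' => by
    have := congrArg Fin.val h'
    rw [H.val_dummy hi, H.val_crossing hi] at this
    omega
  obtain ⟨k8, k9⟩ := eff_insertAfter (a := 8) (b := 9) (by norm_num) (s := s₁)
    (f := H.dummyPerm i) (by rw [e1]; exact h.arr8) (by rw [e1]; exact h.arr9) e8 e9 hfix hne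
  refine ⟨hu, ?_, ?_, k8, k9⟩
  · intro x
    rw [insertAfter_arr (by norm_num) (by norm_num), e1]
    exact h.arr6 x
  · intro x
    rw [insertAfter_arr (by norm_num) (by norm_num), e1]
    exact h.arr7 x

theorem input_arr_zero (i : ℕ) : H.input.arr 0 i = (H.tailAt i : ℤ) := by
  by_cases h : i < H.edges.length <;> simp [HasseDiagram.input, HasseDiagram.tailAt, h]

theorem input_arr_one (i : ℕ) : H.input.arr 1 i = (H.headAt i : ℤ) := by
  by_cases h : i < H.edges.length <;> simp [HasseDiagram.input, HasseDiagram.headAt, h]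

/-- The edge is spliced in after the crossing agent of its tail for `σ` and after that of its head
for `τ`. Arrays `0` and `1` are still the input, so the endpoints can be read there. -/
theorem edgeBody_inserted {n q k i : ℕ} {s : State} (hi : i < H.q)
    (hs : HasParams n q H.p k s) (h7 : s.reg 7 = i) (h : EdgesInserted H i s.arr) :
    EdgesInserted H (i + 1) (edgeBody.eff s).arr := by
  have hu := h.untouched.eff (P := edgeBody) (by decide)
  have ht := H.tailAt_lt hi
  have hh := H.headAt_lt hi
  simp only [edgeBody, eff] at hu ⊢
  set s₁ := ((s.setReg 9 (s.reg 2 + s.reg 2)).setReg 9 _).setReg 8 _ with hs₁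
  have e1 : s₁.arr = s.arr := rfl
  have e7 : s₁.reg 7 = i := by simp [hs₁, h7]
  have e8 : s₁.reg 8 = (H.idx (H.tailAt i) : ℕ) := by
    rw [H.val_crossing ht]
    simp [hs₁, h7, h.untouched 0 (by norm_num), input_arr_zero]
  have e9 : s₁.reg 9 = (H.idx (2 * H.p + i) : ℕ) := by
    rw [H.val_edge hi]; simp [hs₁, h7, hs.reg2]; ring
  clear_value s₁
  have hne : ∀ j < H.p, H.idx (2 * H.p + i) ≠ H.idx j := fun j hj h' => by
    have := congrArg Fin.val h'
    rw [H.val_edge hi, H.val_crossing hj] at this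
    omega
  have hne' : ∀ j < i, H.idx (2 * H.p + i) ≠ H.idx (2 * H.p + j) := fun j hj h' => by
    have := congrArg Fin.val h'
    rw [H.val_edge hi, H.val_edge (by omega)] at this
    omega
  have hfix : H.outPerm i (H.idx (2 * H.p + i)) = H.idx (2 * H.p + i) :=
    insertMany_fixed rfl fun j hj => ⟨hne _ (H.tailAt_lt (by omega)), hne' j hj⟩
  have hfix' : H.inPerm i (H.idx (2 * H.p + i)) = H.idx (2 * H.p + i) := by
    refine insertMany_fixed (insertMany_fixed rfl fun j hj => ⟨hne j hj, fun h' => ?_⟩)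
      fun j hj => ⟨hne _ (H.headAt_lt (by omega)), hne' j hj⟩
    have := congrArg Fin.val h'
    rw [H.val_edge hi, H.val_dummy hj] at this
    omega
  obtain ⟨k6, k7⟩ := eff_insertAfter (a := 6) (b := 7) (by norm_num) (s := s₁)
    (f := H.outPerm i) (by rw [e1]; exact h.arr6) (by rw [e1]; exact h.arr7) e8 e9 hfix
    (hne _ ht).symm
  set s₂ := (insertAfter 6 7).eff s₁ with hs₂
  have f2 : ∀ a, a ≠ 6 → a ≠ 7 → s₂.arr a = s.arr a := fun a ha ha' => by
    rw [hs₂, insertAfter_arr ha ha', e1]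
  have f7 : s₂.reg 7 = i := by rw [hs₂, insertAfter_reg (by norm_num), e7]
  have f9 : s₂.reg 9 = (H.idx (2 * H.p + i) : ℕ) := by
    rw [hs₂, insertAfter_reg (by norm_num), e9]
  clear_value s₂
  set s₃ := s₂.setReg 8 (s₂.arr 1 (s₂.reg 7).toNat) with hs₃
  have g8 : s₃.reg 8 = (H.idx (H.headAt i) : ℕ) := by
    rw [H.val_crossing hh, hs₃, State.reg_setReg, if_pos rfl, f7, f2 1 (by norm_num) (by norm_num),
      h.untouched 1 (by norm_num), input_arr_one, Int.toNat_natCast]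
  have g9 : s₃.reg 9 = (H.idx (2 * H.p + i) : ℕ) := by
    rw [hs₃, State.reg_setReg, if_neg (by norm_num), f9]
  have g1 : s₃.arr = s₂.arr := rfl
  clear_value s₃
  obtain ⟨k8, k9⟩ := eff_insertAfter (a := 8) (b := 9) (by norm_num) (s := s₃)
    (f := H.inPerm i)
    (by intro x; rw [g1, f2 8 (by norm_num) (by norm_num)]; exact h.arr8 x)
    (by intro x; rw [g1, f2 9 (by norm_num) (by norm_num)]; exact h.arr9 x) g8 g9 hfix'
    (hne _ hh).symm
  refine ⟨hu, ?_, ?_, k8, k9⟩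
  · intro x
    rw [insertAfter_arr (by norm_num) (by norm_num), g1]
    exact k6 x
  · intro x
    rw [insertAfter_arr (by norm_num) (by norm_num), g1]
    exact k7 x

theorem IdentityWritten.dummiesInserted {arr : ℕ → ℕ → ℤ} (h : IdentityWritten H H.size arr) :
    DummiesInserted H 0 arr :=
  ⟨h.1, fun x => (h.2 x x.isLt).1, fun x => (h.2 x x.isLt).2.1, fun x => (h.2 x x.isLt).2.2.1,
    fun x => (h.2 x x.isLt).2.2.2⟩

theorem DummiesInserted.edgesInserted {arr : ℕ → ℕ → ℤ} (h : DummiesInserted H H.p arr) :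
    EdgesInserted H 0 arr :=
  ⟨h.untouched, h.arr6, h.arr7, h.arr8, h.arr9⟩

theorem EdgesInserted.outputWritten {arr : ℕ → ℕ → ℤ} (h : EdgesInserted H H.q arr) (k : ℕ) :
    OutputWritten (H.outPerm H.q) (H.inPerm H.q) H.p k 0 arr := by
  have h0 : ∀ a < 6, 2 ≤ a → ∀ F : Fin H.size → ℕ → ℤ, RowsWritten k arr a 0 F := by
    intro a ha ha' F x j _
    rw [h.untouched a ha]
    simp [HasseDiagram.input, show a ≠ 0 by omega, show a ≠ 1 by omega]
  exact ⟨h.arr6, h.arr7, h.arr8, h.arr9, h0 2 (by norm_num) (by norm_num) _,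
    h0 3 (by norm_num) (by norm_num) _, h0 4 (by norm_num) (by norm_num) _,
    h0 5 (by norm_num) (by norm_num) _⟩

theorem input_arraysBounded {M : ℕ} (hM : H.p ≤ M) : ArraysBounded M H.input := by
  have key : ∀ m : ℕ, m ≤ M → (0 : ℤ) ≤ m ∧ (m : ℤ) ≤ (M : ℤ) ^ 4 := fun m hm =>
    ⟨by positivity, by exact_mod_cast hm.trans (Nat.le_self_pow (by norm_num) M)⟩
  intro a _ i
  have htail : H.tailAt i ≤ H.p := by
    by_cases h : i < H.q
    · exact (H.tailAt_lt h).le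
    · rw [HasseDiagram.tailAt, List.getD_eq_default _ _ (by
        rw [List.length_map]; exact not_lt.1 h)]
      exact Nat.zero_le _
  have hhead : H.headAt i ≤ H.p := by
    by_cases h : i < H.q
    · exact (H.headAt_lt h).le
    · rw [HasseDiagram.headAt, List.getD_eq_default _ _ (by
        rw [List.length_map]; exact not_lt.1 h)]
      exact Nat.zero_le _
  by_cases h0 : a = 0
  · subst h0
    rw [input_arr_zero]
    exact key _ (htail.trans hM)
  by_cases h1 : a = 1
  · subst h1
    rw [input_arr_one]
    exact key _ (hhead.trans hM)
  · have : H.input.arr a i = ((0 : ℕ) : ℤ) := by simp [HasseDiagram.input, h0, h1]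
    rw [this]
    exact key 0 (Nat.zero_le _)

/-- The analysis accepts only the constants `0` and `1`, so the assignment of `k` is verified by
hand before it takes over. -/
theorem setup_exec {M k : ℕ} (hM : 2 ≤ M) (hp : H.p ≤ M) (hq : H.q ≤ M) (hk : k ≤ M) :
    ∃ t s, Exec ((M : ℤ) ^ 100) (seq (const 5 k) setup) H.input t s ∧
      t ≤ 1 + setup.cost ∧ HasParams H.size H.q H.p k s ∧ ArraysBounded M s ∧
        IdentityWritten H 0 s.arr := by
  have hk' : |(k : ℤ)| ≤ (M : ℤ) ^ 100 := by
    rw [abs_of_nonneg (by positivity)]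
    exact_mod_cast hk.trans (Nat.le_self_pow (by norm_num) M)
  obtain ⟨b', hb'⟩ := Option.isSome_iff_exists.1 setup_analyze
  have hob : Obeys M inputBounds (H.input.setReg 5 k) := by
    intro r e pos hr
    rw [inputBounds] at hr
    split_ifs at hr with hr2
    simp only [Option.some.injEq, Prod.mk.injEq] at hr
    obtain ⟨rfl, rfl⟩ := hr
    have key : ∀ m : ℕ, m ≤ M → (H.input.setReg 5 k).reg r = m →
        |(H.input.setReg 5 k).reg r| ≤ (M : ℤ) ^ 1 ∧
          (true → 0 ≤ (H.input.setReg 5 k).reg r) := by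
      intro m hm hr
      rw [hr, pow_one, abs_of_nonneg (by positivity)]
      exact ⟨by exact_mod_cast hm, fun _ => by positivity⟩
    interval_cases r
    · exact key _ hp (by simp [HasseDiagram.input])
    · exact key _ hq (by simp [HasseDiagram.input])
  obtain ⟨⟨t, ht, he⟩, -, ha⟩ := analyze_sound hM (by norm_num) hb' hob
    (input_arraysBounded hp)
  refine ⟨_, _, Exec.seq (Exec.const hk') he, by omega, ?_, ha, ?_, ?_⟩
  · constructor <;> simp [setup, eff, HasseDiagram.input, HasseDiagram.size]
    ring
  · intro a ha
    rw [eff_arr_of_notMem (by simp [setup, arrsWritten])]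
    rfl
  · intro j hj
    omega

/-- A bound for the running time per element and edge. -/
def timeBound : ℕ :=
  setup.cost + 13 + 3 * (identityBody.cost + 3) + (dummyBody.cost + 3) + (edgeBody.cost + 3) +
    3 * (outputBody.cost + 3)

theorem profileProgram_exec {k : ℕ} (hk : 6 ≤ k) (H : HasseDiagram X) :
    ∃ t s, Exec (((H.p + H.q + 2) ^ (k * 100) : ℕ) : ℤ) (profileProgram k) H.input t s ∧
      t ≤ timeBound * max 1 (H.p + H.q) ∧
        s.Outputs (profiles (H.outPerm H.q) (H.inPerm H.q) H.p k) := by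
  set N := H.p + H.q + 2 with hN
  -- This `M` bounds `k`, by `k < N ^ k`, and also the size `2p + q + 1 ≤ N ^ 2`. Words up to `M ^
  -- 100` give the exponent `k * 100`, which does not depend on the poset.
  set M := N ^ k with hMdef
  have h2N : 2 ≤ N := by omega
  have hNM : N ^ 2 ≤ M := Nat.pow_le_pow_right (by omega) (by omega)
  have hn : H.size ≤ M := by
    refine le_trans ?_ hNM
    rw [HasseDiagram.size, sq]
    nlinarith
  have hkM : k ≤ M := (Nat.lt_pow_self (by omega)).le
  have hM : 2 ≤ M := by nlinarith
  have hp : H.p ≤ M := by rw [HasseDiagram.size] at hn; omega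
  have hq : H.q ≤ M := by rw [HasseDiagram.size] at hn; omega
  have hW : (((H.p + H.q + 2) ^ (k * 100) : ℕ) : ℤ) = (M : ℤ) ^ 100 := by
    rw [pow_mul, hMdef]; push_cast; rfl
  rw [hW]
  obtain ⟨t₀, s₀, e₀, ht₀, hs₀, ha₀, hi₀⟩ := setup_exec (H := H) hM hp hq hkM
  -- The setup is split only because the sequence in `profileProgram` is bracketed to the right.
  cases e₀ with
  | seq e₀ e₀' =>
  obtain ⟨t₁, s₁, e₁, ht₁, hs₁, ha₁, hi₁⟩ := forLoop_exec hM (by norm_num) hn hq hp hkM hn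
    identityBody_analyze (by decide) (I := IdentityWritten H)
    (fun i _ s _ h7 h => identityBody_written h7 h) hs₀ hs₀.reg0 ha₀ hi₀
  obtain ⟨t₂, s₂, e₂, ht₂, hs₂, ha₂, hi₂⟩ := forLoop_exec hM (by norm_num) hn hq hp hkM hp
    dummyBody_analyze (by decide) (I := DummiesInserted H)
    (fun i hi s hs h7 h => dummyBody_inserted hi hs h7 h) hs₁ hs₁.reg2 ha₁ hi₁.dummiesInserted
  obtain ⟨t₃, s₃, e₃, ht₃, hs₃, ha₃, hi₃⟩ := forLoop_exec hM (by norm_num) hn hq hp hkM hq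
    edgeBody_analyze (by decide) (I := EdgesInserted H)
    (fun i hi s hs h7 h => edgeBody_inserted hi hs h7 h) hs₂ hs₂.reg1 ha₂ hi₂.edgesInserted
  obtain ⟨t₄, s₄, e₄, ht₄, hs₄, ha₄, hi₄⟩ := forLoop_exec hM (by norm_num) hn hq hp hkM hn
    outputBody_analyze outputBody_regsWritten
    (I := OutputWritten (H.outPerm H.q) (H.inPerm H.q) H.p k)
    (fun i hi s hs h7 h => outputBody_written hk hi hs h7 h) hs₃ hs₃.reg0 ha₃
    (hi₃.outputWritten k)
  refine ⟨_, s₄, Exec.seq e₀ (Exec.seq e₀' (Exec.seq e₁ (Exec.seq e₂ (Exec.seq e₃ e₄)))), ?_,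
    outputs_profiles hs₄.reg0 hi₄⟩
  set m := max 1 (H.p + H.q) with hm
  have hm1 : 1 ≤ m := le_max_left _ _
  have hpm : H.p ≤ m := le_trans (Nat.le_add_right _ _) (le_max_right _ _)
  have hqm : H.q ≤ m := le_trans (Nat.le_add_left _ _) (le_max_right _ _)
  have hnm : H.size ≤ 3 * m := by
    have : H.p + H.q ≤ m := le_max_right _ _
    rw [HasseDiagram.size]
    omega
  have b₁ := Nat.mul_le_mul_right (identityBody.cost + 3) hnm
  have b₂ := Nat.mul_le_mul_right (dummyBody.cost + 3) hpm
  have b₃ := Nat.mul_le_mul_right (edgeBody.cost + 3) hqm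
  have b₄ := Nat.mul_le_mul_right (outputBody.cost + 3) hnm
  -- The `13` collects the assignment of `k` and three steps for each of the four loops.
  have b₀ := Nat.mul_le_mul_left (setup.cost + 13) hm1
  have hsum : timeBound * m = (setup.cost + 13) * m + 3 * m * (identityBody.cost + 3) +
      m * (dummyBody.cost + 3) + m * (edgeBody.cost + 3) + 3 * m * (outputBody.cost + 3) := by
    rw [timeBound]; ring
  rw [hsum]
  omega

end Program

end StableMatching

/-! ### The main theorem -/

theorem mainTheorem4 :
    ∃ C : ℕ, ∀ k : ℕ, 6 ≤ k →
      ∃ (P : Program) (T B : ℕ),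
        ∀ (X : Type*) [PartialOrder X] [Finite X] (H : HasseDiagram X),
          ∃ (n : ℕ) (I : SMInstance n) (A : Profiles k n),
            1 ≤ n ∧ 2 * n ≤ C * max 1 (H.p + H.q) ∧
            I.InducedBy A ∧ I.Realizes X ∧
            ∃ (t : ℕ) (s : State),
              Exec (((H.p + H.q + 2) ^ B : ℕ) : ℤ) P H.input t s ∧
              t ≤ T * max 1 (H.p + H.q) ∧ s.Outputs A := by
  -- There are `2 (2p + q + 1)` agents, and `2p + q + 1` is at most `3 * max 1 (p + q)`.
  refine ⟨6, fun k hk => ⟨Program.profileProgram k, Program.timeBound, k * 100, ?_⟩⟩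
  intro X _ _ H
  obtain ⟨I, hI, hR⟩ := H.exists_instance hk
  refine ⟨H.size, I, _, by rw [HasseDiagram.size]; omega, ?_, hI, hR,
    Program.profileProgram_exec hk H⟩
  rw [HasseDiagram.size]
  have := le_max_left 1 (H.p + H.q)
  have := le_max_right 1 (H.p + H.q)
  omega
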